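/- Let $f\colon(\mathbb C,0)\to(\mathbb C,0)$ be a germ of antiholomorphic map that is parabolic, i.e. $0$ is an isolated fixed point and $|\partial f/\partial\bar z(0)|=1$. Such an $f$ is formally conjugate to a series $\bar w+\sum_{m\ge k+1}A_m\bar w^m$ with real coefficients and $A_{k+1}\neq 0$, for a unique $k\ge 1$, the codimension of $f$; if $k$ is even, assume that $f$ is of positive type, i.e. $A_{k+1}>0$. Let $\sigma(z)=\bar z$, $\Sigma(W)=\overline W$ and $T_C(W)=W+C$. After a holomorphic change of coordinate, $f$ is prenormalized: $$f(z)=\bar z+\tfrac12\bar z^{k+1}+\left(\tfrac{k+1}{8}-\tfrac b2\right)\bar z^{2k+1}+o(z^{2k+1}),\qquad b\in\mathbb R .$$ For $j\in\mathbb Z/2k\mathbb Z$ let $S_j$ be the Fatou petal of $g=f\circ f$ around the direction $e^{ij\pi/k}$ (repelling for $j$ even, attracting for $j$ odd): with the time coordinate $Z_j(z)=-\frac1{kz^k}+b\log z-\frac{ij\pi b}{k}$ in the sector $|\arg z-\frac{j\pi}{k}|<\frac{\pi}{k}$, it consists of the points whose $g$-orbit, within a small disk in this sector, reaches the half-plane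 $\operatorname{Re}Z_j>R$ forwards ($j$ odd), or $\operatorname{Re}Z_j<-R$ backwards ($j$ even). Fatou coordinates of $f$ are univalent functions $\varphi_j$ on $S_j$ with $\varphi_j\circ f=\Sigma\circ T_{1/2}\circ\varphi_{-j}$ wherever both sides are defined. They define the transition functions, for $j=1,\dots,k$, $$\Psi_j=\varphi_j\circ\varphi_{j-1}^{-1}\ (j\text{ odd}),\qquad \Psi_j=\varphi_{j-1}\circ\varphi_j^{-1}\ (j\text{ even}),$$ on the part of $S_{j-1}\cap S_j$ between the directions $j-1$ and $j$; $\Psi_j$ is regarded as a germ at the upper end $\operatorname{Im}W\to+\infty$ ($j$ odd) or the lower end $\operatorname{Im}W\to-\infty$ ($j$ even). They are normalized if the constant term of the Fourier expansion of $\Psi_j-\mathrm{id}$ is $-i\pi b/k$ for $j$ odd and $i\pi b/k$ for $j$ even. The analytic invariant $[\Psi_1,\dots,\Psi_k]$ of $f$ is the class of its normalized transition functions under the equivalence relation generated by $(\Psi_j)\sim(T_C\circ\Psi_j\circ T_{-C})$, $C\in\mathbb R$, and, for $k$ even, $(\Psi_j)\cong(\Sigma\circ T_{1/2}\circ\Psi_{k-j+1}\circ\Sigma\circ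 T_{-1/2})$. The triple $(k,b,[\Psi_1,\dots,\Psi_k])$ is the modulus of $f$. Let $n\ge 3$ be odd. Then: 1. $f$ has exactly one formal antiholomorphic $n$-th root, i.e. there is exactly one formal power series $P(\bar z)$ without constant term whose $n$-th iterate is the Taylor series of $f$. 2. If $(k,b,[\Psi_1,\dots,\Psi_k])$ is the modulus of $f$, then $f$ has an antiholomorphic $n$-th root, i.e. there is a germ $h$ of antiholomorphic map fixing $0$ with $h^{\circ n}=f$, if and only if $$\Psi_j\circ T_{1/n}=T_{1/n}\circ\Psi_j\qquad\text{for every } j=1,\dots,k .$$ -/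

import Mathlib

open Filter Topology Asymptotics ComplexConjugate

noncomputable section

namespace AntiholParabolic

/-! ### Antiholomorphic germs and antiholomorphic formal series -/

/-- `f` is (a representative of) a germ at `0` of an antiholomorphic map fixing `0`:
`f ∘ σ` is holomorphic near `0`, where `σ` is complex conjugation. -/
def IsAntiholGerm (f : ℂ → ℂ) : Prop :=
  f 0 = 0 ∧ AnalyticAt ℂ (fun z => f (conj z)) 0

/-- An antiholomorphic parabolic germ: `|∂f/∂z̄ (0)| = 1` and `0` is an isolated fixed point. -/
def IsParabolic (f : ℂ → ℂ) : Prop :=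
  IsAntiholGerm f ∧ ‖deriv (fun z => f (conj z)) 0‖ = 1 ∧ ∀ᶠ z in 𝓝[≠] (0 : ℂ), f z ≠ z

/-- The Taylor series `F` of `f` in the variable `z̄`, that is `f(z) = F(z̄)`. -/
def antiSeries (f : ℂ → ℂ) : PowerSeries ℂ :=
  PowerSeries.mk fun m => iteratedDeriv m (fun z => f (conj z)) 0 / (m.factorial : ℂ)

/-- Conjugation of the coefficients of a formal series. -/
def conjSeries (P : PowerSeries ℂ) : PowerSeries ℂ :=
  PowerSeries.map (starRingEnd ℂ) P

/-- Iterates of the formal antiholomorphic map `z ↦ P(z̄)`. If `R = antiIterate P m`, the `m`-th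
iterate is `z ↦ R(z)` for `m` even and `z ↦ R(z̄)` for `m` odd. One more iteration gives
`P(conj (R(w))) = P(R̄(w̄))`, where `R̄` has the conjugate coefficients. -/
def antiIterate (P : PowerSeries ℂ) : ℕ → PowerSeries ℂ
  | 0 => PowerSeries.X
  | m + 1 => PowerSeries.subst (conjSeries (antiIterate P m)) P

/-- For `n` odd: `z ↦ P(z̄)` is a formal antiholomorphic `n`-th root of `f`. -/
def IsFormalRoot (n : ℕ) (f : ℂ → ℂ) (P : PowerSeries ℂ) : Prop :=
  PowerSeries.constantCoeff P = 0 ∧ antiIterate P n = antiSeries f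

/-- `h` is a (convergent) antiholomorphic `n`-th root of the germ `f`. -/
def IsRoot (n : ℕ) (f h : ℂ → ℂ) : Prop :=
  IsAntiholGerm h ∧ h^[n] =ᶠ[𝓝 0] f

/-! ### Codimension and type -/

/-- `f` is formally conjugate to `w ↦ A(w̄)`: there is a formal change of coordinate `H` with
`H(F(z̄)) = A(conj (H(z))) = A(H̄(z̄))`. -/
def FormallyConjugate (f : ℂ → ℂ) (A : PowerSeries ℂ) : Prop :=
  ∃ H : PowerSeries ℂ, PowerSeries.constantCoeff H = 0 ∧ PowerSeries.coeff 1 H ≠ 0 ∧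
    PowerSeries.subst (antiSeries f) H = PowerSeries.subst (conjSeries H) A

/-- `f` is formally conjugate to a series `A(w̄) = w̄ + A_{k+1} w̄^{k+1} + ⋯` with real
coefficients. -/
def IsRealForm (f : ℂ → ℂ) (k : ℕ) (A : PowerSeries ℝ) : Prop :=
  FormallyConjugate f (PowerSeries.map (algebraMap ℝ ℂ) A) ∧
    PowerSeries.coeff 0 A = 0 ∧ PowerSeries.coeff 1 A = 1 ∧
    ∀ m, 2 ≤ m → m ≤ k → PowerSeries.coeff m A = 0

/-- `f` has codimension `k`. -/
def HasCodim (f : ℂ → ℂ) (k : ℕ) : Prop :=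
  1 ≤ k ∧ ∃ A : PowerSeries ℝ, IsRealForm f k A ∧ PowerSeries.coeff (k + 1) A ≠ 0

/-- `f`, of even codimension `k`, is of positive type. -/
def IsPositiveType (f : ℂ → ℂ) (k : ℕ) : Prop :=
  ∃ A : PowerSeries ℝ, IsRealForm f k A ∧ 0 < PowerSeries.coeff (k + 1) A

/-! ### Prenormalization -/

/-- `f(z) = z̄ + z̄^{k+1}/2 + ((k+1)/8 - b/2) z̄^{2k+1} + o(z^{2k+1})`. -/
def IsPrenormalized (f : ℂ → ℂ) (k : ℕ) (b : ℝ) : Prop :=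
  IsAntiholGerm f ∧
    (fun z : ℂ => f z - (conj z + 1 / 2 * conj z ^ (k + 1) +
      (((k : ℂ) + 1) / 8 - (b : ℂ) / 2) * conj z ^ (2 * k + 1)))
      =o[𝓝 0] fun z : ℂ => z ^ (2 * k + 1)

/-- The germs `f` and `f'` are conjugate by a germ of holomorphic diffeomorphism. -/
def AnalyticallyConjugate (f f' : ℂ → ℂ) : Prop :=
  ∃ h : ℂ → ℂ, AnalyticAt ℂ h 0 ∧ h 0 = 0 ∧ deriv h 0 ≠ 0 ∧ ∀ᶠ z in 𝓝 (0 : ℂ), h (f z) = f' (h z)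

/-! ### Time coordinates, petals and Fatou coordinates

The index `j : ℤ` is understood modulo `2k`; the direction of index `j` is `e^{ijπ/k}`. For
`f ∘ f` it is repelling for `j` even and attracting for `j` odd. -/

/-- The open sector of half-opening `α` around the direction of argument `θ`. -/
def sector (θ α : ℝ) : Set ℂ :=
  {z | z ≠ 0 ∧ |(z * Complex.exp (-(θ : ℂ) * Complex.I)).arg| < α}

/-- The part in the disk `|z| < r` of the sector of half-opening `π/k` around `e^{ijπ/k}`, on which
the time coordinate `Z_j` is used. -/
def chartDomain (k : ℕ) (r : ℝ) (j : ℤ) : Set ℂ :=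
  sector (j * Real.pi / k) (Real.pi / k) ∩ Metric.ball 0 r

/-- The time coordinate `Z_j(z) = -1/(k z^k) + b log z - ijπb/k`, with the branch of the logarithm
whose argument is near `jπ/k`, so that `log z - ijπ/k = Log (z e^{-ijπ/k})`. -/
def timeCoord (k : ℕ) (b : ℝ) (j : ℤ) (z : ℂ) : ℂ :=
  -1 / ((k : ℂ) * z ^ k) +
    (b : ℂ) * Complex.log (z * Complex.exp (-((j * Real.pi / k : ℝ) : ℂ) * Complex.I))

/-- The part of the chart `Z_j` over a left (`j` even) or right (`j` odd) half-plane. -/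
def halfPetal (k : ℕ) (b r R : ℝ) (j : ℤ) : Set ℂ :=
  {z | z ∈ chartDomain k r j ∧
    ((Even j ∧ (timeCoord k b j z).re < -R) ∨ (Odd j ∧ R < (timeCoord k b j z).re))}

/-- The petal `S_j` of `f`: all points of the orbits of `g = f ∘ f`, inside the chart domain, that
meet the half-plane. For `j` odd these are the points whose forward `g`-orbit reaches the half-plane
without leaving the chart domain; for `j` even, those reached from the half-plane. Decreasing `r` or
increasing `R` shrinks the petals. -/
def petal (f : ℂ → ℂ) (k : ℕ) (b r R : ℝ) (j : ℤ) : Set ℂ :=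
  {z | (Even j ∧ ∃ w ∈ halfPetal k b r R j, ∃ N : ℕ,
          (∀ i ≤ N, (f ∘ f)^[i] w ∈ chartDomain k r j) ∧ (f ∘ f)^[N] w = z) ∨
       (Odd j ∧ ∃ N : ℕ,
          (∀ i ≤ N, (f ∘ f)^[i] z ∈ chartDomain k r j) ∧ (f ∘ f)^[N] z ∈ halfPetal k b r R j)}

/-- Fatou coordinates of `f`, written in the variable `z`, that is `φ_j = Φ_j ∘ Z_j`: univalent on
the petal `S_j`, and carrying `f : S_{-j} → S_j` to `Σ ∘ T_{1/2} : W ↦ conj W + 1/2`. -/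
structure IsFatouSystem (f : ℂ → ℂ) (k : ℕ) (b r R : ℝ) (φ : ℤ → ℂ → ℂ) : Prop where
  periodic : ∀ j, φ (j + 2 * k) = φ j
  holomorphic : ∀ j, DifferentiableOn ℂ (φ j) (petal f k b r R j)
  injective : ∀ j, Set.InjOn (φ j) (petal f k b r R j)
  conjugates : ∀ j, ∀ z ∈ petal f k b r R (-j), f z ∈ petal f k b r R j →
    φ j (f z) = conj (φ (-j) z) + 1 / 2

/-! ### Transition functions and the analytic invariant -/

/-- The ends at which the transition functions are defined: upper half-planes for `j` odd, lower
half-planes for `j` even. A transition function is a germ along this filter. -/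
def endFilter (j : ℕ) : Filter ℂ :=
  if Odd j then comap Complex.im atTop else comap Complex.im atBot

/-- The overlap of `S_{j-1}` and `S_j` lying between the directions `j - 1` and `j`. -/
def overlap (f : ℂ → ℂ) (k : ℕ) (b r R : ℝ) (j : ℕ) : Set ℂ :=
  petal f k b r R ((j : ℤ) - 1) ∩ petal f k b r R (j : ℤ) ∩
    sector (((j : ℝ) - 1 / 2) * Real.pi / k) (Real.pi / (2 * k))

/-- `(Ψ_1, …, Ψ_k)` are the transition functions defined by the Fatou coordinates `φ`:
`Ψ_j = φ_j ∘ φ_{j-1}⁻¹` for `j` odd and `Ψ_j = φ_{j-1} ∘ φ_j⁻¹` for `j` even. -/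
def IsTransitionOf (f : ℂ → ℂ) (k : ℕ) (b r R : ℝ) (φ : ℤ → ℂ → ℂ) (Ψ : ℕ → ℂ → ℂ) : Prop :=
  ∀ j : ℕ, 1 ≤ j → j ≤ k →
    (Odd j → ∀ᶠ W in endFilter j, ∃ z ∈ overlap f k b r R j,
      φ ((j : ℤ) - 1) z = W ∧ φ (j : ℤ) z = Ψ j W) ∧
    (Even j → ∀ᶠ W in endFilter j, ∃ z ∈ overlap f k b r R j,
      φ (j : ℤ) z = W ∧ φ ((j : ℤ) - 1) z = Ψ j W)

/-- The constant terms of the Fourier expansions of `Ψ_j - id` are `-iπb/k` for `j` odd and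
`iπb/k` for `j` even. -/
def IsNormalized (k : ℕ) (b : ℝ) (Ψ : ℕ → ℂ → ℂ) : Prop :=
  ∀ j : ℕ, 1 ≤ j → j ≤ k →
    Tendsto (fun W => Ψ j W - W) (endFilter j)
      (𝓝 ((if Odd j then -1 else 1) * (Complex.I * Real.pi * b / k)))

/-- `(Ψ_1, …, Ψ_k)` are normalized transition functions of `f` (of codimension `k` and formal
invariant `b`), computed in some prenormalizing coordinate. -/
def IsNormalizedTransition (f : ℂ → ℂ) (k : ℕ) (b : ℝ) (Ψ : ℕ → ℂ → ℂ) : Prop :=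
  ∃ f' : ℂ → ℂ, AnalyticallyConjugate f f' ∧ IsPrenormalized f' k b ∧
    ∃ r > 0, ∃ R > 0, ∃ φ : ℤ → ℂ → ℂ,
      IsFatouSystem f' k b r R φ ∧ IsTransitionOf f' k b r R φ Ψ ∧ IsNormalized k b Ψ

/-- The relations identifying tuples of transition functions: simultaneous conjugation by a real
translation, and, for `k` even, `Ψ'_j = Σ ∘ T_{1/2} ∘ Ψ_{k-j+1} ∘ Σ ∘ T_{-1/2}`. -/
def ModulusRel (k : ℕ) (Ψ Ψ' : ℕ → ℂ → ℂ) : Prop :=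
  (∃ C : ℝ, ∀ j : ℕ, 1 ≤ j → j ≤ k → ∀ᶠ W in endFilter j, Ψ j W = Ψ' j (W - C) + C) ∨
  (Even k ∧ ∀ j : ℕ, 1 ≤ j → j ≤ k → ∀ᶠ W in endFilter j,
    Ψ' j W = conj (Ψ (k + 1 - j) (conj (W - 1 / 2)) + 1 / 2))

/-- `(k, b, [Ψ_1, …, Ψ_k])` is the modulus of classification of `f`. -/
def IsModulus (f : ℂ → ℂ) (k : ℕ) (b : ℝ) (Ψ : ℕ → ℂ → ℂ) : Prop :=
  ∃ Ψ₀, IsNormalizedTransition f k b Ψ₀ ∧ Relation.EqvGen (ModulusRel k) Ψ₀ Ψ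

/-- `Ψ_j ∘ T_c = T_c ∘ Ψ_j`. -/
def CommutesWithTranslation (j : ℕ) (ψ : ℂ → ℂ) (c : ℂ) : Prop :=
  ∀ᶠ W in endFilter j, ψ (W + c) = ψ W + c

end AntiholParabolic

end

noncomputable section

namespace AntiholParabolic

/-! ### Formal antiholomorphic roots -/

section FormalRoots

open PowerSeries Finset

/-! Formal root. Write n = 2l + 1. If two series with the same unimodular linear coefficient u agree
below degree m ≥ 2 and differ by d in degree m, their n-th iterates differ there by (l + 1)d + l
u^(m+1) d̄ (`coeff_antiIterate_odd_sub`). This real-linear map of d is bijective because l + 1 > l,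
so the coefficients of the root are determined one after the other (`existsUnique_antiIterate_eq`).

Analytic root. In the chart ζ = ±(-1/(k z^k)) of a sector, a petal contains a neighbourhood of
infinity in the plane slit along the negative axis (the filter `far`). There f ∘ f, or its inverse
at a repelling direction, differs from the unit translation by O(|ζ|^(-1-1/k)) in the coordinate ζ -
β log ζ. This error is summable along orbits, so a Fatou coordinate asymptotic to ζ - β log ζ
exists. Any other univalent solution of the Abel equation differs from it by a constant: the
comparison map extends to an injective entire function commuting with W ↦ W + 1, hence is a
translation (`exists_isAsympLog_of_injOn`). So every admissible system of Fatou coordinates has the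
expected asymptotics and can be inverted near infinity.

If h is a root, h ∘ h is tangent to the identity with leading coefficient 1/n and commutes with f ∘
f. Thus φ_j ∘ (h ∘ h) - φ_j is invariant along orbits and tends to 1/n, so it equals 1/n
(`eventually_root`); comparing adjacent petals, every Ψ_j commutes with T_{1/n}.

Conversely, put τ = -l/n, so that 1/2 + τ = 1/(2n). The translation by τ lifts to each petal.
Commutation with the Ψ_j glues the lifts across the overlaps 1, …, k, and the symmetry f : S_{-j} →
S_j handles the other k. The result extends holomorphically over 0 to a germ P
(`exists_analyticAt_translation`), and f ∘ P acts as Σ ∘ T_{1/(2n)} in the Fatou coordinates, so its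
n-th iterate is f.

Finally, neither the existence of a root nor the commutation condition changes under holomorphic
conjugacy and under the relations defining the modulus, respectively. -/

lemma X_pow_dvd_sub {a b : PowerSeries ℂ} {m : ℕ} (h : ∀ i < m, coeff i a = coeff i b) :
    (X : PowerSeries ℂ) ^ m ∣ a - b := by
  rw [X_pow_dvd_iff]
  intro i hi
  rw [map_sub, h i hi, sub_self]

lemma coeff_eq_of_X_pow_dvd_sub {a b : PowerSeries ℂ} {m i : ℕ}
    (h : (X : PowerSeries ℂ) ^ m ∣ a - b) (hi : i < m) : coeff i a = coeff i b := by
  have := X_pow_dvd_iff.1 h i hi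
  rwa [map_sub, sub_eq_zero] at this

/-- Both series vanish at the origin, so each extra factor in a power gains one order. A
perturbation in degree m is therefore invisible in degree m to every power beyond the first. -/
lemma X_pow_dvd_pow_sub_pow {a b : PowerSeries ℂ} {m : ℕ} (ha : constantCoeff a = 0)
    (hb : constantCoeff b = 0) (h : (X : PowerSeries ℂ) ^ m ∣ a - b) (i : ℕ) :
    (X : PowerSeries ℂ) ^ (m + 1) ∣ a ^ (i + 2) - b ^ (i + 2) := by
  have h1 : (X : PowerSeries ℂ) ^ m ∣ a ^ (i + 1) - b ^ (i + 1) :=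
    h.trans (sub_dvd_pow_sub_pow a b (i + 1))
  have h2 : a ^ (i + 2) - b ^ (i + 2) = (a ^ (i + 1) - b ^ (i + 1)) * a + (a - b) * b * b ^ i := by
    ring
  rw [h2, pow_succ]
  exact dvd_add (mul_dvd_mul h1 (X_dvd_iff.2 ha))
    ((mul_dvd_mul h (X_dvd_iff.2 hb)).mul_right _)

lemma coeff_pow_eq_zero {a : PowerSeries ℂ} (ha : constantCoeff a = 0) {m i : ℕ} (h : m < i) :
    coeff m (a ^ i) = 0 :=
  X_pow_dvd_iff.1 (pow_dvd_pow_of_dvd (X_dvd_iff.2 ha) i) m h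

lemma coeff_pow_self {a : PowerSeries ℂ} (ha : constantCoeff a = 0) (m : ℕ) :
    coeff m (a ^ m) = coeff 1 a ^ m := by
  obtain ⟨c, rfl⟩ := X_dvd_iff.2 ha
  rw [mul_pow, coeff_X_pow_mul', if_pos le_rfl, Nat.sub_self, coeff_zero_eq_constantCoeff_apply,
    map_pow]
  congr 1
  simp

lemma coeff_subst_eq_sum {a : PowerSeries ℂ} (ha : constantCoeff a = 0) (P : PowerSeries ℂ)
    (m : ℕ) : coeff m (P.subst a) = ∑ i ∈ range (m + 1), coeff i P * coeff m (a ^ i) := by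
  rw [coeff_subst' (HasSubst.of_constantCoeff_zero' ha)]
  rw [finsum_eq_sum_of_support_subset]
  · rfl
  · intro i hi
    by_contra hc
    apply hi
    have : m < i := by simpa [Nat.lt_succ_iff] using hc
    simp [coeff_pow_eq_zero ha this]

lemma constantCoeff_subst_of_zero {a P : PowerSeries ℂ} (ha : constantCoeff a = 0)
    (hP : constantCoeff P = 0) : constantCoeff (P.subst a) = 0 := by
  rw [← coeff_zero_eq_constantCoeff_apply, coeff_subst_eq_sum ha]
  simp [hP]

lemma coeff_one_subst {a P : PowerSeries ℂ} (ha : constantCoeff a = 0) :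
    coeff 1 (P.subst a) = coeff 1 P * coeff 1 a := by
  rw [coeff_subst_eq_sum ha]
  simp [sum_range_succ]

lemma coeff_subst_congr {a b P Q : PowerSeries ℂ} (ha : constantCoeff a = 0)
    (hb : constantCoeff b = 0) {m : ℕ}
    (hab : ∀ i < m, coeff i a = coeff i b) (hPQ : ∀ i < m, coeff i P = coeff i Q) :
    ∀ l < m, coeff l (P.subst a) = coeff l (Q.subst b) := by
  intro l hl
  rw [coeff_subst_eq_sum ha, coeff_subst_eq_sum hb]
  refine sum_congr rfl fun i hi => ?_
  rw [hPQ i (by grind), coeff_eq_of_X_pow_dvd_sub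
    ((X_pow_dvd_sub hab).trans (sub_dvd_pow_sub_pow a b i)) hl]

/-- Only two terms of the substitution sum change in degree m: the linear one, through the inner
series, and the one of index m, through the outer coefficient. The terms 2 ≤ i < m are unaffected by
`X_pow_dvd_pow_sub_pow`. -/
lemma coeff_subst_sub {a b P Q : PowerSeries ℂ} (ha : constantCoeff a = 0)
    (hb : constantCoeff b = 0) {m : ℕ} (hm : 2 ≤ m)
    (hab : ∀ i < m, coeff i a = coeff i b) (hPQ : ∀ i < m, coeff i P = coeff i Q) :
    coeff m (P.subst a) - coeff m (Q.subst b) =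
      (coeff m P - coeff m Q) * coeff 1 a ^ m + coeff 1 P * (coeff m a - coeff m b) := by
  rw [coeff_subst_eq_sum ha, coeff_subst_eq_sum hb, ← sum_sub_distrib, sum_range_succ,
    coeff_pow_self ha, coeff_pow_self hb, ← hab 1 (by omega)]
  have : ∑ i ∈ range m, (coeff i P * coeff m (a ^ i) - coeff i Q * coeff m (b ^ i)) =
      coeff 1 P * (coeff m a - coeff m b) := by
    rw [sum_eq_single_of_mem 1 (by simp; omega)]
    · rw [← hPQ 1 (by omega)]; simp [mul_sub]
    · intro i hi h1
      rw [mem_range] at hi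
      rw [← hPQ i hi, ← mul_sub]
      obtain _ | _ | i := i
      · simp
      · exact absurd rfl h1
      · rw [coeff_eq_of_X_pow_dvd_sub (X_pow_dvd_pow_sub_pow ha hb (X_pow_dvd_sub hab) i)
          (Nat.lt_succ_self m), sub_self, mul_zero]
  rw [this]; ring

lemma coeff_conjSeries (P : PowerSeries ℂ) (m : ℕ) :
    coeff m (conjSeries P) = conj (coeff m P) := by
  simp [conjSeries]

lemma constantCoeff_conjSeries {P : PowerSeries ℂ} (h : constantCoeff P = 0) :
    constantCoeff (conjSeries P) = 0 := by
  rw [← coeff_zero_eq_constantCoeff_apply, coeff_conjSeries, coeff_zero_eq_constantCoeff_apply, h,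
    map_zero]

lemma constantCoeff_antiIterate {P : PowerSeries ℂ} (hP : constantCoeff P = 0) (N : ℕ) :
    constantCoeff (antiIterate P N) = 0 := by
  induction N with
  | zero => simp [antiIterate]
  | succ N ih => exact constantCoeff_subst_of_zero (constantCoeff_conjSeries ih) hP

lemma coeff_one_antiIterate_even {P : PowerSeries ℂ} (hP : constantCoeff P = 0) (l : ℕ) :
    coeff 1 (antiIterate P (2 * l)) = (coeff 1 P * conj (coeff 1 P)) ^ l := by
  induction l with
  | zero => simp [antiIterate]
  | succ l ih =>
    rw [show 2 * (l + 1) = 2 * l + 1 + 1 by ring, antiIterate, antiIterate,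
      coeff_one_subst (constantCoeff_conjSeries (constantCoeff_subst_of_zero
        (constantCoeff_conjSeries (constantCoeff_antiIterate hP _)) hP)), coeff_conjSeries,
      coeff_one_subst (constantCoeff_conjSeries (constantCoeff_antiIterate hP _)),
      coeff_conjSeries, ih]
    simp
    ring

lemma coeff_one_antiIterate_odd {P : PowerSeries ℂ} (hP : constantCoeff P = 0) (l : ℕ) :
    coeff 1 (antiIterate P (2 * l + 1)) =
      coeff 1 P * (coeff 1 P * conj (coeff 1 P)) ^ l := by
  rw [antiIterate, coeff_one_subst (constantCoeff_conjSeries (constantCoeff_antiIterate hP _)),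
    coeff_conjSeries, coeff_one_antiIterate_even hP, map_pow, map_mul, Complex.conj_conj,
    mul_comm (conj _)]

lemma coeff_antiIterate_congr {P Q : PowerSeries ℂ} (hP : constantCoeff P = 0)
    (hQ : constantCoeff Q = 0) {m : ℕ} (hPQ : ∀ i < m, coeff i P = coeff i Q) (N : ℕ) :
    ∀ i < m, coeff i (antiIterate P N) = coeff i (antiIterate Q N) := by
  induction N with
  | zero => intro i _; rfl
  | succ N ih =>
    refine coeff_subst_congr (constantCoeff_conjSeries (constantCoeff_antiIterate hP _))
      (constantCoeff_conjSeries (constantCoeff_antiIterate hQ _)) (fun i hi => ?_) hPQ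
    rw [coeff_conjSeries, coeff_conjSeries, ih i hi]

lemma coeff_antiIterate_succ_sub {P Q : PowerSeries ℂ} (hP : constantCoeff P = 0)
    (hQ : constantCoeff Q = 0) {m : ℕ} (hm : 2 ≤ m) (hPQ : ∀ i < m, coeff i P = coeff i Q)
    (N : ℕ) :
    coeff m (antiIterate P (N + 1)) - coeff m (antiIterate Q (N + 1)) =
      (coeff m P - coeff m Q) * conj (coeff 1 (antiIterate P N)) ^ m +
        coeff 1 P * conj (coeff m (antiIterate P N) - coeff m (antiIterate Q N)) := by
  rw [antiIterate, antiIterate, coeff_subst_sub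
    (constantCoeff_conjSeries (constantCoeff_antiIterate hP _))
    (constantCoeff_conjSeries (constantCoeff_antiIterate hQ _)) hm _ hPQ]
  · simp [coeff_conjSeries]
  · intro i hi
    rw [coeff_conjSeries, coeff_conjSeries, coeff_antiIterate_congr hP hQ hPQ N i hi]

/-- Two applications of the one-step recursion, with |u| = 1, add d + u^(m+1) d̄ to the previous
difference, where d is the difference in degree m; a single iterate contributes d. -/
lemma coeff_antiIterate_odd_sub {P Q : PowerSeries ℂ} (hP : constantCoeff P = 0)
    (hQ : constantCoeff Q = 0) (hu : coeff 1 P * conj (coeff 1 P) = 1) {m : ℕ} (hm : 2 ≤ m)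
    (hPQ : ∀ i < m, coeff i P = coeff i Q) (l : ℕ) :
    coeff m (antiIterate P (2 * l + 1)) - coeff m (antiIterate Q (2 * l + 1)) =
      (l + 1) * (coeff m P - coeff m Q) +
        l * coeff 1 P ^ (m + 1) * conj (coeff m P - coeff m Q) := by
  induction l with
  | zero =>
    rw [coeff_antiIterate_succ_sub hP hQ hm hPQ]
    simp [antiIterate]
  | succ l ih =>
    rw [show 2 * (l + 1) + 1 = 2 * l + 1 + 1 + 1 by ring, coeff_antiIterate_succ_sub hP hQ hm hPQ,
      coeff_antiIterate_succ_sub hP hQ hm hPQ, ih, show 2 * l + 1 + 1 = 2 * (l + 1) by ring,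
      coeff_one_antiIterate_even hP, coeff_one_antiIterate_odd hP, hu]
    have hu' : (coeff 1 P * conj (coeff 1 P)) ^ m = 1 := by rw [hu, one_pow]
    rw [mul_pow] at hu'
    simp only [map_add, map_mul, map_pow, map_sub, map_one, map_natCast, Complex.conj_conj, one_pow,
      mul_one]
    push_cast
    set u := coeff 1 P
    set p := coeff m P
    set q := coeff m Q
    linear_combination (p - q) * (l + 1) * hu + (l : ℂ) * u ^ (m + 1) * (conj p - conj q) * hu

/-- Taking norms gives (l + 1)|d| = l|d|. -/
lemma eq_zero_of_add_mul_conj_eq_zero {l : ℕ} {w d : ℂ} (hw : ‖w‖ = 1)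
    (h : (l + 1) * d + l * w * conj d = 0) : d = 0 := by
  have h1 : ((l : ℂ) + 1) * d = -(l * w * conj d) := eq_neg_of_add_eq_zero_left h
  have h2 := congrArg norm h1
  rw [norm_neg, norm_mul, norm_mul, norm_mul, hw, RCLike.norm_conj, RCLike.norm_natCast] at h2
  have h3 : ‖((l : ℂ) + 1)‖ = l + 1 := by
    rw [← Nat.cast_succ, RCLike.norm_natCast, Nat.cast_succ]
  rw [h3] at h2
  have : ‖d‖ = 0 := by linarith
  exact norm_eq_zero.1 this

lemma exists_add_mul_conj_eq (l : ℕ) {w : ℂ} (hw : w * conj w = 1) (c : ℂ) :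
    ∃ d : ℂ, (l + 1) * d + l * w * conj d = c := by
  have hne : (2 * l + 1 : ℂ) ≠ 0 := by exact_mod_cast Nat.succ_ne_zero (2 * l)
  -- Cramer's rule for the equation together with its conjugate; the determinant is (l + 1)² -
  -- l²|w|² = 2l + 1.
  refine ⟨((l + 1) * c - l * w * conj c) / (2 * l + 1), ?_⟩
  simp only [map_div₀, map_sub, map_mul, map_add, map_one, map_natCast, Complex.conj_conj,
    map_ofNat]
  have hr := mul_inv_cancel₀ hne
  rw [div_eq_mul_inv, div_eq_mul_inv]
  linear_combination (-(l : ℂ) ^ 2 * c * (2 * l + 1 : ℂ)⁻¹) * hw + c * hr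

/-- The coefficient of degree `m` of the `(2l+1)`-st iterate can be prescribed by changing the
coefficient of degree `m` of the series. -/
lemma exists_coeff_antiIterate_eq {P : PowerSeries ℂ} (hP : constantCoeff P = 0)
    (hu : coeff 1 P * conj (coeff 1 P) = 1) {m : ℕ} (hm : 2 ≤ m) (l : ℕ) (c : ℂ) :
    ∃ Q : PowerSeries ℂ, (∀ i < m, coeff i Q = coeff i P) ∧
      coeff m (antiIterate Q (2 * l + 1)) = c := by
  have hw : coeff 1 P ^ (m + 1) * conj (coeff 1 P ^ (m + 1)) = 1 := by
    rw [map_pow, ← mul_pow, hu, one_pow]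
  obtain ⟨d, hd⟩ := exists_add_mul_conj_eq l hw (c - coeff m (antiIterate P (2 * l + 1)))
  have hlt : ∀ i < m, coeff i (P + monomial m d) = coeff i P := by
    intro i hi
    rw [map_add, coeff_monomial, if_neg hi.ne, add_zero]
  refine ⟨P + monomial m d, hlt, ?_⟩
  have h0 : constantCoeff (P + monomial m d) = 0 := by
    rw [← coeff_zero_eq_constantCoeff_apply, hlt 0 (by omega),
      coeff_zero_eq_constantCoeff_apply, hP]
  have := coeff_antiIterate_odd_sub h0 hP (by rw [hlt 1 (by omega)]; exact hu) hm hlt l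
  rw [hlt 1 (by omega), map_add, coeff_monomial_same, add_sub_cancel_left, hd] at this
  exact sub_left_injective this

/-- The multiplier of the odd iterate is u|u|^(2l). Its modulus |u|^(2l+1) is 1, which forces |u| =
1 and then leaves u itself. -/
lemma coeff_one_eq_of_antiIterate {F P : PowerSeries ℂ} (hF : ‖coeff 1 F‖ = 1) {l : ℕ}
    (hP : constantCoeff P = 0) (h : coeff 1 (antiIterate P (2 * l + 1)) = coeff 1 F) :
    coeff 1 P * conj (coeff 1 P) = 1 ∧ coeff 1 P = coeff 1 F := by
  rw [coeff_one_antiIterate_odd hP] at h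
  have hn := congrArg norm h
  rw [norm_mul, norm_pow, norm_mul, RCLike.norm_conj, hF, ← sq, ← pow_mul, ← pow_succ'] at hn
  have h1 : ‖coeff 1 P‖ = 1 := (pow_eq_one_iff_of_nonneg (norm_nonneg _) (by omega)).1 hn
  have h2 : coeff 1 P * conj (coeff 1 P) = 1 := by
    rw [Complex.mul_conj, Complex.normSq_eq_norm_sq, h1]; simp
  rw [h2, one_pow, mul_one] at h
  exact ⟨h2, h⟩

theorem existsUnique_antiIterate_eq {F : PowerSeries ℂ} (hF0 : constantCoeff F = 0)
    (hF : ‖coeff 1 F‖ = 1) (l : ℕ) :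
    ∃! P : PowerSeries ℂ, constantCoeff P = 0 ∧ antiIterate P (2 * l + 1) = F := by
  have hF' : coeff 1 F * conj (coeff 1 F) = 1 := by
    rw [Complex.mul_conj, Complex.normSq_eq_norm_sq, hF]; simp
  refine existsUnique_of_exists_of_unique ?_ ?_
  · let S := {P : PowerSeries ℂ // constantCoeff P = 0 ∧ coeff 1 P = coeff 1 F}
    have step : ∀ (m : ℕ) (P : S), ∃ Q : S, (∀ i < m + 2, coeff i Q.1 = coeff i P.1) ∧
        coeff (m + 2) (antiIterate Q.1 (2 * l + 1)) = coeff (m + 2) F := by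
      rintro m ⟨P, hP, hP1⟩
      obtain ⟨Q, hQ, hQm⟩ := exists_coeff_antiIterate_eq hP (by rw [hP1, hF'])
        (show 2 ≤ m + 2 by omega) l (coeff (m + 2) F)
      refine ⟨⟨Q, ?_, ?_⟩, hQ, hQm⟩
      · rw [← coeff_zero_eq_constantCoeff_apply, hQ 0 (by omega),
          coeff_zero_eq_constantCoeff_apply, hP]
      · rw [hQ 1 (by omega), hP1]
    choose next hnext hnext' using step
    -- Successive corrections starting from u X: passing from `A m` to `A (m + 1)` keeps all degrees
    -- below m + 2 and adjusts degree m + 2 so that the iterate has the coefficient of F there.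
    let A : ℕ → S := fun m => Nat.rec ⟨C (coeff 1 F) * X, by simp, by simp⟩ next m
    have hA : ∀ m, A (m + 1) = next m (A m) := fun m => rfl
    have hstab : ∀ m d, ∀ i < m + 2, coeff i (A (m + d)).1 = coeff i (A m).1 := by
      intro m d i hi
      induction d with
      | zero => rfl
      | succ d ih => rw [← add_assoc, hA, hnext _ _ i (by omega), ih]
    -- The diagonal limit: degree m is already final in `A m`.
    let P : PowerSeries ℂ := mk fun m => coeff m (A m).1
    have hPA : ∀ m, ∀ i < m + 2, coeff i P = coeff i (A m).1 := by
      intro m i hi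
      rw [coeff_mk]
      rcases le_total i m with h | h
      · obtain ⟨d, rfl⟩ := Nat.exists_eq_add_of_le h
        exact (hstab i d i (by omega)).symm
      · obtain ⟨d, rfl⟩ := Nat.exists_eq_add_of_le h
        exact hstab m d _ hi
    have hP0 : constantCoeff P = 0 := by
      rw [← coeff_zero_eq_constantCoeff_apply, hPA 0 0 (by omega),
        coeff_zero_eq_constantCoeff_apply, (A 0).2.1]
    have hP1 : coeff 1 P = coeff 1 F := by rw [hPA 0 1 (by omega), (A 0).2.2]
    refine ⟨P, hP0, PowerSeries.ext fun m => ?_⟩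
    obtain _ | _ | m := m
    · simp [constantCoeff_antiIterate hP0, hF0]
    · rw [zero_add, coeff_one_antiIterate_odd hP0, hP1, hF', one_pow, mul_one]
    · rw [coeff_antiIterate_congr hP0 (A (m + 1)).2.1 (hPA (m + 1)) _ _ (by omega), hA, hnext']
  · rintro P Q ⟨hP, hPF⟩ ⟨hQ, hQF⟩
    obtain ⟨huP, hP1⟩ := coeff_one_eq_of_antiIterate hF hP (by rw [hPF])
    obtain ⟨huQ, hQ1⟩ := coeff_one_eq_of_antiIterate hF hQ (by rw [hQF])
    ext m
    induction m using Nat.strong_induction_on with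
    | _ m ih =>
      obtain _ | _ | m := m
      · simp [hP, hQ]
      · rw [zero_add, hP1, hQ1]
      · have := coeff_antiIterate_odd_sub hP hQ huP (show 2 ≤ m + 2 by omega) ih l
        rw [hPF, hQF, sub_self] at this
        refine sub_eq_zero.1 (eq_zero_of_add_mul_conj_eq_zero ?_ this.symm)
        rw [norm_pow, hP1, hF, one_pow]

theorem existsUnique_isFormalRoot {f : ℂ → ℂ} (hf : IsParabolic f) {n : ℕ} (hn : Odd n) :
    ∃! P : PowerSeries ℂ, IsFormalRoot n f P := by
  obtain ⟨l, rfl⟩ := hn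
  refine existsUnique_antiIterate_eq ?_ ?_ l
  · rw [← coeff_zero_eq_constantCoeff_apply]
    simp [antiSeries, hf.1.1]
  · rw [antiSeries, coeff_mk]
    simpa using hf.2.1

end FormalRoots

/-! ### The plane near infinity, away from the negative real axis -/

section FarFilter

open Metric

/-- `rho ζ > M` is the complement of the half-strip `Re ζ ≤ M`, `|Im ζ| ≤ M`. -/
def rho (ζ : ℂ) : ℝ := max ζ.re |ζ.im|

/-- Neighbourhoods of infinity in the plane slit along the negative real axis. -/
def far : Filter ℂ := comap rho atTop

lemma lipschitzWith_re : LipschitzWith 1 Complex.re :=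
  LipschitzWith.of_dist_le_mul fun x y => by
    rw [NNReal.coe_one, one_mul, dist_eq_norm, dist_eq_norm, Real.norm_eq_abs, ← Complex.sub_re]
    exact Complex.abs_re_le_norm _

lemma lipschitzWith_im : LipschitzWith 1 Complex.im :=
  LipschitzWith.of_dist_le_mul fun x y => by
    rw [NNReal.coe_one, one_mul, dist_eq_norm, dist_eq_norm, Real.norm_eq_abs, ← Complex.sub_im]
    exact Complex.abs_im_le_norm _

lemma lipschitzWith_rho : LipschitzWith 1 rho := by
  have h : LipschitzWith 1 fun ζ : ℂ => |ζ.im| := by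
    have := (lipschitzWith_one_norm (E := ℝ)).comp lipschitzWith_im
    rwa [one_mul] at this
  have := lipschitzWith_re.max h
  rwa [max_self] at this

lemma continuous_rho : Continuous rho := lipschitzWith_rho.continuous

lemma rho_le_norm (ζ : ℂ) : rho ζ ≤ ‖ζ‖ :=
  max_le (Complex.re_le_norm ζ) (Complex.abs_im_le_norm ζ)

lemma le_add_of_lipschitzWith {ℓ : ℂ → ℝ} (hℓ : LipschitzWith 1 ℓ) {x y : ℂ} {B : ℝ}
    (h : ‖y - x‖ ≤ B) : ℓ x ≤ ℓ y + B := by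
  have := hℓ.dist_le_mul x y
  rw [NNReal.coe_one, one_mul, dist_eq_norm, dist_eq_norm, norm_sub_rev x y,
    Real.norm_eq_abs] at this
  linarith [le_abs_self (ℓ x - ℓ y)]

lemma eventually_closedBall_subset {ℓ : ℂ → ℝ} (hℓ : LipschitzWith 1 ℓ) {s : Set ℂ}
    (hs : s ∈ comap ℓ atTop) (B : ℝ) : ∀ᶠ ζ in comap ℓ atTop, closedBall ζ B ⊆ s := by
  obtain ⟨t, ht, hts⟩ := hs
  obtain ⟨M, hM⟩ := mem_atTop_sets.1 ht
  filter_upwards [tendsto_comap.eventually (eventually_ge_atTop (M + B))] with ζ hζ w hw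
  refine hts (hM _ ?_)
  rw [mem_closedBall, dist_eq_norm] at hw
  linarith [le_add_of_lipschitzWith hℓ hw]

lemma tendsto_comap_of_norm_sub_le {ℓ : ℂ → ℝ} (hℓ : LipschitzWith 1 ℓ) {t : ℂ → ℂ} {B : ℝ}
    (h : ∀ᶠ ζ in comap ℓ atTop, ‖t ζ - ζ‖ ≤ B) : Tendsto t (comap ℓ atTop) (comap ℓ atTop) := by
  intro s hs
  change ∀ᶠ ζ in comap ℓ atTop, t ζ ∈ s
  filter_upwards [h, eventually_closedBall_subset hℓ hs B] with ζ h1 h2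
  exact h2 (by rwa [mem_closedBall, dist_eq_norm])

lemma eventually_far_iff {p : ℂ → Prop} :
    (∀ᶠ ζ in far, p ζ) ↔ ∃ M : ℝ, ∀ ζ, M ≤ rho ζ → p ζ := by
  rw [far, eventually_comap, eventually_atTop]
  exact ⟨fun ⟨M, h⟩ => ⟨M, fun ζ hζ => h _ hζ ζ rfl⟩, fun ⟨M, h⟩ => ⟨M, fun b hb ζ e =>
    h ζ (e ▸ hb)⟩⟩

lemma eventually_far_ge (M : ℝ) : ∀ᶠ ζ in far, M ≤ rho ζ :=
  tendsto_comap.eventually (eventually_ge_atTop M)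

lemma tendsto_norm_far : Tendsto (fun ζ : ℂ => ‖ζ‖) far atTop :=
  tendsto_atTop_mono rho_le_norm tendsto_comap

lemma eventually_far_norm_ge (M : ℝ) : ∀ᶠ ζ in far, M ≤ ‖ζ‖ :=
  tendsto_norm_far.eventually (eventually_ge_atTop M)

lemma up_le_far : comap Complex.im atTop ≤ far := by
  rw [far, ← tendsto_iff_comap]
  exact tendsto_atTop_mono (fun ζ => (le_abs_self _).trans (le_max_right _ _)) tendsto_comap

lemma down_le_far : comap Complex.im atBot ≤ far := by
  rw [far, ← tendsto_iff_comap]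
  refine tendsto_atTop_mono (fun ζ => (neg_le_abs _).trans (le_max_right _ _)) ?_
  exact tendsto_neg_atBot_atTop.comp tendsto_comap

lemma tendsto_neg_up : Tendsto (fun ζ : ℂ => -ζ) (comap Complex.im atTop)
    (comap Complex.im atBot) := by
  rw [tendsto_comap_iff]
  exact tendsto_neg_atTop_atBot.comp tendsto_comap

lemma tendsto_neg_down : Tendsto (fun ζ : ℂ => -ζ) (comap Complex.im atBot)
    (comap Complex.im atTop) := by
  rw [tendsto_comap_iff]
  exact tendsto_neg_atBot_atTop.comp tendsto_comap

lemma tendsto_conj_up : Tendsto (conj : ℂ → ℂ) (comap Complex.im atTop)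
    (comap Complex.im atBot) := by
  rw [tendsto_comap_iff]
  exact tendsto_neg_atTop_atBot.comp tendsto_comap

lemma tendsto_conj_down : Tendsto (conj : ℂ → ℂ) (comap Complex.im atBot)
    (comap Complex.im atTop) := by
  rw [tendsto_comap_iff]
  exact tendsto_neg_atBot_atTop.comp tendsto_comap

lemma rho_conj (ζ : ℂ) : rho (conj ζ) = rho ζ := by simp [rho]

lemma tendsto_conj_far : Tendsto (conj : ℂ → ℂ) far far := by
  rw [far, tendsto_comap_iff]
  exact tendsto_comap.congr fun ζ => (rho_conj ζ).symm

lemma comap_im_atBot : comap Complex.im atBot = comap (fun ζ : ℂ => -ζ.im) atTop := by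
  rw [show (fun ζ : ℂ => -ζ.im) = Neg.neg ∘ Complex.im from rfl, ← comap_comap, comap_neg_atTop]

lemma lipschitzWith_neg_im : LipschitzWith 1 fun ζ : ℂ => -ζ.im := by
  exact lipschitzWith_im.neg

lemma mem_slitPlane_of_rho_pos {ζ : ℂ} (h : 0 < rho ζ) : ζ ∈ Complex.slitPlane := by
  rcases lt_max_iff.1 h with h | h
  · exact Or.inl h
  · exact Or.inr (abs_pos.1 h)

lemma eventually_far_mem_slitPlane : ∀ᶠ ζ in far, ζ ∈ Complex.slitPlane := by
  filter_upwards [eventually_far_ge 1] with ζ hζ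
  exact mem_slitPlane_of_rho_pos (by linarith)

/-- Points that are close relative to their distance to the slit lie on the same side of it. -/
lemma eventually_log_sub_log (C : ℝ) : ∀ᶠ ζ in far, ∀ ζ' : ℂ, |(ζ' - ζ).im| ≤ C →
    ‖ζ' - ζ‖ ≤ ‖ζ‖ / 4 → Complex.log ζ' - Complex.log ζ = Complex.log (ζ' / ζ) := by
  have key : ∀ ζ ζ' : ℂ, ζ ≠ 0 → ζ' ≠ 0 → |ζ'.arg - ζ.arg| < Real.pi →
      Complex.log ζ' - Complex.log ζ = Complex.log (ζ' / ζ) := by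
    intro ζ ζ' h h' ha
    rw [← Complex.log_exp (x := Complex.log ζ' - Complex.log ζ), Complex.exp_sub,
      Complex.exp_log h, Complex.exp_log h']
    · simpa only [Complex.sub_im, Complex.log_im] using (abs_lt.1 ha).1
    · simpa only [Complex.sub_im, Complex.log_im] using (abs_lt.1 ha).2.le
  filter_upwards [eventually_far_ge (|C| + 1)] with ζ hζ ζ' h1 h2
  have hC := le_abs_self C
  have hC0 := abs_nonneg C
  have hζ0 : ζ ≠ 0 := by
    rintro rfl
    simp [rho] at hζ
    linarith
  -- Far from the real axis, the imaginary part keeps its sign under a displacement of imaginary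
  -- part at most C. Near the axis, being far means that the real part is large and positive, so
  -- both arguments are below π/2 in absolute value.
  by_cases hcase : |C| + 1 ≤ |ζ.im|
  · rw [Complex.sub_im] at h1
    rcases le_total 0 ζ.im with h | h
    · rw [abs_of_nonneg h] at hcase
      have h3 : 0 < ζ.im := by linarith
      have h4 : 0 < ζ'.im := by linarith [(abs_le.1 h1).1]
      refine key _ _ hζ0 (fun e => by simp [e] at h4) (abs_lt.2 ⟨?_, ?_⟩)
      · linarith [Complex.arg_lt_pi_iff.2 (Or.inr h3.ne'), Complex.arg_nonneg_iff.2 h4.le]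
      · linarith [Complex.arg_lt_pi_iff.2 (Or.inr h4.ne'), Complex.arg_nonneg_iff.2 h3.le]
    · rw [abs_of_nonpos h] at hcase
      have h3 : ζ.im < 0 := by linarith
      have h4 : ζ'.im < 0 := by linarith [(abs_le.1 h1).2]
      refine key _ _ hζ0 (fun e => by simp [e] at h4) (abs_lt.2 ⟨?_, ?_⟩)
      · linarith [Complex.neg_pi_lt_arg ζ', Complex.arg_neg_iff.2 h3]
      · linarith [Complex.neg_pi_lt_arg ζ, Complex.arg_neg_iff.2 h4]
  · push Not at hcase
    have hre : |C| + 1 ≤ ζ.re := by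
      rcases le_max_iff.1 hζ with h | h
      · exact h
      · linarith
    have h3 : ‖ζ‖ ≤ 2 * ζ.re := by
      have := Complex.norm_le_abs_re_add_abs_im ζ
      rw [abs_of_nonneg (by linarith : 0 ≤ ζ.re)] at this
      linarith
    have h4 : 0 < ζ'.re := by
      have := (abs_le.1 (Complex.abs_re_le_norm (ζ' - ζ))).1
      rw [Complex.sub_re] at this
      linarith
    have h5 := Complex.abs_arg_lt_pi_div_two_iff.2 (Or.inl (show 0 < ζ.re by linarith))
    have h6 := Complex.abs_arg_lt_pi_div_two_iff.2 (Or.inl h4)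
    refine key _ _ hζ0 (fun e => by simp [e] at h4) (abs_lt.2 ⟨?_, ?_⟩) <;>
    linarith [abs_lt.1 h5, abs_lt.1 h6]

/-- The logarithm changes little under small relative displacements. -/
lemma tendsto_log_sub_log {α : Type*} {l : Filter α} {a t : α → ℂ} {C : ℝ} (ha : Tendsto a l far)
    (h1 : ∀ᶠ x in l, |(t x - a x).im| ≤ C)
    (h2 : Tendsto (fun x => (t x - a x) / a x) l (𝓝 0)) :
    Tendsto (fun x => Complex.log (t x) - Complex.log (a x)) l (𝓝 0) := by
  have h3 : Tendsto (fun x => Complex.log (1 + (t x - a x) / a x)) l (𝓝 0) := by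
    have : Tendsto (fun w : ℂ => Complex.log (1 + w)) (𝓝 0) (𝓝 0) := by
      have : ContinuousAt (fun w : ℂ => Complex.log (1 + w)) 0 :=
        ContinuousAt.clog (by fun_prop) (by simp)
      simpa using this.tendsto
    exact this.comp h2
  refine h3.congr' ?_
  have h4 : ∀ᶠ x in l, ‖(t x - a x) / a x‖ ≤ 1 / 4 := by
    have := h2.norm
    rw [norm_zero] at this
    exact (this.eventually (gt_mem_nhds (by norm_num : (0 : ℝ) < 1 / 4))).mono fun _ h => h.le
  filter_upwards [ha.eventually (eventually_log_sub_log C), h1, h4,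
    ha.eventually (eventually_far_norm_ge 1)] with x h5 h6 h7 h8
  have h9 : a x ≠ 0 := by
    intro e
    rw [e, norm_zero] at h8
    linarith
  rw [h5 _ h6]
  · congr 1
    field_simp
    ring
  · rw [norm_div, div_le_iff₀ (norm_pos_iff.2 h9)] at h7
    linarith

end FarFilter

/-! ### The coordinate ζ - β log ζ and maps asymptotic to it -/

section LogCoord

open Metric

/-- The model `ζ - β log ζ` of the time coordinate. -/
def logCoord (β : ℝ) (ζ : ℂ) : ℂ := ζ - β * Complex.log ζ

lemma eventually_eventually_nhds_far {p : ℂ → Prop} (h : ∀ᶠ ζ in far, p ζ) :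
    ∀ᶠ ζ in far, ∀ᶠ ζ' in 𝓝 ζ, p ζ' := by
  filter_upwards [eventually_closedBall_subset lipschitzWith_rho h 1] with ζ hζ
  exact mem_of_superset (closedBall_mem_nhds ζ one_pos) hζ

lemma norm_log_le (ζ : ℂ) : ‖Complex.log ζ‖ ≤ |Real.log ‖ζ‖| + Real.pi := by
  refine (Complex.norm_le_abs_re_add_abs_im _).trans ?_
  rw [Complex.log_re, Complex.log_im]
  exact add_le_add le_rfl (Complex.abs_arg_le_pi ζ)

lemma isLittleO_log_far : (fun ζ : ℂ => Complex.log ζ) =o[far] fun ζ => ζ := by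
  have h1 : (fun x : ℝ => Real.log x) =o[atTop] fun x => x := Real.isLittleO_log_id_atTop
  have h2 : (fun _ : ℝ => Real.pi) =o[atTop] fun x : ℝ => x := isLittleO_const_id_atTop _
  have h3 : (fun ζ : ℂ => |Real.log ‖ζ‖| + Real.pi) =o[far] fun ζ => ‖ζ‖ :=
    ((h1.comp_tendsto tendsto_norm_far).abs_left).add (h2.comp_tendsto tendsto_norm_far)
  refine (IsBigO.of_bound 1 (Eventually.of_forall fun ζ => ?_)).trans_isLittleO h3.of_norm_right
  rw [one_mul]
  exact (norm_log_le ζ).trans (le_abs_self _)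

lemma eventually_norm_mul_log_le (β : ℝ) {ε : ℝ} (hε : 0 < ε) :
    ∀ᶠ ζ in far, ‖(β : ℂ) * Complex.log ζ‖ ≤ ε * ‖ζ‖ :=
  ((isLittleO_log_far.const_mul_left (β : ℂ)).def hε)

lemma abs_im_mul_log_le (β : ℝ) (ζ : ℂ) : |((β : ℂ) * Complex.log ζ).im| ≤ |β| * Real.pi := by
  rw [Complex.im_ofReal_mul, abs_mul, Complex.log_im]
  gcongr
  exact Complex.abs_arg_le_pi ζ

/-- The imaginary part of β log ζ is bounded by |β|π and its real part is o(ζ). The first fact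
suffices where |Im ζ| realizes `rho`; where Re ζ does, |ζ| ≤ 2 Re ζ and the second one suffices. -/
lemma eventually_rho_add_mul_log (β : ℝ) :
    ∀ᶠ ζ in far, rho ζ / 2 - |β| * Real.pi ≤ rho (ζ + β * Complex.log ζ) := by
  filter_upwards [eventually_norm_mul_log_le β (show (0 : ℝ) < 1 / 4 by norm_num),
    eventually_far_ge 1] with ζ h1 hρ
  have h2 := abs_im_mul_log_le β ζ
  have h0 : 0 ≤ |β| * Real.pi := by positivity
  set u := (β : ℂ) * Complex.log ζ
  rcases le_total ζ.re |ζ.im| with h | h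
  · rw [rho, max_eq_right h] at *
    refine le_trans ?_ (le_max_right _ _)
    have : |ζ.im| ≤ |(ζ + u).im| + |u.im| := by
      have := abs_sub ((ζ + u).im) u.im
      simpa using this
    linarith
  · have hre : rho ζ = ζ.re := max_eq_left h
    rw [hre] at hρ ⊢
    refine le_trans ?_ (le_max_left _ _)
    have h3 : ‖ζ‖ ≤ 2 * ζ.re := by
      have := Complex.norm_le_abs_re_add_abs_im ζ
      rw [abs_of_nonneg (by linarith : 0 ≤ ζ.re)] at this
      linarith
    have := (abs_le.1 (Complex.abs_re_le_norm u)).1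
    rw [Complex.add_re]
    linarith

lemma tendsto_add_mul_log_far (β : ℝ) :
    Tendsto (fun ζ : ℂ => ζ + β * Complex.log ζ) far far := by
  refine tendsto_comap_iff.2 (tendsto_atTop_mono' far (eventually_rho_add_mul_log β) ?_)
  exact tendsto_atTop_add_const_right _ _ (tendsto_comap.atTop_div_const (by norm_num))

lemma tendsto_add_mul_log_up (β : ℝ) : Tendsto (fun ζ : ℂ => ζ + β * Complex.log ζ)
    (comap Complex.im atTop) (comap Complex.im atTop) := by
  refine tendsto_comap_iff.2 (tendsto_atTop_mono (f := fun ζ : ℂ => ζ.im - |β| * Real.pi)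
    (fun ζ => ?_) (tendsto_atTop_add_const_right _ _ tendsto_comap))
  have := (abs_le.1 (abs_im_mul_log_le β ζ)).1
  simp only [Function.comp, Complex.add_im]
  linarith

lemma tendsto_add_mul_log_down (β : ℝ) : Tendsto (fun ζ : ℂ => ζ + β * Complex.log ζ)
    (comap Complex.im atBot) (comap Complex.im atBot) := by
  have h0 : Tendsto (fun ζ : ℂ => ζ.im + |β| * Real.pi) (comap Complex.im atBot) atBot :=
    tendsto_atBot_add_const_right _ _ tendsto_comap
  refine tendsto_comap_iff.2 (tendsto_atBot_mono (fun ζ => ?_) h0)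
  have := (abs_le.1 (abs_im_mul_log_le β ζ)).2
  simp only [Function.comp, Complex.add_im]
  linarith

lemma logCoord_eq (β : ℝ) (ζ : ℂ) : logCoord β ζ = ζ + ((-β : ℝ) : ℂ) * Complex.log ζ := by
  rw [logCoord]; push_cast; ring

lemma tendsto_logCoord_far (β : ℝ) : Tendsto (logCoord β) far far :=
  (tendsto_add_mul_log_far (-β)).congr fun ζ => (logCoord_eq β ζ).symm

lemma tendsto_logCoord_up (β : ℝ) : Tendsto (logCoord β) (comap Complex.im atTop)
    (comap Complex.im atTop) :=
  (tendsto_add_mul_log_up (-β)).congr fun ζ => (logCoord_eq β ζ).symm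

lemma tendsto_logCoord_down (β : ℝ) : Tendsto (logCoord β) (comap Complex.im atBot)
    (comap Complex.im atBot) :=
  (tendsto_add_mul_log_down (-β)).congr fun ζ => (logCoord_eq β ζ).symm

/-- Uniform smallness of the variation of the logarithm on balls of fixed radius. -/
lemma eventually_norm_log_sub_log_le (B : ℝ) {δ : ℝ} (hδ : 0 < δ) :
    ∀ᶠ ζ in far, ∀ ζ' ∈ closedBall ζ B, ‖Complex.log ζ' - Complex.log ζ‖ ≤ δ := by
  have : Tendsto (fun w : ℂ => Complex.log (1 + w)) (𝓝 0) (𝓝 0) := by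
    have : ContinuousAt (fun w : ℂ => Complex.log (1 + w)) 0 :=
      ContinuousAt.clog (by fun_prop) (by simp)
    simpa using this.tendsto
  obtain ⟨η, hη, hlog⟩ := Metric.eventually_nhds_iff.1
    (this.eventually (closedBall_mem_nhds (0 : ℂ) hδ))
  filter_upwards [eventually_log_sub_log B, eventually_far_norm_ge (4 * |B| + 1),
    eventually_far_norm_ge (2 * |B| / η + 1)] with ζ h1 h2 h3 ζ' hζ'
  rw [mem_closedBall, dist_eq_norm] at hζ'
  have hB := hζ'.trans (le_abs_self B)
  have hB0 := abs_nonneg B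
  have hpos : 0 < ‖ζ‖ := by linarith
  have hne : ζ ≠ 0 := norm_pos_iff.1 hpos
  rw [h1 ζ' ((Complex.abs_im_le_norm _).trans hζ') (by linarith)]
  have h4 : ζ' / ζ = 1 + (ζ' - ζ) / ζ := by field_simp; ring
  rw [h4]
  have h5 : dist ((ζ' - ζ) / ζ) 0 < η := by
    rw [dist_zero_right, norm_div, div_lt_iff₀ hpos]
    have : 2 * |B| < η * ‖ζ‖ := by
      rw [div_add_one hη.ne', div_le_iff₀ hη] at h3
      linarith
    linarith
  simpa using hlog h5

/-- `F` is holomorphic near infinity and asymptotic to `ζ - β log ζ + c`. -/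
structure IsAsympLog (β : ℝ) (F : ℂ → ℂ) (c : ℂ) : Prop where
  differentiable : ∀ᶠ ζ in far, DifferentiableAt ℂ F ζ
  tendsto : Tendsto (fun ζ => F ζ - logCoord β ζ) far (𝓝 c)

namespace IsAsympLog

variable {β : ℝ} {F : ℂ → ℂ} {c : ℂ}

lemma eventually_norm_sub_le (h : IsAsympLog β F c) {δ : ℝ} (hδ : 0 < δ) :
    ∀ᶠ ζ in far, ‖F ζ - logCoord β ζ - c‖ ≤ δ := by
  filter_upwards [h.tendsto.eventually (closedBall_mem_nhds c hδ)] with ζ hζ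
  rwa [← dist_eq_norm]

lemma analyticAt (h : IsAsympLog β F c) : ∀ᶠ ζ in far, AnalyticAt ℂ F ζ := by
  filter_upwards [eventually_eventually_nhds_far h.differentiable] with ζ hζ
  exact Complex.analyticAt_iff_eventually_differentiableAt.2 hζ

/-- `F` is nearly a translation on balls of fixed radius. -/
lemma eventually_translation (h : IsAsympLog β F c) (B : ℝ) {δ : ℝ} (hδ : 0 < δ) :
    ∀ᶠ ζ in far, ∀ ζ' ∈ closedBall ζ B, ‖F ζ' - F ζ - (ζ' - ζ)‖ ≤ δ := by
  have hβ : 0 < δ / 3 / (|β| + 1) := by positivity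
  have h1 := h.eventually_norm_sub_le (show 0 < δ / 3 by positivity)
  filter_upwards [h1, eventually_closedBall_subset lipschitzWith_rho h1 B,
    eventually_norm_log_sub_log_le B hβ] with ζ h2 h3 h4 ζ' hζ'
  have h5 : F ζ' - F ζ - (ζ' - ζ) = (F ζ' - logCoord β ζ' - c) - (F ζ - logCoord β ζ - c) -
      β * (Complex.log ζ' - Complex.log ζ) := by
    simp only [logCoord]; ring
  have h6 : ‖(β : ℂ) * (Complex.log ζ' - Complex.log ζ)‖ ≤ δ / 3 := by
    rw [norm_mul, Complex.norm_real, Real.norm_eq_abs]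
    calc |β| * ‖Complex.log ζ' - Complex.log ζ‖ ≤ (|β| + 1) * (δ / 3 / (|β| + 1)) := by
          gcongr
          · linarith
          · exact h4 ζ' hζ'
      _ = δ / 3 := by field_simp
  have h7 : ‖F ζ' - logCoord β ζ' - c‖ ≤ δ / 3 := h3 hζ'
  rw [h5]
  linarith [norm_sub_le ((F ζ' - logCoord β ζ' - c) - (F ζ - logCoord β ζ - c))
    (β * (Complex.log ζ' - Complex.log ζ)),
    norm_sub_le (F ζ' - logCoord β ζ' - c) (F ζ - logCoord β ζ - c)]

/-- Cauchy's estimate on the unit disc for F - id, whose oscillation there is small. -/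
lemma eventually_norm_deriv_sub_one_le (h : IsAsympLog β F c) {δ : ℝ} (hδ : 0 < δ) :
    ∀ᶠ ζ in far, ‖deriv F ζ - 1‖ ≤ δ := by
  filter_upwards [h.eventually_translation 1 hδ, h.differentiable,
    eventually_closedBall_subset lipschitzWith_rho h.differentiable 1] with ζ h1 h2 h3
  have hd : DiffContOnCl ℂ (fun w => F w - F ζ - (w - ζ)) (ball ζ 1) := by
    refine DifferentiableOn.diffContOnCl_ball (U := closedBall ζ 1) (fun w hw => ?_) subset_rfl
    exact (((h3 hw).sub_const _).sub (differentiableAt_id.sub_const _)).differentiableWithinAt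
  have := Complex.norm_deriv_le_of_forall_mem_sphere_norm_le one_pos hd
    (fun w hw => h1 w (sphere_subset_closedBall hw))
  have e : deriv (fun w => F w - F ζ - (w - ζ)) ζ = deriv F ζ - 1 := by
    exact ((h2.hasDerivAt.sub_const (F ζ)).sub ((hasDerivAt_id ζ).sub_const ζ)).deriv
  rwa [e, div_one] at this

lemma eventually_deriv_ne_zero (h : IsAsympLog β F c) : ∀ᶠ ζ in far, deriv F ζ ≠ 0 := by
  filter_upwards [h.eventually_norm_deriv_sub_one_le (show (0 : ℝ) < 1 / 2 by norm_num)] with ζ h1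
  intro h0
  rw [h0] at h1
  norm_num at h1

/-- F is within 1 of a translation on the disc of radius 3, so it sends the boundary circle to
distance at least 2 from F ζ. The quantitative open mapping theorem then covers the disc of half
that radius. -/
lemma eventually_exists_eq (h : IsAsympLog β F c) :
    ∀ᶠ ζ in far, ∀ w, ‖w - F ζ‖ < 1 → ∃ ζ' ∈ closedBall ζ 3, F ζ' = w := by
  filter_upwards [h.eventually_translation 3 one_pos, h.eventually_deriv_ne_zero,
    h.differentiable, eventually_closedBall_subset lipschitzWith_rho h.differentiable 3]
    with ζ h1 h2 h3 h4 w hw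
  have hd : DiffContOnCl ℂ F (ball ζ 3) :=
    DifferentiableOn.diffContOnCl_ball (U := closedBall ζ 3)
      (fun w hw => (h4 hw).differentiableWithinAt) subset_rfl
  have hne : ∃ᶠ z in 𝓝 ζ, F z ≠ F ζ :=
    ((h3.hasDerivAt.eventually_ne h2 (c := F ζ)).frequently).filter_mono nhdsWithin_le_nhds
  have := hd.ball_subset_image_closedBall (ε := 2) (by norm_num) (fun z hz => ?_) hne
  · exact this (by rw [mem_ball, dist_eq_norm]; linarith)
  · have h5 := h1 z (sphere_subset_closedBall hz)
    rw [mem_sphere, dist_eq_norm] at hz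
    have := norm_sub_norm_le (z - ζ) (F z - F ζ)
    rw [norm_sub_rev] at h5
    linarith

/-- Neighbourhoods in `far` are not convex, so a derivative bound alone does not give injectivity.
First F x = F y is shown to bound ‖x - y‖: the arguments contribute at most 2π|β|, and the
logarithms of the moduli at most ‖x - y‖/2 once |x|, |y| ≥ 2|β| + 1. The mean value inequality on a
ball of that radius B then concludes, since ‖F' - 1‖ ≤ 1/2 there. -/
lemma exists_injOn (h : IsAsympLog β F c) : ∃ s ∈ far, Set.InjOn F s := by
  set B : ℝ := 4 + 4 * |β| * Real.pi
  have hd := h.eventually_norm_deriv_sub_one_le (show (0 : ℝ) < 1 / 2 by norm_num)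
  have hs := (eventually_closedBall_subset lipschitzWith_rho (hd.and h.differentiable) B).and
    ((h.eventually_norm_sub_le one_pos).and (eventually_far_norm_ge (2 * |β| + 1)))
  refine ⟨_, hs, ?_⟩
  rintro x ⟨hx1, hx2, hx3⟩ y ⟨-, hy2, hy3⟩ hxy
  have hβ := abs_nonneg β
  have hlog : ∀ a b : ℂ, 2 * |β| + 1 ≤ ‖a‖ → 2 * |β| + 1 ≤ ‖b‖ →
      (2 * |β| + 1) * (Real.log ‖a‖ - Real.log ‖b‖) ≤ ‖a - b‖ := by
    intro a b ha hb
    have hb0 : 0 < ‖b‖ := by linarith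
    have ha0 : 0 < ‖a‖ := by linarith
    rw [← Real.log_div ha0.ne' hb0.ne']
    rcases le_total (Real.log (‖a‖ / ‖b‖)) 0 with h0 | h0
    · exact (mul_nonpos_of_nonneg_of_nonpos (by linarith) h0).trans (norm_nonneg _)
    · calc (2 * |β| + 1) * Real.log (‖a‖ / ‖b‖) ≤ ‖b‖ * (‖a‖ / ‖b‖ - 1) := by
            gcongr
            exact Real.log_le_sub_one_of_pos (by positivity)
        _ = ‖a‖ - ‖b‖ := by field_simp
        _ ≤ ‖a - b‖ := norm_sub_norm_le a b
  have h1 : ‖Complex.log x - Complex.log y‖ ≤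
      |Real.log ‖x‖ - Real.log ‖y‖| + 2 * Real.pi := by
    refine (Complex.norm_le_abs_re_add_abs_im _).trans ?_
    rw [Complex.sub_re, Complex.sub_im, Complex.log_re, Complex.log_im, Complex.log_re,
      Complex.log_im]
    have := abs_sub x.arg y.arg
    linarith [Complex.abs_arg_le_pi x, Complex.abs_arg_le_pi y]
  have h2 : |β| * |Real.log ‖x‖ - Real.log ‖y‖| ≤ ‖x - y‖ / 2 := by
    have h3 : (2 * |β| + 1) * |Real.log ‖x‖ - Real.log ‖y‖| ≤ ‖x - y‖ := by
      rcases abs_cases (Real.log ‖x‖ - Real.log ‖y‖) with ⟨e, -⟩ | ⟨e, -⟩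
      · rw [e]; exact hlog x y hx3 hy3
      · rw [e, neg_sub, norm_sub_rev]; exact hlog y x hy3 hx3
    linarith [abs_nonneg (Real.log ‖x‖ - Real.log ‖y‖)]
  have h4 : ‖x - y‖ ≤ 2 + ‖(β : ℂ) * (Complex.log x - Complex.log y)‖ := by
    have e : x - y = (F y - logCoord β y - c) - (F x - logCoord β x - c) +
        β * (Complex.log x - Complex.log y) := by
      rw [hxy]; simp only [logCoord]; ring
    have := norm_add_le ((F y - logCoord β y - c) - (F x - logCoord β x - c))
      (β * (Complex.log x - Complex.log y))
    rw [← e] at this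
    linarith [norm_sub_le (F y - logCoord β y - c) (F x - logCoord β x - c)]
  have h5 : ‖x - y‖ ≤ B := by
    rw [norm_mul, Complex.norm_real, Real.norm_eq_abs] at h4
    have := mul_le_mul_of_nonneg_left h1 hβ
    simp only [B]
    linarith
  have hcv := (convex_closedBall x B).norm_image_sub_le_of_norm_deriv_le
    (f := fun w => F w - w) (C := 1 / 2) (x := x) (y := y)
    (fun w hw => (hx1 hw).2.sub differentiableAt_id) (fun w hw => ?_)
    (mem_closedBall_self ((norm_nonneg _).trans h5))
    (by rwa [mem_closedBall, dist_eq_norm, norm_sub_rev])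
  · rw [hxy, show F y - y - (F y - x) = -(y - x) by ring, norm_neg] at hcv
    have : ‖y - x‖ = 0 := by linarith [norm_nonneg (y - x)]
    exact (sub_eq_zero.1 (norm_eq_zero.1 this)).symm
  · have e : deriv (fun w => F w - w) w = deriv F w - 1 := by
      exact ((hx1 hw).2.hasDerivAt.sub (hasDerivAt_id w)).deriv
    rw [e]
    exact (hx1 hw).1

lemma tendsto_comap (h : IsAsympLog β F c) {ℓ : ℂ → ℝ} (hℓ : LipschitzWith 1 ℓ)
    (hle : comap ℓ atTop ≤ far) (hlog : Tendsto (logCoord β) (comap ℓ atTop) (comap ℓ atTop)) :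
    Tendsto F (comap ℓ atTop) (comap ℓ atTop) := by
  intro s hs
  have h1 := hlog (eventually_closedBall_subset hℓ hs (‖c‖ + 1))
  change ∀ᶠ ζ in comap ℓ atTop, F ζ ∈ s
  filter_upwards [h1, hle (h.eventually_norm_sub_le one_pos)] with ζ h2 h3
  refine h2 ?_
  rw [mem_closedBall, dist_eq_norm]
  have := norm_add_le (F ζ - logCoord β ζ - c) c
  rw [sub_add_cancel] at this
  have h4 : ‖F ζ - logCoord β ζ - c‖ ≤ 1 := h3
  linarith

lemma tendsto_far (h : IsAsympLog β F c) : Tendsto F far far :=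
  h.tendsto_comap lipschitzWith_rho le_rfl (tendsto_logCoord_far β)

lemma tendsto_up (h : IsAsympLog β F c) :
    Tendsto F (comap Complex.im atTop) (comap Complex.im atTop) :=
  h.tendsto_comap lipschitzWith_im up_le_far (tendsto_logCoord_up β)

lemma tendsto_down (h : IsAsympLog β F c) :
    Tendsto F (comap Complex.im atBot) (comap Complex.im atBot) := by
  have h1 := down_le_far
  have h2 := tendsto_logCoord_down β
  rw [comap_im_atBot] at *
  exact h.tendsto_comap lipschitzWith_neg_im h1 h2

end IsAsympLog

/-- Injectivity on s identifies Θ with the local inverse given by the inverse function theorem. The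
condition Θ w ∈ s takes the place of continuity of Θ. -/
lemma differentiableAt_of_local_rightInverse {F Θ : ℂ → ℂ} {ζ : ℂ} {s : Set ℂ}
    (hF : AnalyticAt ℂ F ζ) (hF' : deriv F ζ ≠ 0) (hs : s ∈ 𝓝 ζ) (hinj : Set.InjOn F s)
    (hΘ : ∀ᶠ w in 𝓝 (F ζ), F (Θ w) = w ∧ Θ w ∈ s) : DifferentiableAt ℂ Θ (F ζ) := by
  have hst : HasStrictDerivAt F (deriv F ζ) ζ := hF.hasStrictDerivAt
  have hψ := hst.to_localInverse hF'
  have h0 : hst.localInverse F (deriv F ζ) ζ hF' (F ζ) = ζ :=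
    (hst.eventually_left_inverse hF').self_of_nhds
  have h1 : ∀ᶠ w in 𝓝 (F ζ), hst.localInverse F (deriv F ζ) ζ hF' w ∈ s :=
    hψ.hasDerivAt.continuousAt.eventually_mem (by rwa [h0])
  refine hψ.hasDerivAt.differentiableAt.congr_of_eventuallyEq ?_
  filter_upwards [hΘ, h1, hst.eventually_right_inverse hF'] with w h2 h3 h4
  exact hinj h2.2 h3 (h2.1.trans h4.symm)

end LogCoord

/-! ### Inversion near infinity -/

section Inverse

open Metric

/-- `Θ` is an inverse, near infinity, of the function `F`. -/
structure IsFarInverse (F Θ : ℂ → ℂ) : Prop where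
  far : Tendsto Θ far far
  up : Tendsto Θ (comap Complex.im atTop) (comap Complex.im atTop)
  down : Tendsto Θ (comap Complex.im atBot) (comap Complex.im atBot)
  right : ∀ᶠ w in AntiholParabolic.far, F (Θ w) = w
  left : ∀ᶠ ζ in AntiholParabolic.far, Θ (F ζ) = ζ
  differentiable : ∀ᶠ w in AntiholParabolic.far, DifferentiableAt ℂ Θ w

lemma tendsto_of_mem_closedBall {ℓ : ℂ → ℝ} (hℓ : LipschitzWith 1 ℓ) {a t : ℂ → ℂ} {B : ℝ}
    (ha : Tendsto a (comap ℓ atTop) (comap ℓ atTop))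
    (h : ∀ᶠ ζ in comap ℓ atTop, t ζ ∈ closedBall (a ζ) B) :
    Tendsto t (comap ℓ atTop) (comap ℓ atTop) := by
  intro s hs
  change ∀ᶠ ζ in comap ℓ atTop, t ζ ∈ s
  filter_upwards [h, ha (eventually_closedBall_subset hℓ hs B)] with ζ h1 h2
  exact h2 h1

lemma tendsto_sub_const_comap {ℓ : ℂ → ℝ} (hℓ : LipschitzWith 1 ℓ) (c : ℂ) :
    Tendsto (fun w : ℂ => w - c) (comap ℓ atTop) (comap ℓ atTop) :=
  tendsto_comap_of_norm_sub_le hℓ (B := ‖c‖) (Eventually.of_forall fun w => by simp)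

/-- The explicit map a(w) = (w - c) + β log(w - c) is an approximate inverse: F(a(w)) - w → 0
because log a(w) - log(w - c) → 0. By `eventually_exists_eq`, an exact preimage lies within distance
3 of a(w), and a bounded displacement preserves the limits at infinity and at both ends. -/
theorem IsAsympLog.exists_inverse {β : ℝ} {F : ℂ → ℂ} {c : ℂ} (h : IsAsympLog β F c) :
    ∃ Θ, IsFarInverse F Θ := by
  classical
  set a : ℂ → ℂ := fun w => (w - c) + β * Complex.log (w - c) with ha
  have hsub := tendsto_sub_const_comap lipschitzWith_rho c
  have ha_far : Tendsto a far far := (tendsto_add_mul_log_far β).comp hsub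
  have ha_up : Tendsto a (comap Complex.im atTop) (comap Complex.im atTop) :=
    (tendsto_add_mul_log_up β).comp (tendsto_sub_const_comap lipschitzWith_im c)
  have ha_down : Tendsto a (comap Complex.im atBot) (comap Complex.im atBot) := by
    refine (tendsto_add_mul_log_down β).comp ?_
    rw [comap_im_atBot]
    exact tendsto_sub_const_comap lipschitzWith_neg_im c
  have hlog : Tendsto (fun w => Complex.log (a w) - Complex.log (w - c)) far (𝓝 0) := by
    refine tendsto_log_sub_log (C := |β| * Real.pi) hsub (Eventually.of_forall fun w => ?_) ?_
    · rw [ha]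
      simpa only [add_sub_cancel_left] using abs_im_mul_log_le β (w - c)
    · have := ((isLittleO_log_far.const_mul_left (β : ℂ)).tendsto_div_nhds_zero).comp hsub
      refine this.congr fun w => ?_
      simp [ha]
  have hclose : ∀ᶠ w in far, ‖w - F (a w)‖ < 1 := by
    have h1 : Tendsto (fun w => (F (a w) - logCoord β (a w)) - c -
        β * (Complex.log (a w) - Complex.log (w - c))) far (𝓝 (c - c - β * 0)) :=
      ((h.tendsto.comp ha_far).sub_const c).sub (hlog.const_mul _)
    rw [sub_self, mul_zero, sub_zero] at h1
    filter_upwards [h1.eventually (ball_mem_nhds 0 one_pos)] with w hw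
    rw [dist_zero_right] at hw
    rw [norm_sub_rev]
    convert hw using 2
    simp only [ha, logCoord]
    ring
  have hex : ∀ᶠ w in far, ∃ ζ ∈ closedBall (a w) 3, F ζ = w := by
    filter_upwards [hclose, ha_far.eventually h.eventually_exists_eq] with w h1 h2
    exact h2 w h1
  let Θ : ℂ → ℂ := fun w => if hw : ∃ ζ ∈ closedBall (a w) 3, F ζ = w then hw.choose else 0
  have hΘ : ∀ᶠ w in far, Θ w ∈ closedBall (a w) 3 ∧ F (Θ w) = w := by
    filter_upwards [hex] with w hw
    simp only [Θ, dif_pos hw]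
    exact hw.choose_spec
  have hΘfar : Tendsto Θ far far :=
    tendsto_of_mem_closedBall lipschitzWith_rho ha_far (hΘ.mono fun w hw => hw.1)
  obtain ⟨s, hs, hinj⟩ := h.exists_injOn
  refine ⟨Θ, hΘfar, ?_, ?_, hΘ.mono fun w hw => hw.2, ?_, ?_⟩
  · exact tendsto_of_mem_closedBall lipschitzWith_im ha_up
      (up_le_far (hΘ.mono fun w hw => hw.1))
  · have := down_le_far (hΘ.mono fun w hw => hw.1)
    rw [comap_im_atBot] at *
    exact tendsto_of_mem_closedBall lipschitzWith_neg_im ha_down this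
  · filter_upwards [hs, h.tendsto_far.eventually (hΘfar hs), h.tendsto_far.eventually hΘ]
      with ζ h1 h2 h3
    exact hinj h2 h1 h3.2
  · filter_upwards [hΘfar.eventually (eventually_eventually_nhds_far hs),
      hΘfar.eventually h.analyticAt, hΘfar.eventually h.eventually_deriv_ne_zero, hΘ,
      eventually_eventually_nhds_far (hΘ.and (hΘfar hs))] with w h1 h2 h3 h4 h5
    have := differentiableAt_of_local_rightInverse h2 h3 h1 hinj
      (by rw [h4.2]; exact h5.mono fun w hw => ⟨hw.1.2, hw.2⟩)
    rwa [h4.2] at this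

end Inverse

/-! ### Injective entire functions -/

section Entire

/-- An injective entire function is affine. -/
theorem exists_affine_of_injective {E : ℂ → ℂ} (hE : Differentiable ℂ E)
    (hinj : Function.Injective E) : ∃ a b : ℂ, ∀ z, E z = a * z + b := by
  obtain ⟨z₀, hz₀⟩ : ∃ z₀, deriv E z₀ ≠ 0 := by
    by_contra! hc
    have := is_const_of_deriv_eq_zero hE hc 0 1
    exact zero_ne_one (hinj this)
  have hd : Differentiable ℂ (dslope E z₀) := by
    have := (Complex.differentiableOn_dslope (s := Set.univ) (c := z₀) univ_mem).2
      hE.differentiableOn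
    exact differentiableOn_univ.1 this
  have hne : ∀ z, dslope E z₀ z ≠ 0 := by
    intro z
    rcases eq_or_ne z z₀ with rfl | hz
    · rwa [dslope_same]
    · rw [dslope_of_ne _ hz, slope_def_field]
      exact div_ne_zero (sub_ne_zero.2 (hinj.ne hz)) (sub_ne_zero.2 hz)
  -- Q(z) = (z - z₀)/(E z - E z₀) is entire by injectivity and E'(z₀) ≠ 0, and it has no zero. It
  -- suffices to show that it is constant, by way of linear growth.
  set Q : ℂ → ℂ := fun z => (dslope E z₀ z)⁻¹ with hQ
  have hQd : Differentiable ℂ Q := fun z => (hd z).inv (hne z)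
  have hQE : ∀ z, z - z₀ = Q z * (E z - E z₀) := by
    intro z
    rcases eq_or_ne z z₀ with rfl | hz
    · simp
    · simp only [hQ]
      rw [dslope_of_ne _ hz, slope_def_field]
      have := sub_ne_zero.2 (hinj.ne hz)
      field_simp
  -- `Q` grows at most linearly
  obtain ⟨ε, hε, hεb⟩ : ∃ ε > 0, ∀ z, 1 ≤ ‖z - z₀‖ → ε ≤ ‖E z - E z₀‖ := by
    have han : AnalyticAt ℂ E z₀ := hE.analyticAt z₀
    have hmap : 𝓝 (E z₀) ≤ map E (𝓝 z₀) := by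
      rw [← han.hasStrictDerivAt.map_nhds_eq hz₀]
    -- The image of the unit disc already covers an ε-disc about E z₀, so injectivity keeps all
    -- other values out of that disc.
    have := hmap (image_mem_map (Metric.ball_mem_nhds z₀ one_pos))
    obtain ⟨ε, hε, hsub⟩ := Metric.mem_nhds_iff.1 this
    refine ⟨ε, hε, fun z hz => ?_⟩
    by_contra! hc
    obtain ⟨w, hw, hwz⟩ := hsub (by rwa [Metric.mem_ball, dist_eq_norm] : E z ∈ Metric.ball _ ε)
    rw [hinj hwz, Metric.mem_ball, dist_eq_norm] at hw
    linarith
  have hgrowth : ∀ z, 1 ≤ ‖z - z₀‖ → ‖Q z‖ ≤ ‖z - z₀‖ / ε := by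
    intro z hz
    rw [le_div_iff₀ hε, hQE z, norm_mul]
    exact mul_le_mul_of_nonneg_left (hεb z hz) (norm_nonneg _)
  have hderiv : ∀ z, ‖deriv Q z‖ ≤ 2 / ε := by
    intro z
    have hR : (0 : ℝ) < ‖z - z₀‖ + 1 := by positivity
    have := Complex.norm_deriv_le_of_forall_mem_sphere_norm_le (c := z) hR
      (C := (2 * (‖z - z₀‖ + 1)) / ε) hQd.diffContOnCl (fun w hw => ?_)
    · refine this.trans (le_of_eq ?_)
      field_simp
    · rw [mem_sphere_iff_norm] at hw
      have h1 : ‖w - z‖ - ‖z - z₀‖ ≤ ‖w - z₀‖ := by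
        have := norm_sub_le (w - z₀) (z - z₀)
        rw [sub_sub_sub_cancel_right] at this
        linarith
      have h2 : ‖w - z₀‖ ≤ ‖w - z‖ + ‖z - z₀‖ := by
        have := norm_add_le (w - z) (z - z₀)
        rwa [sub_add_sub_cancel] at this
      refine (hgrowth w (by linarith)).trans ?_
      gcongr
      linarith
  have hQ' : Differentiable ℂ (deriv Q) := hQd.deriv
  have hconst : ∀ z, deriv Q z = deriv Q z₀ := fun z =>
    hQ'.apply_eq_apply_of_bounded (isBounded_iff_forall_norm_le.2
      ⟨2 / ε, by rintro _ ⟨z, rfl⟩; exact hderiv z⟩) z z₀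
  have hlin : ∀ z, Q z = deriv Q z₀ * z + (Q z₀ - deriv Q z₀ * z₀) := by
    intro z
    have hd0 : ∀ w, deriv (fun w => Q w - deriv Q z₀ * w) w = 0 := by
      intro w
      have := ((hQd w).hasDerivAt.sub ((hasDerivAt_id w).const_mul (deriv Q z₀))).deriv
      rw [mul_one, hconst w, sub_self] at this
      exact this
    have := is_const_of_deriv_eq_zero (hQd.sub (differentiable_id.const_mul (deriv Q z₀))) hd0 z z₀
    simp only [Pi.sub_apply] at this
    linear_combination this
  have hQne : ∀ z, Q z ≠ 0 := fun z => inv_ne_zero (hne z)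
  -- An affine function without zeros is constant.
  have ha : deriv Q z₀ = 0 := by
    by_contra ha
    apply hQne (-(Q z₀ - deriv Q z₀ * z₀) / deriv Q z₀)
    rw [hlin]
    field_simp
    ring
  refine ⟨(Q z₀)⁻¹, E z₀ - (Q z₀)⁻¹ * z₀, fun z => ?_⟩
  have h1 := hQE z
  rw [hlin z, ha] at h1
  have := hQne z₀
  field_simp
  linear_combination (-1 : ℂ) * h1
end Entire

/-! ### Orbits of maps close to the unit translation -/

section Orbits

open Metric Finset

/-- `∑ (M + |x + i|)^{-p}` is small, uniformly in `x`, for large `M`. -/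
lemma exists_sum_rpow_le {p : ℝ} (hp : 1 < p) {δ : ℝ} (hδ : 0 < δ) :
    ∃ M : ℕ, ∀ (x : ℝ) (N : ℕ), ∑ i ∈ range N, ((M : ℝ) + 1 + |x + i|) ^ (-p) ≤ δ := by
  have hs : Summable fun m : ℕ => ((m : ℝ) ^ (-p)) := Real.summable_nat_rpow.2 (by linarith)
  have htail := tendsto_sum_nat_add fun m : ℕ => ((m : ℝ) ^ (-p))
  obtain ⟨M, hM⟩ := (htail.eventually (ge_mem_nhds (show 0 < δ / 2 by positivity))).exists
  refine ⟨M, fun x N => ?_⟩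
  have hsM : Summable fun m : ℕ => (((m + M : ℕ) : ℝ) ^ (-p)) := (summable_nat_add_iff M).2 hs
  -- indices on which the floor of `|x + i|` is injective
  have key : ∀ s : Finset ℕ, Set.InjOn (fun i : ℕ => ⌊|x + i|⌋₊) s →
      ∑ i ∈ s, ((M : ℝ) + 1 + |x + i|) ^ (-p) ≤ δ / 2 := by
    intro s hinj
    calc ∑ i ∈ s, ((M : ℝ) + 1 + |x + i|) ^ (-p)
        ≤ ∑ i ∈ s, (((⌊|x + i|⌋₊ + 1 + M : ℕ) : ℝ) ^ (-p)) := by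
          refine sum_le_sum fun i _ => ?_
          refine Real.rpow_le_rpow_of_nonpos (by positivity) ?_ (by linarith)
          have := Nat.floor_le (abs_nonneg (x + i))
          push_cast
          linarith
      _ = ∑ m ∈ s.image (fun i : ℕ => ⌊|x + i|⌋₊ + 1), (((m + M : ℕ) : ℝ) ^ (-p)) := by
          rw [sum_image]
          intro i hi j hj hij
          exact hinj hi hj (Nat.succ_injective hij)
      _ ≤ ∑' m : ℕ, (((m + M : ℕ) : ℝ) ^ (-p)) :=
          hsM.sum_le_tsum _ fun m _ => by positivity
      _ ≤ δ / 2 := hM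
  have hfloor : ∀ y : ℝ, ∀ d : ℕ, 0 ≤ y → 0 < d → ⌊y⌋₊ < ⌊y + d⌋₊ := by
    intro y d hy hd
    rw [Nat.floor_add_natCast hy]
    omega
  -- The numbers x + i are spaced by 1, so the integer parts of |x + i| are distinct on the
  -- nonnegative half and, separately, on the negative half. Each half costs δ/2.
  have h1 := key ((range N).filter fun i : ℕ => 0 ≤ x + i) (by
    intro i hi j hj hij
    simp only [coe_filter, Set.mem_ofPred_eq] at hi hj
    simp only [abs_of_nonneg hi.2, abs_of_nonneg hj.2] at hij
    by_contra hne
    rcases Nat.lt_or_gt_of_ne hne with h | h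
    · obtain ⟨d, rfl⟩ := Nat.exists_eq_add_of_lt h
      have := hfloor (x + i) (d + 1) hi.2 (by omega)
      push_cast at this hij
      rw [hij, ← add_assoc, ← add_assoc, ← add_assoc] at this
      exact lt_irrefl _ this
    · obtain ⟨d, rfl⟩ := Nat.exists_eq_add_of_lt h
      have := hfloor (x + j) (d + 1) hj.2 (by omega)
      push_cast at this hij
      rw [← hij, ← add_assoc, ← add_assoc, ← add_assoc] at this
      exact lt_irrefl _ this)
  have h2 := key ((range N).filter fun i : ℕ => ¬ 0 ≤ x + i) (by
    intro i hi j hj hij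
    simp only [coe_filter, Set.mem_ofPred_eq, not_le] at hi hj
    simp only [abs_of_neg hi.2, abs_of_neg hj.2] at hij
    by_contra hne
    rcases Nat.lt_or_gt_of_ne hne with h | h
    · obtain ⟨d, rfl⟩ := Nat.exists_eq_add_of_lt h
      have := hfloor (-(x + (i + d + 1 : ℕ))) (d + 1) (by linarith [hj.2]) (by omega)
      rw [← hij] at this
      push_cast at this
      rw [show -(x + (i + d + 1 : ℝ)) + (d + 1) = -(x + i) by ring] at this
      exact lt_irrefl _ this
    · obtain ⟨d, rfl⟩ := Nat.exists_eq_add_of_lt h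
      have := hfloor (-(x + (j + d + 1 : ℕ))) (d + 1) (by linarith [hi.2]) (by omega)
      rw [hij] at this
      push_cast at this
      rw [show -(x + (j + d + 1 : ℝ)) + (d + 1) = -(x + j) by ring] at this
      exact lt_irrefl _ this)
  rw [← sum_filter_add_sum_filter_not (range N) (fun i : ℕ => 0 ≤ x + i)]
  linarith

/-- `Γ` is holomorphic near infinity and, in the coordinate `logCoord β`, close to the unit
translation. -/
structure IsNearTranslation (β κ : ℝ) (Γ : ℂ → ℂ) : Prop where
  pos : 0 < κ
  differentiable : ∀ᶠ ζ in far, DifferentiableAt ℂ Γ ζ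
  tendsto : Tendsto (fun ζ => Γ ζ - ζ) far (𝓝 1)
  bound : ∃ C : ℝ, ∀ᶠ ζ in far,
    ‖logCoord β (Γ ζ) - logCoord β ζ - 1‖ ≤ C * ‖ζ‖ ^ (-(1 + κ))

lemma eventually_norm_logCoord_le (β : ℝ) : ∀ᶠ ζ in far, ‖logCoord β ζ‖ ≤ 2 * ‖ζ‖ := by
  filter_upwards [eventually_norm_mul_log_le β one_pos] with ζ h
  rw [logCoord]
  linarith [norm_sub_le ζ (β * Complex.log ζ)]

/-- On the part of the plane where `rho` is bounded, so is `rho` of the time coordinate. -/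
lemma eventually_rho_logCoord_le (β : ℝ) :
    ∀ᶠ ζ in far, ∀ M, 0 ≤ M → rho ζ ≤ M → rho (logCoord β ζ) ≤ 2 * M + |β| * Real.pi := by
  have hlog : ∀ᶠ x : ℝ in atTop, ‖|β| * Real.log x‖ ≤ 1 / 2 * ‖x‖ :=
    (Real.isLittleO_log_id_atTop.const_mul_left |β|).def (by norm_num)
  filter_upwards [tendsto_norm_far.eventually hlog, eventually_far_norm_ge 1]
    with ζ h1 h2 M hM hρ
  have hre : ζ.re ≤ M := (le_max_left _ _).trans hρ
  have him : |ζ.im| ≤ M := (le_max_right _ _).trans hρ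
  have hπ : 0 ≤ |β| * Real.pi := by positivity
  have h3 := abs_im_mul_log_le β ζ
  rw [Real.norm_eq_abs, norm_norm, abs_mul, abs_abs] at h1
  have h4 : |((β : ℂ) * Complex.log ζ).re| ≤ 1 / 2 * ‖ζ‖ := by
    rw [Complex.re_ofReal_mul, abs_mul, Complex.log_re]
    exact h1
  have h5 := Complex.norm_le_abs_re_add_abs_im ζ
  refine max_le ?_ ?_
  · rw [logCoord, Complex.sub_re]
    have := (abs_le.1 h4).1
    rcases abs_cases ζ.re with ⟨e, h⟩ | ⟨e, h⟩ <;> rw [e] at h5 <;> linarith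
  · rw [logCoord, Complex.sub_im]
    have := abs_sub ζ.im ((β : ℂ) * Complex.log ζ).im
    linarith

namespace IsNearTranslation

variable {β κ : ℝ} {Γ : ℂ → ℂ}

lemma eventually_norm_sub_le (h : IsNearTranslation β κ Γ) : ∀ᶠ ζ in far, ‖Γ ζ - ζ‖ ≤ 2 := by
  have := h.tendsto.norm
  rw [norm_one] at this
  exact (this.eventually (gt_mem_nhds one_lt_two)).mono fun _ h => h.le

/-- Orbits that start far enough stay far, and are close to orbits of the translation. -/
theorem eventually_orbit (h : IsNearTranslation β κ Γ) {δ : ℝ} (hδ : 0 < δ) {s : Set ℂ}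
    (hs : s ∈ far) : ∀ᶠ ζ in far, ∀ N : ℕ, Γ^[N] ζ ∈ s ∧
      ‖logCoord β (Γ^[N] ζ) - logCoord β ζ - N‖ ≤ δ := by
  have hκ := h.pos
  obtain ⟨C, hC⟩ := h.bound
  obtain ⟨M₀, hM₀⟩ := eventually_far_iff.1 (hC.and (h.eventually_norm_sub_le.and
    ((eventually_norm_logCoord_le β).and (eventually_rho_logCoord_le β))))
  obtain ⟨M₁, hM₁⟩ := eventually_far_iff.1 hs
  set Ms : ℝ := max (max (M₀ + 2) M₁) 1 with hMs
  have hMs0 : M₀ + 2 ≤ Ms := (le_max_left _ _).trans (le_max_left _ _)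
  have hMs1 : M₁ ≤ Ms := (le_max_right _ _).trans (le_max_left _ _)
  have hMs2 : 1 ≤ Ms := le_max_right _ _
  -- The factor 1/4 combines ‖logCoord ξ‖ ≤ 2‖ξ‖ with the lower bound `hlow` on ‖logCoord ξ‖ along
  -- the orbit.
  set A : ℝ := (|C| + 1) * (1 / 4 : ℝ) ^ (-(1 + κ)) with hA
  have hApos : 0 < A := by positivity
  obtain ⟨M, hM⟩ := exists_sum_rpow_le (show 1 < 1 + κ by linarith)
    (show 0 < min δ 1 / A by positivity)
  filter_upwards [eventually_far_ge Ms,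
    (tendsto_logCoord_far β).eventually (eventually_far_ge (4 * (M + 1) + 4)),
    (tendsto_logCoord_far β).eventually (eventually_far_ge (2 * Ms + |β| * Real.pi + 2))]
    with ζ h1 h2 h3
  set x : ℝ := (logCoord β ζ).re with hx
  set S : ℕ → ℝ := fun N => A * ∑ i ∈ range N, ((M : ℝ) + 1 + |x + i|) ^ (-(1 + κ)) with hS
  have hSle : ∀ N, S N ≤ min δ 1 := by
    intro N
    have := hM x N
    rw [le_div_iff₀ hApos] at this
    simp only [hS]
    linarith
  have key : ∀ N : ℕ, Ms ≤ rho (Γ^[N] ζ) ∧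
      ‖logCoord β (Γ^[N] ζ) - logCoord β ζ - N‖ ≤ S N := by
    intro N
    induction N with
    | zero => simp [h1, hS]
    | succ N ih =>
      obtain ⟨ih1, ih2⟩ := ih
      set ξ := Γ^[N] ζ with hξ
      rw [Function.iterate_succ_apply', ← hξ]
      obtain ⟨b1, b2, b3, -⟩ := hM₀ ξ (by linarith)
      have hS1 : S N ≤ 1 := (hSle N).trans (min_le_right _ _)
      -- The orbit's time coordinate stays within 1 of that of ζ plus N. The norm of the latter
      -- dominates both |x + N| and `rho` of the initial time coordinate, since adding N ≥ 0 does
      -- not decrease `rho`; averaging the two bounds gives the claim.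
      have hlow : ((M : ℝ) + 1 + |x + N|) / 2 ≤ ‖logCoord β ξ‖ := by
        have e1 : |x + N| ≤ ‖logCoord β ζ + N‖ := by
          have := Complex.abs_re_le_norm (logCoord β ζ + N)
          simpa [hx] using this
        have e2 : rho (logCoord β ζ) ≤ ‖logCoord β ζ + N‖ := by
          refine le_trans ?_ (rho_le_norm _)
          refine max_le_max ?_ ?_ <;> simp
        have e3 := norm_sub_le (logCoord β ξ) (logCoord β ξ - logCoord β ζ - N)
        rw [show logCoord β ξ - (logCoord β ξ - logCoord β ζ - N) = logCoord β ζ + N by ring] at e3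
        linarith
      have hstep : ‖logCoord β (Γ ξ) - logCoord β ξ - 1‖ ≤
          A * ((M : ℝ) + 1 + |x + N|) ^ (-(1 + κ)) := by
        have e1 : (0 : ℝ) < (M : ℝ) + 1 + |x + N| := by positivity
        calc ‖logCoord β (Γ ξ) - logCoord β ξ - 1‖ ≤ C * ‖ξ‖ ^ (-(1 + κ)) := b1
          _ ≤ (|C| + 1) * ‖ξ‖ ^ (-(1 + κ)) := by
              gcongr
              linarith [le_abs_self C]
          _ ≤ (|C| + 1) * (1 / 4 * ((M : ℝ) + 1 + |x + N|)) ^ (-(1 + κ)) := by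
              refine mul_le_mul_of_nonneg_left ?_ (by positivity)
              exact Real.rpow_le_rpow_of_nonpos (by positivity) (by linarith) (by linarith)
          _ = A * ((M : ℝ) + 1 + |x + N|) ^ (-(1 + κ)) := by
              rw [Real.mul_rpow (by norm_num) e1.le, hA]
              ring
      have hsum : ‖logCoord β (Γ ξ) - logCoord β ζ - (N + 1 : ℕ)‖ ≤ S (N + 1) := by
        have e : logCoord β (Γ ξ) - logCoord β ζ - (N + 1 : ℕ) =
            (logCoord β (Γ ξ) - logCoord β ξ - 1) + (logCoord β ξ - logCoord β ζ - N) := by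
          push_cast; ring
        rw [e]
        refine (norm_add_le _ _).trans ?_
        simp only [hS, sum_range_succ, mul_add] at ih2 ⊢
        linarith
      refine ⟨?_, hsum⟩
      -- Bootstrap: one step changes `rho` by at most 2, so the next point still satisfies the
      -- estimates valid beyond M₀. If it had `rho` below Ms, its time coordinate would have `rho`
      -- at most 2 Ms + |β|π, although it follows a translate of a time coordinate that started at
      -- least 2 above this bound.
      by_contra! hcon
      have hge : M₀ ≤ rho (Γ ξ) := by
        have := le_add_of_lipschitzWith lipschitzWith_rho b2
        linarith
      have e1 := (hM₀ _ hge).2.2.2 Ms (by linarith) hcon.le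
      have e2 : rho (logCoord β ζ) ≤ rho (logCoord β ζ + (N + 1 : ℕ)) := by
        refine max_le_max ?_ ?_
        · simp only [Complex.add_re, Complex.natCast_re]
          have : (0 : ℝ) ≤ (N + 1 : ℕ) := Nat.cast_nonneg _
          linarith
        · simp
      have e3 : rho (logCoord β ζ + (N + 1 : ℕ)) ≤ rho (logCoord β (Γ ξ)) + 1 := by
        refine le_add_of_lipschitzWith lipschitzWith_rho ?_
        rw [← sub_sub]
        exact hsum.trans ((hSle _).trans (min_le_right _ _))
      linarith
  intro N
  exact ⟨hM₁ _ (hMs1.trans (key N).1), (key N).2.trans ((hSle N).trans (min_le_left _ _))⟩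

lemma tendsto_far (h : IsNearTranslation β κ Γ) : Tendsto Γ far far :=
  tendsto_comap_of_norm_sub_le lipschitzWith_rho h.eventually_norm_sub_le

/-- Orbits go to infinity at a speed that is controlled by the time coordinate. -/
lemma exists_forall_orbit_mem (h : IsNearTranslation β κ Γ) : ∃ s₀ ∈ far, ∀ s ∈ far, ∃ K : ℝ,
    ∀ ζ ∈ s₀, ∀ N : ℕ, K ≤ (logCoord β ζ).re + N → Γ^[N] ζ ∈ s := by
  obtain ⟨M₀, hM₀⟩ := eventually_far_iff.1 (eventually_rho_logCoord_le β)
  refine ⟨_, h.eventually_orbit one_pos (eventually_far_ge M₀), fun s hs => ?_⟩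
  obtain ⟨M₁, hM₁⟩ := eventually_far_iff.1 hs
  refine ⟨2 * max M₁ 0 + |β| * Real.pi + 2, fun ζ hζ N hN => ?_⟩
  obtain ⟨h1, h2⟩ := hζ N
  by_contra hcon
  have h3 : rho (Γ^[N] ζ) ≤ max M₁ 0 := by
    by_contra! hc
    exact hcon (hM₁ _ ((le_max_left _ _).trans hc.le))
  have h4 := hM₀ _ h1 _ (le_max_right _ _) h3
  have h5 : (logCoord β ζ).re + N ≤ rho (logCoord β (Γ^[N] ζ)) + 1 := by
    refine le_trans ?_ (le_add_of_lipschitzWith lipschitzWith_rho (x := logCoord β ζ + N)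
      (by rw [← sub_sub]; exact h2))
    refine le_trans (le_of_eq ?_) (le_max_left _ _)
    simp
  linarith

lemma eventually_tendsto_orbit (h : IsNearTranslation β κ Γ) :
    ∀ᶠ ζ in far, Tendsto (fun N : ℕ => Γ^[N] ζ) atTop far := by
  obtain ⟨s₀, hs₀, H⟩ := h.exists_forall_orbit_mem
  filter_upwards [hs₀] with ζ hζ s hs
  obtain ⟨K, hK⟩ := H s hs
  have : Tendsto (fun N : ℕ => (logCoord β ζ).re + N) atTop atTop :=
    tendsto_atTop_add_const_left _ _ tendsto_natCast_atTop_atTop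
  change ∀ᶠ N : ℕ in atTop, Γ^[N] ζ ∈ s
  filter_upwards [this.eventually (eventually_ge_atTop K)] with N hN
  exact hK ζ hζ N hN

end IsNearTranslation

end Orbits

/-! ### Fatou coordinates: existence, and uniqueness up to a constant -/

section FatouCoordinate

open Metric

lemma exists_isOpen_subset_of_mem_far {s : Set ℂ} (hs : s ∈ far) :
    ∃ U ∈ far, IsOpen U ∧ U ⊆ s := by
  obtain ⟨M, hM⟩ := eventually_far_iff.1 hs
  refine ⟨{ζ | M < rho ζ}, ?_, isOpen_lt continuous_const continuous_rho, fun ζ hζ => hM ζ hζ.le⟩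
  filter_upwards [eventually_far_ge (M + 1)] with ζ hζ
  linarith

lemma differentiableAt_logCoord (β : ℝ) {ζ : ℂ} (h : ζ ∈ Complex.slitPlane) :
    DifferentiableAt ℂ (logCoord β) ζ :=
  differentiableAt_id.sub ((differentiableAt_id.clog h).const_mul _)

namespace IsNearTranslation

variable {β κ : ℝ} {Γ : ℂ → ℂ}

/-- Existence of Fatou coordinates. -/
theorem exists_fatou (h : IsNearTranslation β κ Γ) :
    ∃ Φ, IsAsympLog β Φ 0 ∧ ∀ᶠ ζ in far, Φ (Γ ζ) = Φ ζ + 1 := by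
  obtain ⟨s₀, hs₀, H⟩ := h.exists_forall_orbit_mem
  have hD := h.eventually_orbit one_pos (h.differentiable.and eventually_far_mem_slitPlane)
  obtain ⟨U, hU, hUo, hUs⟩ := exists_isOpen_subset_of_mem_far (inter_mem hs₀ hD)
  set Φ : ℕ → ℂ → ℂ := fun N ζ => logCoord β (Γ^[N] ζ) - N with hΦ
  -- The orbit estimate is applied from the point Γ^N ζ, which is as far out as needed once Re of
  -- the time coordinate plus N exceeds K. The threshold depends on ζ only through that real part,
  -- whence local uniformity.
  have hT : ∀ δ > 0, ∃ K : ℝ, ∀ ζ ∈ U, ∀ N : ℕ, K ≤ (logCoord β ζ).re + N →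
      ∀ m, ‖Φ (N + m) ζ - Φ N ζ‖ ≤ δ := by
    intro δ hδ
    obtain ⟨K, hK⟩ := H _ (h.eventually_orbit hδ univ_mem)
    refine ⟨K, fun ζ hζ N hN m => ?_⟩
    have := (hK ζ (hUs hζ).1 N hN m).2
    rw [← Function.iterate_add_apply, add_comm m N] at this
    convert this using 2
    simp only [hΦ]
    push_cast
    ring
  have hcau : ∀ ζ ∈ U, CauchySeq fun N => Φ N ζ := by
    intro ζ hζ
    refine Metric.cauchySeq_iff'.2 fun ε hε => ?_
    obtain ⟨K, hK⟩ := hT (ε / 2) (by positivity)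
    obtain ⟨N, hN⟩ := exists_nat_ge (K - (logCoord β ζ).re)
    refine ⟨N, fun n hn => ?_⟩
    obtain ⟨m, rfl⟩ := Nat.exists_eq_add_of_le hn
    rw [dist_eq_norm]
    have := hK ζ hζ N (by linarith) m
    linarith
  set L : ℂ → ℂ := fun ζ => limUnder atTop fun N => Φ N ζ with hL
  have hlim : ∀ ζ ∈ U, Tendsto (fun N => Φ N ζ) atTop (𝓝 (L ζ)) := fun ζ hζ =>
    tendsto_nhds_limUnder (cauchySeq_tendsto_of_complete (hcau ζ hζ))
  have hlimδ : ∀ ζ ∈ U, ∀ N δ, (∀ m, ‖Φ (N + m) ζ - Φ N ζ‖ ≤ δ) → ‖L ζ - Φ N ζ‖ ≤ δ := by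
    intro ζ hζ N δ hm
    have : Tendsto (fun m => Φ (N + m) ζ) atTop (𝓝 (L ζ)) := by
      simp_rw [add_comm N]
      exact (tendsto_add_atTop_iff_nat N).2 (hlim ζ hζ)
    exact le_of_tendsto (this.sub_const (Φ N ζ)).norm (Eventually.of_forall hm)
  have hslit : ∀ ζ ∈ U, ζ ∈ Complex.slitPlane := fun ζ hζ => ((hUs hζ).2 0).1.2
  have hdiffN : ∀ N, DifferentiableOn ℂ (Φ N) U := by
    intro N ζ hζ
    have hit : ∀ n, DifferentiableAt ℂ (Γ^[n]) ζ := by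
      intro n
      induction n with
      | zero => exact differentiableAt_id
      | succ n ih =>
        rw [Function.iterate_succ']
        exact DifferentiableAt.comp ζ ((hUs hζ).2 n).1.1 ih
    exact ((DifferentiableAt.comp ζ (differentiableAt_logCoord β ((hUs hζ).2 N).1.2)
      (hit N)).sub_const _).differentiableWithinAt
  have hunif : TendstoLocallyUniformlyOn Φ L atTop U := by
    rw [Metric.tendstoLocallyUniformlyOn_iff]
    intro ε hε ζ hζ
    obtain ⟨K, hK⟩ := hT (ε / 2) (by positivity)
    have hc : ∀ᶠ ζ' in 𝓝 ζ, (logCoord β ζ).re - 1 < (logCoord β ζ').re := by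
      have : ContinuousAt (fun ζ' => (logCoord β ζ').re) ζ :=
        Complex.continuous_re.continuousAt.comp
          (differentiableAt_logCoord β (hslit ζ hζ)).continuousAt
      exact this.eventually (lt_mem_nhds (by linarith))
    refine ⟨_, inter_mem_nhdsWithin U hc, ?_⟩
    obtain ⟨N₀, hN₀⟩ := exists_nat_ge (K - ((logCoord β ζ).re - 1))
    filter_upwards [eventually_ge_atTop N₀] with N hN ζ' hζ'
    have h1 : (N₀ : ℝ) ≤ N := Nat.cast_le.2 hN
    have h2 : (logCoord β ζ).re - 1 < (logCoord β ζ').re := hζ'.2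
    rw [dist_eq_norm]
    have := hlimδ ζ' hζ'.1 N _ (hK ζ' hζ'.1 N (by linarith))
    linarith
  have hdiff : DifferentiableOn ℂ L U :=
    hunif.differentiableOn (Eventually.of_forall hdiffN) hUo
  refine ⟨L, ⟨?_, ?_⟩, ?_⟩
  · filter_upwards [hU] with ζ hζ
    exact hdiff.differentiableAt (hUo.mem_nhds hζ)
  · rw [Metric.tendsto_nhds]
    intro ε hε
    filter_upwards [hU, h.eventually_orbit (show 0 < ε / 2 by positivity) univ_mem] with ζ h1 h2
    have := hlimδ ζ h1 0 (ε / 2) (fun m => by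
      have := (h2 m).2
      convert this using 2
      simp only [hΦ, zero_add, Function.iterate_zero, id]
      push_cast
      ring)
    rw [dist_zero_right]
    simp only [hΦ, Function.iterate_zero, id, Nat.cast_zero, sub_zero] at this
    linarith
  · filter_upwards [hU, h.tendsto_far.eventually hU] with ζ h1 h2
    have e1 : Tendsto (fun N => Φ (N + 1) ζ + 1) atTop (𝓝 (L ζ + 1)) :=
      ((tendsto_add_atTop_iff_nat 1).2 (hlim ζ h1)).add_const 1
    refine tendsto_nhds_unique (hlim _ h2) (e1.congr fun N => ?_)
    simp only [hΦ, Function.iterate_succ_apply]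
    push_cast
    ring

/-- A univalent solution of the Abel equation agrees, up to a constant, with the time coordinate
near infinity. -/
theorem exists_isAsympLog_of_injOn (h : IsNearTranslation β κ Γ) {φ : ℂ → ℂ}
    (hd : ∀ᶠ ζ in far, DifferentiableAt ℂ φ ζ) (hinj : ∃ s ∈ far, Set.InjOn φ s)
    (habel : ∀ᶠ ζ in far, φ (Γ ζ) = φ ζ + 1) : ∃ c, IsAsympLog β φ c := by
  obtain ⟨Φ, hΦ, hΦΓ⟩ := h.exists_fatou
  obtain ⟨Θ, hΘ⟩ := hΦ.exists_inverse
  obtain ⟨s, hs, hsinj⟩ := hinj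
  set E₀ : ℂ → ℂ := fun w => φ (Θ w) with hE₀
  have hΘ1 : ∀ᶠ w in far, Θ (w + 1) = Γ (Θ w) := by
    filter_upwards [hΘ.far.eventually hΦΓ, hΘ.right,
      (h.tendsto_far.comp hΘ.far).eventually hΘ.left] with w h1 h2 h3
    rw [h2] at h1
    rw [← h1]
    exact h3
  obtain ⟨M, hM⟩ := eventually_far_iff.1 (((hΘ.far.eventually hd).and hΘ.differentiable).and
    ((hΘ1.and (hΘ.far.eventually habel)).and ((hΘ.far.eventually hs).and hΘ.right)))
  have hM' : ∀ w : ℂ, M ≤ w.re → (DifferentiableAt ℂ E₀ w ∧ E₀ (w + 1) = E₀ w + 1) ∧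
      Θ w ∈ s ∧ Φ (Θ w) = w := by
    intro w hw
    obtain ⟨⟨a1, a2⟩, ⟨a3, a4⟩, a5, a6⟩ := hM w (hw.trans (le_max_left _ _))
    exact ⟨⟨DifferentiableAt.comp w a1 a2, by simp only [hE₀, a3, a4]⟩, a5, a6⟩
  have hadd : ∀ (w : ℂ) (N : ℕ), M ≤ w.re → E₀ (w + N) = E₀ w + N := by
    intro w N hw
    induction N with
    | zero => simp
    | succ N ih =>
      have := (hM' (w + N) (by
        rw [Complex.add_re, Complex.natCast_re]
        linarith [(Nat.cast_nonneg N : (0 : ℝ) ≤ N)])).1.2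
      push_cast
      rw [← add_assoc, this, ih]
      ring
  -- E₀ = φ ∘ Θ commutes with the unit translation on the half-plane Re w ≥ M. Translating to the
  -- right and back extends it to the whole plane; the number of steps is irrelevant as soon as it
  -- is large enough, so holomorphy and injectivity are inherited.
  set E : ℂ → ℂ := fun w => E₀ (w + ⌈M - w.re⌉₊) - ⌈M - w.re⌉₊ with hE
  have hEN : ∀ (w : ℂ) (N : ℕ), M - w.re ≤ N → E w = E₀ (w + N) - N := by
    intro w N hN
    obtain ⟨m, rfl⟩ := Nat.exists_eq_add_of_le (Nat.ceil_le.2 hN)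
    have := hadd (w + ⌈M - w.re⌉₊) m (by
      rw [Complex.add_re, Complex.natCast_re]
      linarith [Nat.le_ceil (M - w.re)])
    simp only [hE]
    push_cast
    rw [← add_assoc, this]
    ring
  have hEd : Differentiable ℂ E := by
    intro w
    obtain ⟨N, hN⟩ := exists_nat_ge (M - w.re + 1)
    have hev : E =ᶠ[𝓝 w] fun w' => E₀ (w' + N) - N := by
      have : ∀ᶠ w' in 𝓝 w, w.re - 1 < w'.re :=
        Complex.continuous_re.continuousAt.eventually (lt_mem_nhds (by linarith))
      filter_upwards [this] with w' hw'
      exact hEN w' N (by linarith)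
    refine DifferentiableAt.congr_of_eventuallyEq ?_ hev
    refine DifferentiableAt.sub_const ?_ _
    have hdE := (hM' (w + N) (by rw [Complex.add_re, Complex.natCast_re]; linarith)).1.1
    exact DifferentiableAt.comp (g := E₀) (f := fun w' : ℂ => w' + N) w hdE
      (differentiableAt_id.add_const _)
  have hEinj : Function.Injective E := by
    intro a b hab
    obtain ⟨N, hN⟩ := exists_nat_ge (max (M - a.re) (M - b.re))
    have ha : M - a.re ≤ N := (le_max_left _ _).trans hN
    have hb : M - b.re ≤ N := (le_max_right _ _).trans hN
    rw [hEN a N ha, hEN b N hb, sub_left_inj] at hab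
    have ma := hM' (a + N) (by rw [Complex.add_re, Complex.natCast_re]; linarith)
    have mb := hM' (b + N) (by rw [Complex.add_re, Complex.natCast_re]; linarith)
    have := congrArg Φ (hsinj ma.2.1 mb.2.1 hab)
    rw [ma.2.2, mb.2.2] at this
    exact add_right_cancel this
  obtain ⟨a, b, hab⟩ := exists_affine_of_injective hEd hEinj
  have hEE₀ : ∀ w : ℂ, M ≤ w.re → E w = E₀ w := by
    intro w hw
    have := hEN w 0 (by simpa using hw)
    simpa using this
  have ha1 : a = 1 := by
    have h1 := (hM' (M : ℂ) (by simp)).1.2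
    rw [← hEE₀ _ (by simp), ← hEE₀ _ (by simp), hab, hab] at h1
    linear_combination h1
  -- The affine formula is known over a right half-plane only. Every far point reaches it along its
  -- orbit, where φ and Φ both increase by exactly N.
  have hφΦ : ∀ᶠ ζ in far, φ ζ = Φ ζ + b := by
    filter_upwards [h.eventually_orbit one_pos (habel.and (hΦΓ.and hΘ.left))] with ζ hζ
    have hN : ∀ N : ℕ, φ (Γ^[N] ζ) = φ ζ + N ∧ Φ (Γ^[N] ζ) = Φ ζ + N := by
      intro N
      induction N with
      | zero => simp
      | succ N ih =>
        obtain ⟨h1, h2, -⟩ := (hζ N).1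
        rw [Function.iterate_succ_apply', h1, h2, ih.1, ih.2]
        push_cast
        constructor <;> ring
    obtain ⟨N, hNM⟩ := exists_nat_ge (M - (Φ ζ).re)
    have h1 := hEE₀ (Φ ζ + N) (by rw [Complex.add_re, Complex.natCast_re]; linarith)
    simp only [hE₀] at h1
    rw [← (hN N).2, (hζ N).1.2.2, hab, (hN N).1, (hN N).2, ha1] at h1
    linear_combination -h1
  refine ⟨b, hd, ?_⟩
  have := hΦ.tendsto.add_const b
  rw [zero_add] at this
  refine this.congr' ?_
  filter_upwards [hφΦ] with ζ hζ
  rw [hζ]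
  ring

end IsNearTranslation

end FatouCoordinate

/-! ### Charts of the sectors -/

section Charts

/-- `-1` at the repelling directions, `1` at the attracting ones. -/
def sgn (j : ℤ) : ℝ := if Even j then -1 else 1

lemma sgn_of_even {j : ℤ} (h : Even j) : sgn j = -1 := if_pos h

lemma sgn_of_odd {j : ℤ} (h : Odd j) : sgn j = 1 := if_neg (Int.not_even_iff_odd.2 h)

lemma sgn_neg (j : ℤ) : sgn (-j) = sgn j := by simp [sgn]

lemma sgn_mul_self (j : ℤ) : sgn j * sgn j = 1 := by
  unfold sgn; split_ifs <;> norm_num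

lemma sgn_ne_zero (j : ℤ) : sgn j ≠ 0 := fun h => by simpa [h] using sgn_mul_self j

lemma abs_sgn (j : ℤ) : |sgn j| = 1 := by unfold sgn; split_ifs <;> norm_num

lemma sgn_mul_self_complex (j : ℤ) : (sgn j : ℂ) * sgn j = 1 := by
  exact_mod_cast sgn_mul_self j

lemma norm_sgn_mul (j : ℤ) (z : ℂ) : ‖(sgn j : ℂ) * z‖ = ‖z‖ := by
  rw [norm_mul, Complex.norm_real, Real.norm_eq_abs, abs_sgn, one_mul]

lemma exp_int_mul_pi (j : ℤ) : Complex.exp (j * Real.pi * Complex.I) = -(sgn j : ℂ) := by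
  rcases Int.even_or_odd' j with ⟨m, rfl | rfl⟩
  · rw [sgn_of_even (even_two_mul m)]
    rw [show ((2 * m : ℤ) : ℂ) * Real.pi * Complex.I = m * (2 * Real.pi * Complex.I) by
      push_cast; ring, Complex.exp_int_mul_two_pi_mul_I]
    simp
  · rw [sgn_of_odd (odd_two_mul_add_one m)]
    rw [show ((2 * m + 1 : ℤ) : ℂ) * Real.pi * Complex.I =
      m * (2 * Real.pi * Complex.I) + Real.pi * Complex.I by push_cast; ring, Complex.exp_add,
      Complex.exp_int_mul_two_pi_mul_I, Complex.exp_pi_mul_I]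
    simp

/-- The leading part of the time coordinates. -/
def powCoord (k : ℕ) (z : ℂ) : ℂ := -1 / (k * z ^ k)

/-- The inverse of `sgn j * powCoord k` on the sector around the direction of index `j`. -/
def chart (k : ℕ) (j : ℤ) (ζ : ℂ) : ℂ :=
  Complex.exp ((j * Real.pi * Complex.I - Complex.log k - Complex.log ζ) / k)

variable {k : ℕ} {j : ℤ} {ζ : ℂ}

lemma chart_ne_zero : chart k j ζ ≠ 0 := Complex.exp_ne_zero _

lemma chart_pow (hk : 1 ≤ k) (hζ : ζ ≠ 0) : chart k j ζ ^ k = -(sgn j : ℂ) / (k * ζ) := by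
  have hk0 : (k : ℂ) ≠ 0 := Nat.cast_ne_zero.2 (by omega)
  rw [chart, ← Complex.exp_nat_mul, mul_div_cancel₀ _ hk0, Complex.exp_sub, Complex.exp_sub,
    Complex.exp_log hk0, Complex.exp_log hζ, exp_int_mul_pi, div_div]

lemma powCoord_chart (hk : 1 ≤ k) (hζ : ζ ≠ 0) : powCoord k (chart k j ζ) = sgn j * ζ := by
  have hk0 : (k : ℂ) ≠ 0 := Nat.cast_ne_zero.2 (by omega)
  have hs : (sgn j : ℂ) ≠ 0 := Complex.ofReal_ne_zero.2 (sgn_ne_zero j)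
  rw [powCoord, chart_pow hk hζ]
  field_simp
  rw [sq, sgn_mul_self_complex]

lemma sgn_mul_powCoord_chart (hk : 1 ≤ k) (hζ : ζ ≠ 0) :
    sgn j * powCoord k (chart k j ζ) = ζ := by
  rw [powCoord_chart hk hζ, ← mul_assoc, sgn_mul_self_complex, one_mul]

lemma chart_injOn (hk : 1 ≤ k) : Set.InjOn (chart k j) {0}ᶜ := by
  intro x hx y hy h
  rw [← sgn_mul_powCoord_chart (j := j) hk hx, h, sgn_mul_powCoord_chart hk hy]

lemma norm_chart_pow (hk : 1 ≤ k) (hζ : ζ ≠ 0) : ‖chart k j ζ‖ ^ k = 1 / (k * ‖ζ‖) := by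
  rw [← norm_pow, chart_pow hk hζ, norm_div, norm_mul, norm_neg, Complex.norm_real,
    Real.norm_eq_abs, abs_sgn, RCLike.norm_natCast]

lemma tendsto_chart (hk : 1 ≤ k) (j : ℤ) : Tendsto (chart k j) far (𝓝[≠] 0) := by
  refine tendsto_nhdsWithin_iff.2 ⟨?_, Eventually.of_forall fun ζ => chart_ne_zero⟩
  rw [Metric.tendsto_nhds]
  intro ε hε
  filter_upwards [eventually_far_norm_ge (1 / ε ^ k + 1)] with ζ hζ
  have h0 : 0 < 1 / ε ^ k := by positivity
  have hpos : 0 < ‖ζ‖ := by linarith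
  rw [dist_zero_right]
  refine lt_of_pow_lt_pow_left₀ k hε.le ?_
  rw [norm_chart_pow hk (norm_pos_iff.1 hpos)]
  have hk1 : (1 : ℝ) ≤ k := by exact_mod_cast hk
  calc 1 / (k * ‖ζ‖) ≤ 1 / ‖ζ‖ := by
        gcongr
        nlinarith
    _ < 1 / (1 / ε ^ k) := by gcongr; linarith
    _ = ε ^ k := one_div_one_div _

lemma differentiableAt_chart (h : ζ ∈ Complex.slitPlane) : DifferentiableAt ℂ (chart k j) ζ :=
  (((differentiableAt_id.clog h).const_sub _).div_const _).cexp

/-- In the upper half-plane log(-ζ) = log ζ - iπ, which compensates for lowering the index by one.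
Hence the upper end of chart j and the lower end of chart j - 1 describe the same overlap. -/
lemma chart_sub_one (h : 0 < ζ.im) : chart k (j - 1) (-ζ) = chart k j ζ := by
  have : Complex.log (-ζ) = Complex.log ζ - Real.pi * Complex.I := by
    apply Complex.ext
    · simp [Complex.log_re]
    · simp [Complex.log_im, Complex.arg_neg_eq_arg_sub_pi_of_im_pos h]
  rw [chart, chart, this]
  congr 2
  push_cast
  ring

/-- Complex conjugation reflects the direction of index j to that of index -j; this is why f
exchanges S_{-j} and S_j. -/
lemma conj_chart (h : ζ ∈ Complex.slitPlane) : conj (chart k j ζ) = chart k (-j) (conj ζ) := by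
  rw [chart, chart, ← Complex.exp_conj]
  congr 1
  rw [map_div₀, map_sub, map_sub, map_mul, map_mul, Complex.conj_I, Complex.conj_ofReal,
    ← Complex.log_conj ζ (Complex.mem_slitPlane_iff_arg.1 h).1,
    ← Complex.log_conj (k : ℂ) (by rw [Complex.natCast_arg]; exact Real.pi_pos.ne)]
  simp

lemma chart_add_two_mul (hk : 1 ≤ k) (m : ℤ) : chart k (j + m * (2 * k)) ζ = chart k j ζ := by
  have hk0 : (k : ℂ) ≠ 0 := Nat.cast_ne_zero.2 (by omega)
  rw [chart, chart, Complex.exp_eq_exp_iff_exists_int]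
  refine ⟨m, ?_⟩
  field_simp
  push_cast
  ring

/-- The index of a chart is determined modulo `2k`. -/
lemma exists_eq_add_of_chart_eq (hk : 1 ≤ k) {i : ℤ} (h : chart k i ζ = chart k j ζ) :
    ∃ m : ℤ, i = j + m * (2 * k) := by
  have hk0 : (k : ℂ) ≠ 0 := Nat.cast_ne_zero.2 (by omega)
  rw [chart, chart, Complex.exp_eq_exp_iff_exists_int] at h
  obtain ⟨m, hm⟩ := h
  refine ⟨m, ?_⟩
  have hπ : (Real.pi : ℂ) ≠ 0 := Complex.ofReal_ne_zero.2 Real.pi_ne_zero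
  field_simp at hm
  have h2 : (Real.pi : ℂ) * Complex.I * (i - (j + m * (2 * k))) = 0 := by
    linear_combination hm
  have h3 : (i : ℂ) - (j + m * (2 * k)) = 0 := by
    simpa [hπ, Complex.I_ne_zero] using h2
  have h4 : ((i - (j + m * (2 * k)) : ℤ) : ℂ) = 0 := by push_cast; exact h3
  have := Int.cast_eq_zero.1 h4
  omega

lemma chart_mul_exp (hk : 1 ≤ k) :
    chart k j ζ * Complex.exp (-((j * Real.pi / k : ℝ) : ℂ) * Complex.I) =
      Complex.exp (-(Complex.log k + Complex.log ζ) / k) := by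
  have hk0 : (k : ℂ) ≠ 0 := Nat.cast_ne_zero.2 (by omega)
  rw [chart, ← Complex.exp_add]
  congr 1
  push_cast
  field_simp
  ring

lemma im_log_chart (k : ℕ) (ζ : ℂ) :
    (-(Complex.log k + Complex.log ζ) / k).im = -ζ.arg / k := by
  rw [← Complex.ofReal_natCast k, Complex.div_ofReal_im, Complex.neg_im, Complex.add_im,
    Complex.log_im, Complex.log_im, Complex.ofReal_natCast, Complex.natCast_arg, zero_add]

lemma abs_arg_div_lt (hk : 1 ≤ k) (h : ζ ∈ Complex.slitPlane) :
    |-ζ.arg / k| < Real.pi / k := by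
  have hk0 : (0 : ℝ) < k := by exact_mod_cast hk
  rw [abs_div, abs_neg, abs_of_pos hk0]
  gcongr
  exact lt_of_le_of_ne (Complex.abs_arg_le_pi ζ) fun e => by
    rcases abs_cases ζ.arg with ⟨e', -⟩ | ⟨e', -⟩
    · exact (Complex.mem_slitPlane_iff_arg.1 h).1 (e' ▸ e)
    · linarith [Complex.neg_pi_lt_arg ζ]

lemma log_chart_mul_exp (hk : 1 ≤ k) (h : ζ ∈ Complex.slitPlane) :
    Complex.log (chart k j ζ * Complex.exp (-((j * Real.pi / k : ℝ) : ℂ) * Complex.I)) =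
      -(Complex.log k + Complex.log ζ) / k := by
  have hle : Real.pi / k ≤ Real.pi :=
    div_le_self Real.pi_pos.le (by exact_mod_cast hk)
  have := abs_lt.1 (abs_arg_div_lt hk h)
  rw [chart_mul_exp hk, Complex.log_exp] <;> rw [im_log_chart] <;> linarith

lemma chart_mem_sector (hk : 1 ≤ k) (h : ζ ∈ Complex.slitPlane) :
    chart k j ζ ∈ sector (j * Real.pi / k) (Real.pi / k) := by
  refine ⟨chart_ne_zero, ?_⟩
  rw [← Complex.log_im, log_chart_mul_exp hk h, im_log_chart]
  exact abs_arg_div_lt hk h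

/-- With log(z e^(-ijπ/k)) = -(log k + log ζ)/k, the time coordinate becomes ± the model coordinate
up to a constant. This dictates the value β = sgn(j) b/k used for the charts. -/
lemma timeCoord_chart (hk : 1 ≤ k) (b : ℝ) (h : ζ ∈ Complex.slitPlane) :
    timeCoord k b j (chart k j ζ) =
      sgn j * logCoord (sgn j * b / k) ζ - b * Complex.log k / k := by
  have hk0 : (k : ℂ) ≠ 0 := Nat.cast_ne_zero.2 (by omega)
  have h1 := powCoord_chart (j := j) hk (Complex.slitPlane_ne_zero h)
  rw [powCoord] at h1
  rw [timeCoord, log_chart_mul_exp hk h, h1, logCoord]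
  push_cast
  field_simp
  linear_combination (b * Complex.log ζ) * sgn_mul_self_complex j

/-- Every nonzero point lies in the middle part of some chart. -/
lemma exists_chart_eq (hk : 1 ≤ k) {z : ℂ} (hz : z ≠ 0) :
    ∃ j : ℤ, j ∈ Finset.Icc (-k : ℤ) k ∧ ∃ ζ : ℂ, ζ ≠ 0 ∧ 0 ≤ ζ.re ∧ chart k j ζ = z := by
  have hk0 : (k : ℂ) ≠ 0 := Nat.cast_ne_zero.2 (by omega)
  have hkR : (0 : ℝ) < k := by exact_mod_cast hk
  -- The argument of z in units of π/k. Rounding it selects the nearest direction, which leaves |arg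
  -- ζ| ≤ π/2, that is Re ζ ≥ 0.
  set x : ℝ := k * z.arg / Real.pi with hx
  have hπ := Real.pi_pos
  have hxk : |x| ≤ k := by
    rw [hx, abs_div, abs_mul, abs_of_pos hkR, abs_of_pos hπ, div_le_iff₀ hπ]
    gcongr
    exact Complex.abs_arg_le_pi z
  set j := round x with hj
  have hround := abs_sub_round x
  set w : ℂ := -Complex.log k - k * (Complex.log z - j * Real.pi * Complex.I / k) with hw
  have hwim : w.im = (j - x) * Real.pi := by
    have h1 : w = -Complex.log k - k * Complex.log z + ((j * Real.pi : ℝ) : ℂ) * Complex.I := by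
      rw [hw]; push_cast; field_simp; ring
    rw [h1, Complex.add_im, Complex.sub_im, Complex.neg_im, Complex.log_im, Complex.natCast_arg,
      ← Complex.ofReal_natCast k, Complex.im_ofReal_mul, Complex.log_im, Complex.im_ofReal_mul,
      Complex.I_im, hx]
    field_simp
    ring
  have hwim' : |w.im| ≤ Real.pi / 2 := by
    rw [hwim, abs_mul, abs_of_pos hπ, abs_sub_comm]
    nlinarith
  have hlog : Complex.log (Complex.exp w) = w := by
    have := abs_le.1 hwim'
    rw [Complex.log_exp] <;> linarith
  refine ⟨j, ?_, Complex.exp w, Complex.exp_ne_zero _, ?_, ?_⟩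
  · have h1 : |(j : ℝ)| < k + 1 := by
      have := abs_sub_abs_le_abs_sub (j : ℝ) x
      rw [abs_sub_comm] at this
      linarith
    have h2 := abs_lt.1 h1
    have h3 : (-(k : ℤ) - 1) < j := by
      have : ((-(k : ℤ) - 1 : ℤ) : ℝ) < j := by push_cast; linarith [h2.1]
      exact_mod_cast this
    have h4 : j < (k : ℤ) + 1 := by
      have : (j : ℝ) < ((k : ℤ) + 1 : ℤ) := by push_cast; linarith [h2.2]
      exact_mod_cast this
    rw [Finset.mem_Icc]
    omega
  · rw [Complex.exp_re]
    have := abs_le.1 hwim'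
    exact mul_nonneg (Real.exp_pos _).le (Real.cos_nonneg_of_neg_pi_div_two_le_of_le
      (by linarith) this.2)
  · rw [chart, hlog, hw]
    refine Eq.trans (congrArg Complex.exp ?_) (Complex.exp_log hz)
    field_simp
    ring

lemma rho_ge_of_re_nonneg {ζ : ℂ} (h : 0 ≤ ζ.re) : ‖ζ‖ / 2 ≤ rho ζ := by
  have := Complex.norm_le_abs_re_add_abs_im ζ
  rw [abs_of_nonneg h] at this
  have h1 : ζ.re ≤ rho ζ := le_max_left _ _
  have h2 : |ζ.im| ≤ rho ζ := le_max_right _ _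
  linarith

/-- The middle parts of the charts cover a punctured neighbourhood of the origin. -/
lemma eventually_nhdsNE_of_chart (hk : 1 ≤ k) {p : ℤ → ℂ → Prop}
    (h : ∀ j, ∀ᶠ ζ in far, p j ζ) :
    ∀ᶠ z in 𝓝[≠] (0 : ℂ), ∃ j ζ, ζ ≠ 0 ∧ 0 ≤ ζ.re ∧ chart k j ζ = z ∧ p j ζ := by
  have hkR : (0 : ℝ) < k := by exact_mod_cast hk
  have hall : ∀ᶠ ζ in far, ∀ j ∈ Finset.Icc (-k : ℤ) k, p j ζ :=
    (Finset.eventually_all _).2 fun j _ => h j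
  obtain ⟨M, hM⟩ := eventually_far_iff.1 hall
  have hnorm : ∀ᶠ z in 𝓝[≠] (0 : ℂ), ‖z‖ ^ k * (2 * k * (|M| + 1)) < 1 := by
    have : Tendsto (fun z : ℂ => ‖z‖ ^ k * (2 * k * (|M| + 1))) (𝓝 0) (𝓝 0) := by
      have : ContinuousAt (fun z : ℂ => ‖z‖ ^ k * (2 * k * (|M| + 1))) 0 := by fun_prop
      simpa [ContinuousAt, zero_pow (show k ≠ 0 by omega)] using this
    exact (this.eventually (gt_mem_nhds one_pos)).filter_mono nhdsWithin_le_nhds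
  filter_upwards [hnorm, self_mem_nhdsWithin] with z h1 h2
  obtain ⟨j, hj, ζ, hζ0, hζ, rfl⟩ := exists_chart_eq hk h2
  refine ⟨j, ζ, hζ0, hζ, rfl, hM ζ ?_ j hj⟩
  have hpos : 0 < ‖ζ‖ := norm_pos_iff.2 hζ0
  rw [norm_chart_pow hk hζ0, div_mul_eq_mul_div, one_mul, div_lt_one (by positivity)] at h1
  have h3 := rho_ge_of_re_nonneg hζ
  have h4 : 2 * (|M| + 1) < ‖ζ‖ := by
    by_contra! hc
    have := mul_le_mul_of_nonneg_left hc hkR.le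
    linarith
  linarith [le_abs_self M]

end Charts

/-! ### Germs tangent to the identity in the charts -/

section Lift

variable {k : ℕ} {j : ℤ} {t : ℂ → ℂ} {a : ℂ}

/-- The map `t`, seen in the chart of index `j`. -/
def lift (k : ℕ) (j : ℤ) (t : ℂ → ℂ) (ζ : ℂ) : ℂ := sgn j * powCoord k (t (chart k j ζ))

/-- `t(z) = z + a z^{k+1} + o(z^{k+1})`. -/
def TangentTo (k : ℕ) (a : ℂ) (t : ℂ → ℂ) : Prop :=
  (fun z => t z - z - a * z ^ (k + 1)) =o[𝓝 0] fun z => z ^ (k + 1)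

/-- The relative displacement of `t`. -/
def relDisp (t : ℂ → ℂ) (z : ℂ) : ℂ := (t z - z) / z

lemma eq_mul_one_add_relDisp {z : ℂ} (hz : z ≠ 0) : t z = z * (1 + relDisp t z) := by
  rw [relDisp]; field_simp; ring

lemma TangentTo.tendsto_relDisp_div (h : TangentTo k a t) :
    Tendsto (fun z => relDisp t z / z ^ k) (𝓝[≠] 0) (𝓝 a) := by
  have h1 := (h.mono (nhdsWithin_le_nhds (s := {0}ᶜ))).tendsto_div_nhds_zero.add_const a
  rw [zero_add] at h1
  refine h1.congr' ?_
  filter_upwards [self_mem_nhdsWithin] with z hz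
  have : z ≠ 0 := hz
  rw [relDisp]
  field_simp
  ring

lemma tendsto_pow_nhdsNE (hk : 1 ≤ k) : Tendsto (fun z : ℂ => z ^ k) (𝓝[≠] 0) (𝓝 0) := by
  have : ContinuousAt (fun z : ℂ => z ^ k) 0 := by fun_prop
  have h := this.tendsto
  rw [zero_pow (by omega)] at h
  exact h.mono_left nhdsWithin_le_nhds

lemma TangentTo.tendsto_relDisp (hk : 1 ≤ k) (h : TangentTo k a t) :
    Tendsto (relDisp t) (𝓝[≠] 0) (𝓝 0) := by
  have := h.tendsto_relDisp_div.mul (tendsto_pow_nhdsNE hk)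
  rw [mul_zero] at this
  refine this.congr' ?_
  filter_upwards [self_mem_nhdsWithin] with z hz
  have : z ≠ 0 := hz
  field_simp

/-- The germ at `0` of `u ↦ -((1 + u)^{-k} - 1)/k`. -/
def negPowPart (k : ℕ) (u : ℂ) : ℂ := -(((1 + u) ^ k)⁻¹ - 1) / k

lemma powCoord_sub_powCoord {z : ℂ} (hz : z ≠ 0) (hk : 1 ≤ k) :
    powCoord k (t z) - powCoord k z = negPowPart k (relDisp t z) / z ^ k := by
  have hk0 : (k : ℂ) ≠ 0 := Nat.cast_ne_zero.2 (by omega)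
  rw [eq_mul_one_add_relDisp (t := t) hz, powCoord, powCoord, negPowPart, mul_pow]
  by_cases h : 1 + relDisp t z = 0
  · rw [h, zero_pow (by omega), mul_zero, mul_zero, div_zero, inv_zero]
    field_simp
    ring
  · field_simp
    ring

lemma hasDerivAt_negPowPart (hk : 1 ≤ k) : HasDerivAt (negPowPart k) 1 0 := by
  have hk0 : (k : ℂ) ≠ 0 := Nat.cast_ne_zero.2 (by omega)
  have h1 : HasDerivAt (fun u : ℂ => (1 + u) ^ k) (k * (1 + 0) ^ (k - 1) * 1) 0 :=
    ((hasDerivAt_id (0 : ℂ)).const_add 1).pow k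
  have h2 := (((h1.inv (by simp)).sub_const 1).neg).div_const (k : ℂ)
  refine HasDerivAt.congr_deriv (f := negPowPart k) h2 ?_
  simp [hk0]

lemma TangentTo.tendsto_powCoord_sub (hk : 1 ≤ k) (h : TangentTo k a t) :
    Tendsto (fun z => powCoord k (t z) - powCoord k z) (𝓝[≠] 0) (𝓝 a) := by
  have h1 : Tendsto (fun u => dslope (negPowPart k) 0 u) (𝓝 0) (𝓝 1) := by
    have := (continuousAt_dslope_same.2 (hasDerivAt_negPowPart hk).differentiableAt).tendsto
    rwa [dslope_same, (hasDerivAt_negPowPart hk).deriv] at this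
  have h2 := (h1.comp (h.tendsto_relDisp hk)).mul h.tendsto_relDisp_div
  rw [one_mul] at h2
  refine h2.congr' ?_
  filter_upwards [self_mem_nhdsWithin] with z hz
  rw [powCoord_sub_powCoord hz hk]
  have := sub_smul_dslope (negPowPart k) 0 (relDisp t z)
  rw [sub_zero, smul_eq_mul, show negPowPart k 0 = 0 by simp [negPowPart], sub_zero] at this
  rw [← this]
  simp only [Function.comp]
  ring

lemma lift_sub (hk : 1 ≤ k) {ζ : ℂ} (hζ : ζ ≠ 0) :
    lift k j t ζ - ζ = sgn j * (powCoord k (t (chart k j ζ)) - powCoord k (chart k j ζ)) := by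
  rw [mul_sub, sgn_mul_powCoord_chart hk hζ, lift]

lemma eventually_far_ne_zero : ∀ᶠ ζ in far, ζ ≠ 0 :=
  eventually_far_mem_slitPlane.mono fun _ h => Complex.slitPlane_ne_zero h

lemma TangentTo.tendsto_lift_sub (hk : 1 ≤ k) (h : TangentTo k a t) (j : ℤ) :
    Tendsto (fun ζ => lift k j t ζ - ζ) far (𝓝 (sgn j * a)) := by
  refine (((h.tendsto_powCoord_sub hk).comp (tendsto_chart hk j)).const_mul (sgn j : ℂ)).congr' ?_
  filter_upwards [eventually_far_ne_zero] with ζ hζ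
  rw [lift_sub hk hζ]
  rfl

lemma eventually_log_inv_pow (k : ℕ) :
    ∀ᶠ u : ℂ in 𝓝 0, Complex.log (((1 + u) ^ k)⁻¹) = -k * Complex.log (1 + u) := by
  have : Tendsto (fun u : ℂ => (-k * Complex.log (1 + u)).im) (𝓝 0) (𝓝 0) := by
    have h1 : ContinuousAt (fun u : ℂ => Complex.log (1 + u)) 0 :=
      ContinuousAt.clog (by fun_prop) (by simp)
    have h2 : ContinuousAt (fun u : ℂ => (-k * Complex.log (1 + u)).im) 0 :=
      Complex.continuous_im.continuousAt.comp (continuousAt_const.mul h1)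
    simpa using h2.tendsto
  have hne : ∀ᶠ u : ℂ in 𝓝 0, 1 + u ≠ 0 := by
    have : ContinuousAt (fun u : ℂ => 1 + u) 0 := by fun_prop
    exact this.eventually_ne (by simp)
  filter_upwards [this.eventually (Ioo_mem_nhds (neg_lt_zero.2 Real.pi_pos) Real.pi_pos), hne]
    with u hu hu0
  rw [← Complex.log_exp hu.1 hu.2.le, neg_mul, Complex.exp_neg, Complex.exp_nat_mul,
    Complex.exp_log hu0]

/-- The quotient of the lift by ζ is (1 + u)^(-k), with u the relative displacement. It is close to
1, so no branch is crossed. -/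
lemma TangentTo.eventually_log_lift (hk : 1 ≤ k) (h : TangentTo k a t) (j : ℤ) :
    ∀ᶠ ζ in far, Complex.log (lift k j t ζ) - Complex.log ζ =
      -k * Complex.log (1 + relDisp t (chart k j ζ)) := by
  have hb : ∀ᶠ ζ in far, ‖lift k j t ζ - ζ‖ ≤ ‖a‖ + 1 := by
    have := (h.tendsto_lift_sub hk j).norm
    rw [norm_sgn_mul] at this
    exact (this.eventually (gt_mem_nhds (lt_add_one _))).mono fun _ h => h.le
  have hu := (h.tendsto_relDisp hk).comp (tendsto_chart hk j)
  filter_upwards [hb, eventually_log_sub_log (‖a‖ + 1), eventually_far_norm_ge (4 * (‖a‖ + 1)),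
    eventually_far_ne_zero, hu.eventually (eventually_log_inv_pow k)] with ζ h1 h2 h3 h4 h5
  rw [h2 _ ((Complex.abs_im_le_norm _).trans h1) (by linarith)]
  simp only [Function.comp] at h5
  rw [← h5]
  congr 1
  have hc := chart_ne_zero (k := k) (j := j) (ζ := ζ)
  have e := powCoord_chart (j := j) hk h4
  rw [div_eq_iff h4, lift, eq_mul_one_add_relDisp (t := t) hc]
  have e2 : ∀ w : ℂ, powCoord k (chart k j ζ * w) = powCoord k (chart k j ζ) * (w ^ k)⁻¹ := by
    intro w
    rw [powCoord, powCoord, mul_pow]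
    simp only [div_eq_mul_inv, mul_inv]
    ring
  rw [e2, e]
  linear_combination (ζ * ((1 + relDisp t (chart k j ζ)) ^ k)⁻¹) * sgn_mul_self_complex j

/-- The lift only records t through a k-th power; the logarithm identity selects the right k-th
root, so that no rotation by a root of unity intervenes. -/
lemma TangentTo.eventually_chart_lift (hk : 1 ≤ k) (h : TangentTo k a t) (j : ℤ) :
    ∀ᶠ ζ in far, chart k j (lift k j t ζ) = t (chart k j ζ) := by
  have hk0 : (k : ℂ) ≠ 0 := Nat.cast_ne_zero.2 (by omega)
  have hu := (h.tendsto_relDisp hk).comp (tendsto_chart hk j)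
  have hne : ∀ᶠ u : ℂ in 𝓝 0, 1 + u ≠ 0 := by
    have : ContinuousAt (fun u : ℂ => 1 + u) 0 := by fun_prop
    exact this.eventually_ne (by simp)
  filter_upwards [h.eventually_log_lift hk j, hu.eventually hne] with ζ h1 h2
  have hc := chart_ne_zero (k := k) (j := j) (ζ := ζ)
  rw [eq_mul_one_add_relDisp (t := t) hc]
  simp only [Function.comp] at h2
  refine Eq.trans ?_ (congrArg (chart k j ζ * ·) (Complex.exp_log h2))
  rw [chart, sub_eq_iff_eq_add.1 h1, chart, ← Complex.exp_add]
  congr 1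
  field_simp
  ring

lemma TangentTo.eventually_logCoord_lift_sub (hk : 1 ≤ k) (h : TangentTo k a t) (j : ℤ) (b : ℝ) :
    ∀ᶠ ζ in far, logCoord (sgn j * b / k) (lift k j t ζ) - logCoord (sgn j * b / k) ζ =
      sgn j * (negPowPart k (relDisp t (chart k j ζ)) / chart k j ζ ^ k +
        b * Complex.log (1 + relDisp t (chart k j ζ))) := by
  have hk0 : (k : ℂ) ≠ 0 := Nat.cast_ne_zero.2 (by omega)
  filter_upwards [h.eventually_log_lift hk j, eventually_far_ne_zero] with ζ h1 h2
  have h3 := lift_sub (t := t) (j := j) hk h2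
  rw [powCoord_sub_powCoord chart_ne_zero hk] at h3
  rw [logCoord, logCoord, sub_sub_sub_comm, ← mul_sub, h1, h3]
  push_cast
  field_simp
  ring

lemma TangentTo.tendsto_lift_comap (hk : 1 ≤ k) (h : TangentTo k a t) (j : ℤ) {ℓ : ℂ → ℝ}
    (hℓ : LipschitzWith 1 ℓ) (hle : comap ℓ atTop ≤ far) :
    Tendsto (lift k j t) (comap ℓ atTop) (comap ℓ atTop) := by
  have hb : ∀ᶠ ζ in far, ‖lift k j t ζ - ζ‖ ≤ ‖a‖ + 1 := by
    have := (h.tendsto_lift_sub hk j).norm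
    rw [norm_sgn_mul] at this
    exact (this.eventually (gt_mem_nhds (lt_add_one _))).mono fun _ h => h.le
  exact tendsto_comap_of_norm_sub_le hℓ (hle hb)

lemma differentiableAt_powCoord {z : ℂ} (hk : 1 ≤ k) (hz : z ≠ 0) :
    DifferentiableAt ℂ (powCoord k) z := by
  have hk0 : (k : ℂ) ≠ 0 := Nat.cast_ne_zero.2 (by omega)
  exact (differentiableAt_const _).div ((differentiableAt_id.pow k).const_mul _)
    (mul_ne_zero hk0 (pow_ne_zero _ hz))

lemma TangentTo.eventually_differentiableAt_lift (hk : 1 ≤ k) (h : TangentTo k a t)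
    (ht : AnalyticAt ℂ t 0) (j : ℤ) : ∀ᶠ ζ in far, DifferentiableAt ℂ (lift k j t) ζ := by
  have h1 : ∀ᶠ z in 𝓝[≠] (0 : ℂ), DifferentiableAt ℂ t z :=
    (Complex.analyticAt_iff_eventually_differentiableAt.1 ht).filter_mono nhdsWithin_le_nhds
  filter_upwards [eventually_far_mem_slitPlane, (tendsto_chart hk j).eventually h1,
    h.eventually_chart_lift hk j] with ζ h2 h3 h4
  have h5 : t (chart k j ζ) ≠ 0 := h4 ▸ chart_ne_zero
  exact ((differentiableAt_powCoord hk h5).comp ζ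
    (h3.comp ζ (differentiableAt_chart h2))).const_mul _

end Lift

/-! ### Second order expansion of a prenormalized germ -/

section Prenormal

lemma isBigO_pow_pow_of_le {p q : ℕ} (h : q ≤ p) :
    (fun z : ℂ => z ^ p) =O[𝓝[≠] 0] fun z => z ^ q := by
  rcases h.eq_or_lt with rfl | h
  · exact isBigO_refl _ _
  · exact (isLittleO_pow_pow h).isBigO.mono nhdsWithin_le_nhds

/-- The order of vanishing is an integer, so being o(z^m) means order at least m + 1. This whole
extra order is what makes the later error terms summable. -/
lemma AnalyticAt.isBigO_pow_succ {h : ℂ → ℂ} {m : ℕ} (ha : AnalyticAt ℂ h 0)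
    (ho : h =o[𝓝 0] fun z => z ^ m) : h =O[𝓝 0] fun z => z ^ (m + 1) := by
  have key : ((m + 1 : ℕ) : ℕ∞) ≤ analyticOrderAt h 0 := by
    by_contra! hlt
    obtain ⟨l, hl⟩ := ENat.ne_top_iff_exists.1 (ne_top_of_lt hlt)
    rw [← hl, Nat.cast_lt] at hlt
    obtain ⟨g, hg, hg0, hgz⟩ := ha.analyticOrderAt_eq_natCast.1 hl.symm
    apply hg0
    have h1 : Tendsto g (𝓝[≠] 0) (𝓝 0) := by
      have hpow : (fun z : ℂ => z ^ m) =O[𝓝[≠] 0] fun z => z ^ l :=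
        isBigO_pow_pow_of_le (by omega)
      have := ((ho.mono (nhdsWithin_le_nhds (s := {0}ᶜ))).trans_isBigO hpow).tendsto_div_nhds_zero
      refine this.congr' ?_
      filter_upwards [hgz.filter_mono nhdsWithin_le_nhds, self_mem_nhdsWithin] with z hz hz0
      have : z ≠ 0 := hz0
      rw [hz, sub_zero, smul_eq_mul]
      field_simp
    exact tendsto_nhds_unique (hg.continuousAt.tendsto.mono_left nhdsWithin_le_nhds) h1
  obtain ⟨g, hg, hgz⟩ := (natCast_le_analyticOrderAt ha).1 key
  have h1 : (fun z : ℂ => z ^ (m + 1) * g z) =O[𝓝 0] fun z => z ^ (m + 1) * 1 :=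
    (isBigO_refl _ _).mul (hg.continuousAt.tendsto.isBigO_one ℂ)
  refine IsBigO.congr' h1 ?_ (by simp)
  filter_upwards [hgz] with z hz
  rw [hz, sub_zero, smul_eq_mul]

lemma exists_inv_one_add_pow_eq (k : ℕ) : ∃ R : ℂ → ℂ, ContinuousAt R 0 ∧ ∀ u : ℂ, 1 + u ≠ 0 →
    ((1 + u) ^ k)⁻¹ = 1 - k * u + k * (k + 1) / 2 * u ^ 2 + u ^ 3 * R u := by
  induction k with
  | zero => exact ⟨fun _ => 0, continuousAt_const, fun u _ => by simp⟩
  | succ k ih =>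
    obtain ⟨R, hR, h⟩ := ih
    refine ⟨fun u => (R u - (k + 1) * (k + 2) / 2) / (1 + u), ?_, fun u hu => ?_⟩
    · exact (hR.sub continuousAt_const).div (by fun_prop) (by simp)
    · rw [pow_succ, mul_inv, h u hu]
      push_cast
      field_simp
      ring

lemma isBigO_log_one_add_sub : (fun u : ℂ => Complex.log (1 + u) - u) =O[𝓝 0] fun u => u ^ 2 := by
  refine IsBigO.of_bound 1 ?_
  filter_upwards [Metric.closedBall_mem_nhds (0 : ℂ) (show (0 : ℝ) < 1 / 2 by norm_num)] with u hu
  rw [mem_closedBall_zero_iff] at hu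
  refine (Complex.norm_log_one_add_sub_self_le (by linarith)).trans ?_
  rw [norm_pow, one_mul]
  have h1 : (1 - ‖u‖)⁻¹ ≤ 2 := by
    rw [inv_le_comm₀ (by linarith) two_pos]
    linarith
  nlinarith [sq_nonneg ‖u‖]

/-- The coefficient of degree `2k + 1` in the prenormal form kills the first order correction of
the time coordinate. -/
lemma isBigO_time_error {k : ℕ} (hk : 1 ≤ k) (b : ℝ) {F : ℂ → ℂ}
    (hF : (fun z : ℂ => F z - (z + 1 / 2 * z ^ (k + 1) +
      (((k : ℂ) + 1) / 8 - (b : ℂ) / 2) * z ^ (2 * k + 1))) =O[𝓝 0] fun z => z ^ (2 * k + 2)) :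
    (fun z => negPowPart k (relDisp F z) / z ^ k + b * Complex.log (1 + relDisp F z) - 1 / 2)
      =O[𝓝[≠] 0] fun z => z ^ (k + 1) := by
  have hk0 : (k : ℂ) ≠ 0 := Nat.cast_ne_zero.2 (by omega)
  set c : ℂ := ((k : ℂ) + 1) / 8 - (b : ℂ) / 2 with hc
  set u := relDisp F with hu
  have hpow : ∀ {p q : ℕ}, q ≤ p → (fun z : ℂ => z ^ p) =O[𝓝[≠] 0] fun z => z ^ q :=
    isBigO_pow_pow_of_le
  have hD : (fun z => u z - (z ^ k / 2 + c * z ^ (2 * k))) =O[𝓝[≠] 0] fun z => z ^ (2 * k + 1) := by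
    have h1 : (fun z : ℂ => z⁻¹) =O[𝓝[≠] 0] fun z => z⁻¹ := isBigO_refl _ _
    refine (h1.mul (hF.mono nhdsWithin_le_nhds)).congr' ?_ ?_
    · filter_upwards [self_mem_nhdsWithin] with z hz
      have : z ≠ 0 := hz
      rw [hu, relDisp]
      field_simp
      ring
    · filter_upwards [self_mem_nhdsWithin] with z hz
      have : z ≠ 0 := hz
      field_simp
      ring
  have hA : (fun z => u z - z ^ k / 2) =O[𝓝[≠] 0] fun z => z ^ (2 * k) := by
    have := (hD.trans (hpow (by omega : 2 * k ≤ 2 * k + 1))).add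
      ((isBigO_refl (fun z : ℂ => z ^ (2 * k)) (𝓝[≠] 0)).const_mul_left c)
    refine this.congr_left fun z => ?_
    ring
  have hw : (fun z : ℂ => z ^ k / 2) =O[𝓝[≠] 0] fun z => z ^ k := by
    simp_rw [div_eq_inv_mul]
    exact (isBigO_refl _ _).const_mul_left _
  have hub : u =O[𝓝[≠] 0] fun z => z ^ k := by
    have := (hA.trans (hpow (by omega : k ≤ 2 * k))).add hw
    refine this.congr_left fun z => ?_
    ring
  have hB : (fun z => u z + z ^ k / 2) =O[𝓝[≠] 0] fun z => z ^ k := hub.add hw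
  have hu0 : Tendsto u (𝓝[≠] 0) (𝓝 0) := hub.trans_tendsto (tendsto_pow_nhdsNE hk)
  have h3k : (fun z : ℂ => z ^ (3 * k)) =O[𝓝[≠] 0] fun z => z ^ (2 * k + 1) := hpow (by omega)
  obtain ⟨R, hR, hRu⟩ := exists_inv_one_add_pow_eq k
  have t1 : (fun z => (u z - z ^ k / 2) * (u z + z ^ k / 2)) =O[𝓝[≠] 0]
      fun z => z ^ (2 * k + 1) :=
    ((hA.mul hB).congr_right fun z => by rw [← pow_add]; congr 1; omega).trans h3k
  have t2 : (fun z => u z ^ 3 * R (u z)) =O[𝓝[≠] 0] fun z => z ^ (2 * k + 1) := by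
    have h1 := (hub.pow 3).mul ((hR.tendsto.comp hu0).isBigO_one ℂ)
    exact (h1.congr_right fun z => by rw [mul_one, ← pow_mul]; congr 1; omega).trans h3k
  have t3 : (fun z => z ^ k * (Complex.log (1 + u z) - u z)) =O[𝓝[≠] 0]
      fun z => z ^ (2 * k + 1) := by
    have h1 := (isBigO_refl (fun z : ℂ => z ^ k) (𝓝[≠] 0)).mul
      ((isBigO_log_one_add_sub.comp_tendsto hu0).trans (hub.pow 2))
    exact (h1.congr_right fun z => by rw [← pow_mul, ← pow_add]; congr 1; omega).trans h3k
  have t4 : (fun z => z ^ k * (u z - z ^ k / 2)) =O[𝓝[≠] 0] fun z => z ^ (2 * k + 1) :=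
    (((isBigO_refl (fun z : ℂ => z ^ k) (𝓝[≠] 0)).mul hA).congr_right fun z => by
      rw [← pow_add]; congr 1; omega).trans h3k
  -- Multiplied by z^k, the error is the sum of these five terms. The z^(2k) contributions cancel
  -- because c - (k + 1)/8 + b/2 = 0.
  have hsum := (((hD.sub (t1.const_mul_left (((k : ℂ) + 1) / 2))).sub
    (t2.const_mul_left ((k : ℂ)⁻¹))).add (t3.const_mul_left (b : ℂ))).add
    (t4.const_mul_left (b : ℂ))
  have hinv : (fun z : ℂ => (z ^ k)⁻¹) =O[𝓝[≠] 0] fun z => (z ^ k)⁻¹ := isBigO_refl _ _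
  have hne : ∀ᶠ z in 𝓝[≠] (0 : ℂ), 1 + u z ≠ 0 := by
    have : ContinuousAt (fun u : ℂ => 1 + u) 0 := by fun_prop
    exact hu0.eventually (this.eventually_ne (by simp))
  refine (hinv.mul hsum).congr' ?_ ?_
  · filter_upwards [self_mem_nhdsWithin, hne] with z hz h1
    have : z ≠ 0 := hz
    rw [negPowPart, hRu _ h1, hc]
    have e : z ^ (2 * k) = z ^ k * z ^ k := by rw [two_mul, pow_add]
    rw [e]
    field_simp
    ring
  · filter_upwards [self_mem_nhdsWithin] with z hz
    have : z ≠ 0 := hz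
    field_simp
    rw [← pow_add]
    congr 1
    omega

lemma IsPrenormalized.isBigO {f : ℂ → ℂ} {k : ℕ} {b : ℝ} (h : IsPrenormalized f k b) :
    (fun z : ℂ => f (conj z) - (z + 1 / 2 * z ^ (k + 1) +
      (((k : ℂ) + 1) / 8 - (b : ℂ) / 2) * z ^ (2 * k + 1))) =O[𝓝 0] fun z => z ^ (2 * k + 2) := by
  refine AnalyticAt.isBigO_pow_succ (h.1.2.sub (by fun_prop)) ?_
  have hconj : Tendsto (conj : ℂ → ℂ) (𝓝 0) (𝓝 0) := by
    simpa using Complex.continuous_conj.tendsto 0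
  have := h.2.comp_tendsto hconj
  refine IsLittleO.congr_left (IsLittleO.of_norm_right (this.norm_right.congr_right fun z => ?_))
    fun z => ?_
  · simp
  · simp

lemma IsPrenormalized.tangentTo {f : ℂ → ℂ} {k : ℕ} {b : ℝ} (hk : 1 ≤ k)
    (h : IsPrenormalized f k b) : TangentTo k (1 / 2) fun z => f (conj z) := by
  have hpow : ∀ m, k + 1 < m → (fun z : ℂ => z ^ m) =o[𝓝 0] fun z => z ^ (k + 1) := fun m hm =>
    isLittleO_pow_pow hm
  have := (h.isBigO.trans_isLittleO (hpow _ (by omega))).add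
    ((hpow (2 * k + 1) (by omega)).const_mul_left (((k : ℂ) + 1) / 8 - (b : ℂ) / 2))
  refine this.congr_left fun z => ?_
  ring

/-- Since |z| = (k|ζ|)^(-1/k) in the chart, an error O(z^(k+1)) becomes O(|ζ|^(-(1+1/k))), with an
exponent below -1. -/
lemma IsPrenormalized.logCoord_lift {f : ℂ → ℂ} {k : ℕ} {b : ℝ} (hk : 1 ≤ k)
    (h : IsPrenormalized f k b) (j : ℤ) : ∃ C : ℝ, ∀ᶠ ζ in far,
      ‖logCoord (sgn j * b / k) (lift k j (fun z => f (conj z)) ζ) -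
        logCoord (sgn j * b / k) ζ - sgn j / 2‖ ≤ C * ‖ζ‖ ^ (-(1 + 1 / (k : ℝ))) := by
  obtain ⟨C, hC⟩ := ((isBigO_time_error hk b h.isBigO).comp_tendsto (tendsto_chart hk j)).bound
  refine ⟨C * (k : ℝ) ^ (-(1 + 1 / (k : ℝ))), ?_⟩
  filter_upwards [hC, (h.tangentTo hk).eventually_logCoord_lift_sub hk j b, eventually_far_ne_zero]
    with ζ h1 h2 h3
  rw [h2]
  simp only [Function.comp] at h1
  rw [div_eq_mul_one_div (sgn j : ℂ), ← mul_sub, norm_sgn_mul]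
  refine h1.trans (le_of_eq ?_)
  have hkR : (0 : ℝ) < k := by exact_mod_cast hk
  rw [mul_assoc, ← Real.mul_rpow hkR.le (norm_nonneg _), norm_pow]
  congr 1
  have h4 : ‖chart k j ζ‖ = (k * ‖ζ‖) ^ (-(1 / (k : ℝ))) := by
    rw [Real.rpow_neg (by positivity), ← Real.inv_rpow (by positivity), ← one_div,
      ← norm_chart_pow (j := j) hk h3, ← Real.rpow_natCast, ← Real.rpow_mul (norm_nonneg _),
      mul_one_div_cancel hkR.ne', Real.rpow_one]
  rw [h4, ← Real.rpow_natCast, ← Real.rpow_mul (by positivity)]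
  congr 1
  push_cast
  field_simp

end Prenormal

/-! ### The dynamics of a prenormalized germ on its petals -/

section Dynamics

/-- Points deep in the sector of index `j`. -/
def petalFilter (k : ℕ) (j : ℤ) : Filter ℂ := map (chart k j) far

/-- The antiholomorphic map `f`, seen in the charts of index `-j` and `j`. -/
def antiLift (k : ℕ) (j : ℤ) (f : ℂ → ℂ) (ζ : ℂ) : ℂ := lift k j (fun z => f (conj z)) (conj ζ)

lemma logCoord_conj (β : ℝ) {ζ : ℂ} (h : ζ ∈ Complex.slitPlane) :
    logCoord β (conj ζ) = conj (logCoord β ζ) := by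
  rw [logCoord, logCoord, Complex.log_conj ζ (Complex.mem_slitPlane_iff_arg.1 h).1]
  simp

namespace IsPrenormalized

variable {f : ℂ → ℂ} {k : ℕ} {b : ℝ}

lemma eventually_apply_chart (hk : 1 ≤ k) (h : IsPrenormalized f k b) (j : ℤ) :
    ∀ᶠ ζ in far, f (chart k (-j) ζ) = chart k j (antiLift k j f ζ) := by
  filter_upwards [tendsto_conj_far.eventually ((h.tangentTo hk).eventually_chart_lift hk j),
    eventually_far_mem_slitPlane] with ζ h1 h2
  rw [antiLift, h1]
  have := conj_chart (k := k) (j := -j) h2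
  rw [neg_neg] at this
  rw [← this, Complex.conj_conj]

lemma tendsto_antiLift_sub (hk : 1 ≤ k) (h : IsPrenormalized f k b) (j : ℤ) :
    Tendsto (fun ζ => antiLift k j f ζ - conj ζ) far (𝓝 (sgn j / 2)) := by
  have := ((h.tangentTo hk).tendsto_lift_sub hk j).comp tendsto_conj_far
  rw [mul_one_div] at this
  exact this

lemma tendsto_antiLift_far (hk : 1 ≤ k) (h : IsPrenormalized f k b) (j : ℤ) :
    Tendsto (antiLift k j f) far far :=
  ((h.tangentTo hk).tendsto_lift_comap hk j lipschitzWith_rho le_rfl).comp tendsto_conj_far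

lemma tendsto_antiLift_up (hk : 1 ≤ k) (h : IsPrenormalized f k b) (j : ℤ) :
    Tendsto (antiLift k j f) (comap Complex.im atTop) (comap Complex.im atBot) := by
  refine Tendsto.comp ?_ tendsto_conj_up
  have h1 := down_le_far
  rw [comap_im_atBot] at *
  exact (h.tangentTo hk).tendsto_lift_comap hk j lipschitzWith_neg_im h1

lemma tendsto_petalFilter (hk : 1 ≤ k) (h : IsPrenormalized f k b) (j : ℤ) :
    Tendsto f (petalFilter k (-j)) (petalFilter k j) := by
  rw [petalFilter, petalFilter, tendsto_map'_iff]
  exact (tendsto_map.comp (h.tendsto_antiLift_far hk j)).congr'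
    ((h.eventually_apply_chart hk j).mono fun ζ hζ => hζ.symm)

lemma eventually_apply_apply_chart (hk : 1 ≤ k) (h : IsPrenormalized f k b) (j : ℤ) :
    ∀ᶠ ζ in far, f (f (chart k j ζ)) = chart k j (antiLift k j f (antiLift k (-j) f ζ)) := by
  have h1 := h.eventually_apply_chart hk (-j)
  rw [neg_neg] at h1
  filter_upwards [h1, (h.tendsto_antiLift_far hk (-j)).eventually (h.eventually_apply_chart hk j)]
    with ζ h2 h3
  rw [h2, h3]

/-- Composing two antiholomorphic lifts gives a holomorphic map with displacement s/2 + conj(s/2) =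
s, where s = sgn(j). The formulation with β = 0 makes `exists_inverse` available for it. -/
lemma exists_isAsympLog_zero (hk : 1 ≤ k) (h : IsPrenormalized f k b) (j : ℤ) :
    IsAsympLog 0 (fun ζ => antiLift k j f (antiLift k (-j) f ζ)) (sgn j) := by
  constructor
  · have hd := fun i => (h.tangentTo hk).eventually_differentiableAt_lift hk h.1.2 i
    filter_upwards [tendsto_conj_far.eventually (hd (-j)),
      (tendsto_conj_far.comp (h.tendsto_antiLift_far hk (-j))).eventually (hd j)] with ζ h1 h2
    have h3 := DifferentiableAt.conj_conj h1
    rw [Complex.conj_conj] at h3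
    exact DifferentiableAt.comp (g := lift k j fun z => f (conj z))
      (f := fun ζ => conj (antiLift k (-j) f ζ)) ζ h2 h3
  · have h1 := (h.tendsto_antiLift_sub hk j).comp (h.tendsto_antiLift_far hk (-j))
    have h2 := (Complex.continuous_conj.tendsto _).comp (h.tendsto_antiLift_sub hk (-j))
    have h3 := h1.add h2
    have e : (sgn j / 2 + conj (sgn (-j) / 2 : ℂ)) = sgn j := by
      rw [sgn_neg, map_div₀, Complex.conj_ofReal, map_ofNat]
      ring
    rw [e] at h3
    refine h3.congr fun ζ => ?_
    simp [logCoord, map_sub]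

/-- Two half-steps of f, each controlled by `logCoord_lift`, are added. Conjugation passes through
the model coordinate because β is real and the points avoid the slit. -/
lemma exists_logCoord_bound (hk : 1 ≤ k) (h : IsPrenormalized f k b) (j : ℤ) :
    ∃ C : ℝ, 0 ≤ C ∧ ∀ᶠ ζ in far,
      ‖logCoord (sgn j * b / k) (antiLift k j f (antiLift k (-j) f ζ)) -
        logCoord (sgn j * b / k) ζ - sgn j‖ ≤ C * ‖ζ‖ ^ (-(1 + 1 / (k : ℝ))) := by
  obtain ⟨C, hC⟩ := h.logCoord_lift hk j
  obtain ⟨C', hC'⟩ := h.logCoord_lift hk (-j)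
  set p : ℝ := -(1 + 1 / (k : ℝ)) with hp
  have hp0 : p ≤ 0 := by rw [hp]; linarith [show (0 : ℝ) ≤ 1 / k by positivity]
  have hsub := (h.tendsto_antiLift_sub hk (-j)).norm
  refine ⟨|C| * (1 / 2) ^ p + |C'|, by positivity, ?_⟩
  filter_upwards [(tendsto_conj_far.comp (h.tendsto_antiLift_far hk (-j))).eventually hC,
    tendsto_conj_far.eventually hC',
    (h.tendsto_antiLift_far hk (-j)).eventually eventually_far_mem_slitPlane,
    eventually_far_mem_slitPlane, hsub.eventually (gt_mem_nhds (lt_add_one _)),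
    eventually_far_norm_ge (2 * (‖(sgn (-j) : ℂ) / 2‖ + 1))] with ζ h1 h2 h3 h4 h5 h6
  set ξ := antiLift k (-j) f ζ with hξ
  have e1 : ‖logCoord (sgn j * b / k) (antiLift k j f ξ) -
      conj (logCoord (sgn j * b / k) ξ) - sgn j / 2‖ ≤ |C| * (1 / 2) ^ p * ‖ζ‖ ^ p := by
    simp only [Function.comp] at h1
    rw [logCoord_conj _ h3, ← hξ] at h1
    refine h1.trans ?_
    rw [mul_assoc, ← Real.mul_rpow (by norm_num) (norm_nonneg _), RCLike.norm_conj]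
    have hζξ : 1 / 2 * ‖ζ‖ ≤ ‖ξ‖ := by
      have := norm_sub_norm_le (conj ζ) ξ
      rw [norm_sub_rev, RCLike.norm_conj] at this
      linarith
    have hpos : 0 < ‖ζ‖ := norm_pos_iff.2 (Complex.slitPlane_ne_zero h4)
    have hrp := Real.rpow_le_rpow_of_nonpos (by positivity) hζξ hp0
    exact (mul_le_mul_of_nonneg_right (le_abs_self C) (by positivity)).trans
      (mul_le_mul_of_nonneg_left hrp (abs_nonneg C))
  have e2 : ‖conj (logCoord (sgn j * b / k) ξ) - logCoord (sgn j * b / k) ζ - sgn j / 2‖ ≤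
      |C'| * ‖ζ‖ ^ p := by
    rw [sgn_neg, logCoord_conj _ h4, RCLike.norm_conj] at h2
    rw [← RCLike.norm_conj]
    simp only [map_sub, Complex.conj_conj, map_div₀, Complex.conj_ofReal, map_ofNat]
    exact h2.trans (mul_le_mul_of_nonneg_right (le_abs_self C') (by positivity))
  rw [add_mul]
  refine le_trans (le_of_eq ?_) ((norm_add_le _ _).trans (add_le_add e1 e2))
  congr 1
  ring

/-- On a petal, `f ∘ f` or its inverse is close to the unit translation. -/
theorem exists_isNearTranslation (hk : 1 ≤ k) (h : IsPrenormalized f k b) (j : ℤ) :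
    ∃ Γ, IsNearTranslation (sgn j * b / k) (1 / k) Γ ∧
      (Odd j → ∀ᶠ ζ in far, f (f (chart k j ζ)) = chart k j (Γ ζ)) ∧
      (Even j → ∀ᶠ ζ in far, f (f (chart k j (Γ ζ))) = chart k j ζ) := by
  have hkR : (0 : ℝ) < k := by exact_mod_cast hk
  have hG := h.exists_isAsympLog_zero hk j
  obtain ⟨C, hC0, hC⟩ := h.exists_logCoord_bound hk j
  have hGt := hG.tendsto
  simp only [logCoord, Complex.ofReal_zero, zero_mul, sub_zero] at hGt
  rcases Int.even_or_odd j with hj | hj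
  -- At a repelling direction f ∘ f moves by about -1 in the chart, so its inverse near infinity is
  -- the near-translation.
  · obtain ⟨Θ, hΘ⟩ := hG.exists_inverse
    rw [sgn_of_even hj] at hGt
    have hsub : Tendsto (fun ζ => Θ ζ - ζ) far (𝓝 1) := by
      have := (hGt.comp hΘ.far).neg
      rw [Complex.ofReal_neg, Complex.ofReal_one, neg_neg] at this
      refine this.congr' (hΘ.right.mono fun ζ hζ => ?_)
      simp only [Function.comp, hζ]
      ring
    refine ⟨Θ, ⟨by positivity, hΘ.differentiable, hsub, C * (1 / 2) ^ (-(1 + 1 / (k : ℝ))), ?_⟩,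
      fun ho => absurd hj (Int.not_even_iff_odd.2 ho), fun _ => ?_⟩
    · filter_upwards [hΘ.far.eventually hC, hΘ.right,
        hsub.norm.eventually (gt_mem_nhds (lt_add_one _)), eventually_far_norm_ge 4]
        with ζ h1 h2 h3 h4
      have hpos : 0 < ‖ζ‖ := by linarith
      rw [mul_assoc, ← Real.mul_rpow (by norm_num) (norm_nonneg _)]
      rw [h2, ← norm_neg] at h1
      have e : -(logCoord (sgn j * b / k) ζ - logCoord (sgn j * b / k) (Θ ζ) - sgn j) =
          logCoord (sgn j * b / k) (Θ ζ) - logCoord (sgn j * b / k) ζ - 1 := by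
        rw [sgn_of_even hj]; push_cast; ring
      rw [e] at h1
      refine h1.trans (mul_le_mul_of_nonneg_left ?_ hC0)
      refine Real.rpow_le_rpow_of_nonpos (by positivity) ?_
        (by linarith [show (0 : ℝ) ≤ 1 / k by positivity])
      have := norm_sub_norm_le ζ (Θ ζ)
      rw [norm_sub_rev] at this
      rw [norm_one] at h3
      linarith
    · filter_upwards [hΘ.far.eventually (h.eventually_apply_apply_chart hk j), hΘ.right]
        with ζ h1 h2
      rw [h1, h2]
  · rw [sgn_of_odd hj, Complex.ofReal_one] at hGt
    refine ⟨_, ⟨by positivity, hG.differentiable, hGt, C, ?_⟩,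
      fun _ => h.eventually_apply_apply_chart hk j,
      fun he => absurd he (Int.not_even_iff_odd.2 hj)⟩
    filter_upwards [hC] with ζ hζ
    refine le_trans (le_of_eq ?_) hζ
    rw [sgn_of_odd hj, Complex.ofReal_one]

/-- Petals of any size contain all points that are deep enough in the sector. -/
theorem petal_mem (hk : 1 ≤ k) (h : IsPrenormalized f k b) {r : ℝ} (hr : 0 < r) (R : ℝ) (j : ℤ) :
    ∀ᶠ ζ in far, ζ ∈ Complex.slitPlane ∧ chart k j ζ ∈ petal f k b r R j := by
  obtain ⟨Γ, hΓ, hodd, heven⟩ := h.exists_isNearTranslation hk j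
  have hdom : ∀ᶠ ζ in far, ζ ∈ Complex.slitPlane ∧ chart k j ζ ∈ chartDomain k r j := by
    have hball : ∀ᶠ z in 𝓝[≠] (0 : ℂ), z ∈ Metric.ball 0 r :=
      mem_nhdsWithin_of_mem_nhds (Metric.ball_mem_nhds 0 hr)
    filter_upwards [eventually_far_mem_slitPlane, (tendsto_chart hk j).eventually hball]
      with ζ h1 h2
    exact ⟨h1, chart_mem_sector hk h1, h2⟩
  have hN : ∀ ζ : ℂ, ∃ N : ℕ, R + |(b * Complex.log k / k : ℂ).re| + 1 <
      (logCoord (sgn j * b / k) ζ).re + N := by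
    intro ζ
    obtain ⟨N, hN⟩ := exists_nat_gt (R + |(b * Complex.log k / k : ℂ).re| + 1 -
      (logCoord (sgn j * b / k) ζ).re)
    exact ⟨N, by linarith⟩
  have hre : ∀ (ζ : ℂ) (N : ℕ), Γ^[N] ζ ∈ Complex.slitPlane →
      ‖logCoord (sgn j * b / k) (Γ^[N] ζ) - logCoord (sgn j * b / k) ζ - N‖ ≤ 1 →
      R + |(b * Complex.log k / k : ℂ).re| + 1 < (logCoord (sgn j * b / k) ζ).re + N →
      R < sgn j * (timeCoord k b j (chart k j (Γ^[N] ζ))).re := by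
    intro ζ N h1 h2 h3
    have h4 := (abs_le.1 ((Complex.abs_re_le_norm _).trans h2)).1
    rw [Complex.sub_re, Complex.sub_re, Complex.natCast_re] at h4
    rw [timeCoord_chart hk b h1, Complex.sub_re, Complex.re_ofReal_mul, mul_sub, ← mul_assoc,
      sgn_mul_self, one_mul]
    have h5 : sgn j * (b * Complex.log k / k : ℂ).re ≤ |(b * Complex.log k / k : ℂ).re| := by
      refine (le_abs_self _).trans ?_
      rw [abs_mul, abs_sgn, one_mul]
    linarith
  rcases Int.even_or_odd j with hj | hj
  · filter_upwards [hΓ.eventually_orbit one_pos (hdom.and (heven hj))] with ζ hζ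
    refine ⟨(hζ 0).1.1.1, Or.inl ⟨hj, ?_⟩⟩
    obtain ⟨N, hN⟩ := hN ζ
    -- On a repelling petal f ∘ f undoes Γ, so the far point Γ^N ζ is the starting point in the
    -- half-plane from which N iterates lead back to ζ.
    have hback : ∀ i m, (f ∘ f)^[i] (chart k j (Γ^[m + i] ζ)) = chart k j (Γ^[m] ζ) := by
      intro i
      induction i with
      | zero => intro m; rfl
      | succ i ih =>
        intro m
        rw [Function.iterate_succ_apply', show m + (i + 1) = (m + 1) + i by ring, ih,
          Function.iterate_succ_apply']
        exact (hζ m).1.2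
    refine ⟨chart k j (Γ^[N] ζ), ⟨(hζ N).1.1.2, Or.inl ⟨hj, ?_⟩⟩, N, fun i hi => ?_, ?_⟩
    · have := hre ζ N (hζ N).1.1.1 (hζ N).2 hN
      rw [sgn_of_even hj] at this
      linarith
    · obtain ⟨m, rfl⟩ := Nat.exists_eq_add_of_le' hi
      rw [hback]
      exact (hζ m).1.1.2
    · have := hback N 0
      rwa [zero_add] at this
  · filter_upwards [hΓ.eventually_orbit one_pos (hdom.and (hodd hj))] with ζ hζ
    refine ⟨(hζ 0).1.1.1, Or.inr ⟨hj, ?_⟩⟩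
    obtain ⟨N, hN⟩ := hN ζ
    have hforw : ∀ i, (f ∘ f)^[i] (chart k j ζ) = chart k j (Γ^[i] ζ) := by
      intro i
      induction i with
      | zero => rfl
      | succ i ih =>
        rw [Function.iterate_succ_apply', ih, Function.iterate_succ_apply']
        exact (hζ i).1.2
    refine ⟨N, fun i _ => ?_, ?_⟩
    · rw [hforw]
      exact (hζ i).1.1.2
    · rw [hforw]
      refine ⟨(hζ N).1.1.2, Or.inr ⟨hj, ?_⟩⟩
      have := hre ζ N (hζ N).1.1.1 (hζ N).2 hN
      rwa [sgn_of_odd hj, one_mul] at this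

end IsPrenormalized

end Dynamics

/-! ### The given Fatou coordinates, seen in the charts -/

section FatouSystem

/-- A Fatou coordinate in the chart of its petal, with the orientation for which `f ∘ f` or its
inverse is close to the unit translation. -/
def fatouLift (k : ℕ) (φ : ℤ → ℂ → ℂ) (j : ℤ) (ζ : ℂ) : ℂ := sgn j * φ j (chart k j ζ)

lemma eq_sgn_mul_fatouLift (k : ℕ) (φ : ℤ → ℂ → ℂ) (j : ℤ) (ζ : ℂ) :
    φ j (chart k j ζ) = sgn j * fatouLift k φ j ζ := by
  rw [fatouLift, ← mul_assoc, sgn_mul_self_complex, one_mul]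

lemma eventually_petalFilter {k : ℕ} {j : ℤ} {p : ℂ → Prop} :
    (∀ᶠ z in petalFilter k j, p z) ↔ ∀ᶠ ζ in far, p (chart k j ζ) := eventually_map

namespace IsFatouSystem

variable {f : ℂ → ℂ} {k : ℕ} {b r R : ℝ} {φ : ℤ → ℂ → ℂ}

lemma eventually_conj (hφ : IsFatouSystem f k b r R φ) (hr : 0 < r) (hk : 1 ≤ k)
    (h : IsPrenormalized f k b) (j : ℤ) :
    ∀ᶠ z in petalFilter k (-j), φ j (f z) = conj (φ (-j) z) + 1 / 2 := by
  have h1 : ∀ i, ∀ᶠ z in petalFilter k i, z ∈ petal f k b r R i := fun i =>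
    eventually_petalFilter.2 ((h.petal_mem hk hr R i).mono fun _ h => h.2)
  filter_upwards [h1 (-j), (h.tendsto_petalFilter hk j).eventually (h1 j)] with z h2 h3
  exact hφ.conjugates j z h2 h3

lemma eventually_abel (hφ : IsFatouSystem f k b r R φ) (hr : 0 < r) (hk : 1 ≤ k)
    (h : IsPrenormalized f k b) (j : ℤ) :
    ∀ᶠ z in petalFilter k j, φ j (f (f z)) = φ j z + 1 := by
  have h1 := hφ.eventually_conj hr hk h (-j)
  have h2 := h.tendsto_petalFilter hk (-j)
  rw [neg_neg] at h1 h2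
  filter_upwards [h1, h2.eventually (hφ.eventually_conj hr hk h j)] with z h3 h4
  rw [h4, h3, map_add, Complex.conj_conj, map_div₀, map_one, map_ofNat]
  ring

lemma mem_petalFilter (hr : 0 < r) (hk : 1 ≤ k) (h : IsPrenormalized f k b) (j : ℤ) :
    petal f k b r R j ∈ petalFilter k j :=
  eventually_petalFilter.2 ((h.petal_mem hk hr R j).mono fun _ h => h.2)

/-- A Fatou system is only assumed univalent and compatible with f. Applying that compatibility
twice yields the Abel equation, and univalence then forces the asymptotics by
`exists_isAsympLog_of_injOn`. -/
theorem exists_isAsympLog (hφ : IsFatouSystem f k b r R φ) (hr : 0 < r) (hk : 1 ≤ k)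
    (h : IsPrenormalized f k b) (j : ℤ) :
    ∃ c, IsAsympLog (sgn j * b / k) (fatouLift k φ j) c := by
  obtain ⟨Γ, hΓ, hodd, heven⟩ := h.exists_isNearTranslation hk j
  have hmem := h.petal_mem hk hr R j
  refine hΓ.exists_isAsympLog_of_injOn ?_ ⟨_, hmem, ?_⟩ ?_
  · filter_upwards [eventually_eventually_nhds_far hmem] with ζ hζ
    have h1 : DifferentiableOn ℂ (fun ζ => φ j (chart k j ζ))
        {ζ | ζ ∈ Complex.slitPlane ∧ chart k j ζ ∈ petal f k b r R j} :=
      (hφ.holomorphic j).comp (fun ζ hζ => (differentiableAt_chart hζ.1).differentiableWithinAt)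
        fun ζ hζ => hζ.2
    exact (h1.differentiableAt hζ).const_mul _
  · rintro x ⟨hx1, hx2⟩ y ⟨hy1, hy2⟩ hxy
    have hs : (sgn j : ℂ) ≠ 0 := Complex.ofReal_ne_zero.2 (sgn_ne_zero j)
    exact chart_injOn hk (Complex.slitPlane_ne_zero hx1) (Complex.slitPlane_ne_zero hy1)
      (hφ.injective j hx2 hy2 (mul_left_cancel₀ hs hxy))
  · have habel := eventually_petalFilter.1 (hφ.eventually_abel hr hk h j)
    rcases Int.even_or_odd j with hj | hj
    · filter_upwards [heven hj, hΓ.tendsto_far.eventually habel] with ζ h1 h2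
      rw [h1] at h2
      rw [fatouLift, fatouLift, h2, sgn_of_even hj]
      push_cast
      ring
    · filter_upwards [hodd hj, habel] with ζ h1 h2
      rw [fatouLift, fatouLift, ← h1, h2, sgn_of_odd hj]
      push_cast
      ring

end IsFatouSystem

/-! ### Transition functions on the overlaps -/

/-- Points deep in the intersection of the sectors of index `j - 1` and `j`. -/
def overlapFilter (k : ℕ) (j : ℤ) : Filter ℂ := map (chart k j) (comap Complex.im atTop)

/-- The even one of the indices `j - 1` and `j`. -/
def src (j : ℤ) : ℤ := if Odd j then j - 1 else j

/-- The odd one of the indices `j - 1` and `j`. -/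
def tgt (j : ℤ) : ℤ := if Odd j then j else j - 1

lemma even_src (j : ℤ) : Even (src j) := by
  unfold src
  split_ifs with h
  · exact h.sub_odd odd_one
  · exact Int.not_odd_iff_even.1 h

lemma map_neg_up : map (fun ζ : ℂ => -ζ) (comap Complex.im atTop) = comap Complex.im atBot := by
  refine le_antisymm tendsto_neg_up fun s hs => ?_
  have : ∀ᶠ ζ in comap Complex.im atBot, -(-ζ) ∈ s :=
    tendsto_neg_down.eventually (p := fun ζ => -ζ ∈ s) hs
  filter_upwards [this] with ζ hζ
  rwa [neg_neg] at hζ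

lemma overlapFilter_eq (k : ℕ) (j : ℤ) :
    overlapFilter k j = map (chart k (j - 1)) (comap Complex.im atBot) := by
  rw [overlapFilter, ← map_neg_up, map_map]
  refine Filter.map_congr ?_
  filter_upwards [tendsto_comap.eventually (eventually_gt_atTop 0)] with ζ hζ
  exact (chart_sub_one hζ).symm

lemma overlapFilter_le (k : ℕ) (j : ℤ) : overlapFilter k j ≤ petalFilter k j :=
  map_mono up_le_far

lemma overlapFilter_le' (k : ℕ) (j : ℤ) : overlapFilter k j ≤ petalFilter k (j - 1) := by
  rw [overlapFilter_eq]
  exact map_mono down_le_far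

lemma overlapFilter_le_src (k : ℕ) (j : ℤ) : overlapFilter k j ≤ petalFilter k (src j) := by
  unfold src
  split_ifs
  exacts [overlapFilter_le' k j, overlapFilter_le k j]

lemma overlapFilter_le_tgt (k : ℕ) (j : ℤ) : overlapFilter k j ≤ petalFilter k (tgt j) := by
  unfold tgt
  split_ifs
  exacts [overlapFilter_le k j, overlapFilter_le' k j]

namespace IsFatouSystem

variable {f : ℂ → ℂ} {k : ℕ} {b r R : ℝ} {φ : ℤ → ℂ → ℂ}

/-- A Fatou coordinate maps the overlap onto an end of the plane. -/
lemma tendsto_src (hφ : IsFatouSystem f k b r R φ) (hr : 0 < r) (hk : 1 ≤ k)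
    (h : IsPrenormalized f k b) (j : ℕ) :
    Tendsto (φ (src j)) (overlapFilter k j) (endFilter j) ∧
      ∃ ω : ℂ → ℂ, Tendsto ω (endFilter j) (overlapFilter k j) ∧
        ∀ᶠ W in endFilter j, φ (src j) (ω W) = W := by
  obtain ⟨c, hc⟩ := hφ.exists_isAsympLog hr hk h (src j)
  obtain ⟨Θ, hΘ⟩ := hc.exists_inverse
  have hval : ∀ ζ, φ (src j) (chart k (src j) ζ) = -fatouLift k φ (src j) ζ := by
    intro ζ
    rw [eq_sgn_mul_fatouLift k φ, sgn_of_even (even_src j)]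
    simp
  by_cases hj : Odd j
  · have hj' : Odd (j : ℤ) := by exact_mod_cast hj
    have hs : src j = (j : ℤ) - 1 := if_pos hj'
    rw [endFilter, if_pos hj, overlapFilter_eq, ← hs]
    refine ⟨?_, fun W => chart k (src j) (Θ (-W)), ?_, ?_⟩
    · rw [tendsto_map'_iff]
      exact (tendsto_neg_down.comp hc.tendsto_down).congr fun ζ => (hval ζ).symm
    · exact tendsto_map.comp (hΘ.down.comp tendsto_neg_up)
    · filter_upwards [tendsto_neg_up.eventually (down_le_far hΘ.right)] with W hW
      rw [hval, hW, neg_neg]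
  · have hj' : ¬ Odd (j : ℤ) := by exact_mod_cast hj
    have hs : src j = (j : ℤ) := if_neg hj'
    rw [hs] at hval hc hΘ ⊢
    rw [endFilter, if_neg hj, overlapFilter]
    refine ⟨?_, fun W => chart k j (Θ (-W)), ?_, ?_⟩
    · rw [tendsto_map'_iff]
      exact (tendsto_neg_up.comp hc.tendsto_up).congr fun ζ => (hval ζ).symm
    · exact tendsto_map.comp (hΘ.up.comp tendsto_neg_down)
    · filter_upwards [tendsto_neg_down.eventually (up_le_far hΘ.right)] with W hW
      rw [hval, hW, neg_neg]

/-- The definition provides, for each W, some point of the overlap realizing Ψ_j W; injectivity of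
the source coordinate on its petal shows that it is the given z. -/
lemma eventually_transition (hφ : IsFatouSystem f k b r R φ) (hr : 0 < r) (hk : 1 ≤ k)
    (h : IsPrenormalized f k b) {Ψ : ℕ → ℂ → ℂ} (hΨ : IsTransitionOf f k b r R φ Ψ) {j : ℕ}
    (hj1 : 1 ≤ j) (hjk : j ≤ k) :
    ∀ᶠ z in overlapFilter k j, φ (tgt j) z = Ψ j (φ (src j) z) := by
  have hex : ∀ᶠ W in endFilter j, ∃ z ∈ petal f k b r R (src j),
      φ (src j) z = W ∧ φ (tgt j) z = Ψ j W := by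
    by_cases hj : Odd j
    · have hj' : Odd (j : ℤ) := by exact_mod_cast hj
      rw [src, tgt, if_pos hj', if_pos hj']
      filter_upwards [(hΨ j hj1 hjk).1 hj] with W ⟨z, hz, hz'⟩
      exact ⟨z, hz.1.1, hz'⟩
    · have hj' : ¬ Odd (j : ℤ) := by exact_mod_cast hj
      rw [src, tgt, if_neg hj', if_neg hj']
      filter_upwards [(hΨ j hj1 hjk).2 (Nat.not_odd_iff_even.1 hj)] with W ⟨z, hz, hz'⟩
      exact ⟨z, hz.1.2, hz'⟩
  filter_upwards [(hφ.tendsto_src hr hk h j).1.eventually hex,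
    overlapFilter_le_src k j (mem_petalFilter (R := R) hr hk h (src j))] with z ⟨z', h1, h2, h3⟩ h4
  rw [← h3, hφ.injective _ h1 h4 h2]

end IsFatouSystem

end FatouSystem

/-! ### Roots commute with the translations of the time coordinates -/

section Forward

lemma TangentTo.isEquivalent {k : ℕ} (hk : 1 ≤ k) {a : ℂ} {t : ℂ → ℂ} (h : TangentTo k a t) :
    t ~[𝓝 0] fun z => z := by
  have h1 : (fun z : ℂ => z ^ (k + 1)) =o[𝓝 0] fun z => z := by
    simpa using isLittleO_pow_pow (𝕜 := ℂ) (show 1 < k + 1 by omega)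
  have := (h.trans h1).add (h1.const_mul_left a)
  refine this.congr_left fun z => ?_
  simp only [Pi.sub_apply]
  ring

lemma TangentTo.tendsto (hk : 1 ≤ k) {a : ℂ} {t : ℂ → ℂ} (h : TangentTo k a t) :
    Tendsto t (𝓝 0) (𝓝 0) :=
  (h.isEquivalent hk).symm.tendsto_nhds tendsto_id

lemma TangentTo.comp {k : ℕ} (hk : 1 ≤ k) {a a' : ℂ} {s t : ℂ → ℂ} (hs : TangentTo k a s)
    (ht : TangentTo k a' t) : TangentTo k (a + a') (s ∘ t) := by
  have he := ht.isEquivalent hk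
  have h1 := (hs.comp_tendsto (ht.tendsto hk)).trans_isBigO (he.isBigO.pow (k + 1))
  have h2 : (fun z => t z ^ (k + 1) - z ^ (k + 1)) =o[𝓝 0] fun z => z ^ (k + 1) :=
    (he.pow (k + 1)).isLittleO
  refine ((h1.add (h2.const_mul_left a)).add ht).congr_left fun z => ?_
  simp only [Function.comp]
  ring

lemma TangentTo.conj_conj {k : ℕ} {a : ℂ} {t : ℂ → ℂ} (h : TangentTo k a t) :
    TangentTo k (conj a) fun z => conj (t (conj z)) := by
  have hconj : Tendsto (conj : ℂ → ℂ) (𝓝 0) (𝓝 0) := by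
    simpa using Complex.continuous_conj.tendsto 0
  refine IsLittleO.of_norm_norm ((h.comp_tendsto hconj).norm_norm.congr (fun z => ?_) fun z => ?_)
  · rw [← RCLike.norm_conj]
    simp
  · simp

lemma TangentTo.iterate {k : ℕ} (hk : 1 ≤ k) {a : ℂ} {t : ℂ → ℂ} (h : TangentTo k a t) (n : ℕ) :
    TangentTo k (n * a) t^[n] := by
  induction n with
  | zero => simp [TangentTo]
  | succ n ih =>
    rw [Function.iterate_succ']
    have := h.comp hk ih
    push_cast
    rwa [add_mul, one_mul, add_comm]

lemma TangentTo.congr {k : ℕ} {a : ℂ} {s t : ℂ → ℂ} (h : TangentTo k a s) (hst : s =ᶠ[𝓝 0] t) :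
    TangentTo k a t :=
  IsLittleO.congr' h (hst.mono fun z hz => by simp only [hz]) EventuallyEq.rfl

lemma TangentTo.unique {k l : ℕ} {a a' : ℂ} {t : ℂ → ℂ} (h : TangentTo k a t)
    (h' : TangentTo l a' t) (ha : a ≠ 0) (ha' : a' ≠ 0) : k = l ∧ a = a' := by
  have key : ∀ {k l : ℕ} {a a' : ℂ}, TangentTo k a t → TangentTo l a' t → k < l → a = 0 := by
    intro k l a a' h h' hkl
    have h1 := h'.tendsto_relDisp_div.mul (tendsto_pow_nhdsNE (show 1 ≤ l - k by omega))
    rw [mul_zero] at h1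
    refine tendsto_nhds_unique h.tendsto_relDisp_div (h1.congr' ?_)
    filter_upwards [self_mem_nhdsWithin] with z hz
    have : z ≠ 0 := hz
    have e : z ^ l = z ^ k * z ^ (l - k) := by rw [← pow_add]; congr 1; omega
    rw [e]
    field_simp
  rcases lt_trichotomy k l with hlt | rfl | hlt
  · exact absurd (key h h' hlt) ha
  · exact ⟨rfl, tendsto_nhds_unique h.tendsto_relDisp_div h'.tendsto_relDisp_div⟩
  · exact absurd (key h' h hlt) ha'

/-- The only iterative roots, tangent to the identity, of a germ tangent to the identity are
tangent to it to the same order. -/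
lemma tangentTo_of_iterate {k n : ℕ} {a : ℂ} {q : ℂ → ℂ} (hq : AnalyticAt ℂ q 0) (hq0 : q 0 = 0)
    (hq1 : deriv q 0 = 1) (h : TangentTo k a q^[n]) (ha : a ≠ 0) : TangentTo k (a / n) q := by
  have hd : AnalyticAt ℂ (fun z => q z - z) 0 := hq.sub analyticAt_id
  by_cases htop : analyticOrderAt (fun z => q z - z) 0 = ⊤
  · exfalso
    have h1 : ∀ᶠ z in 𝓝 (0 : ℂ), q z = z :=
      (analyticOrderAt_eq_top.1 htop).mono fun z hz => sub_eq_zero.1 hz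
    have h2 : ∀ᶠ z in 𝓝 (0 : ℂ), q^[n] z = z := h1.mono fun z hz => Function.iterate_fixed hz n
    have h3 : TangentTo k a fun z => z := h.congr h2
    have h4 : Tendsto (fun z : ℂ => relDisp (fun z => z) z / z ^ k) (𝓝[≠] 0) (𝓝 0) := by
      simp [relDisp]
    exact ha (tendsto_nhds_unique h3.tendsto_relDisp_div h4)
  · obtain ⟨m, hm⟩ := ENat.ne_top_iff_exists.1 htop
    obtain ⟨e, he, he0, hez⟩ := hd.analyticOrderAt_eq_natCast.1 hm.symm
    have hm2 : 2 ≤ m := by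
      by_contra! hlt
      have hderiv : HasDerivAt (fun z => q z - z) 0 0 := by
        have := hq.differentiableAt.hasDerivAt.sub (hasDerivAt_id 0)
        rw [hq1, sub_self] at this
        exact this
      have hval : (fun z => q z - z) 0 = 0 := by simp [hq0]
      have h0 := hez.self_of_nhds
      obtain _ | _ | m := m
      · simp only [sub_zero, pow_zero, one_smul, hq0] at h0
        exact he0 h0.symm
      · have h1 : HasDerivAt (fun z : ℂ => (z - 0) ^ (0 + 1) • e z) (e 0) 0 := by
          have := (hasDerivAt_id (0 : ℂ)).mul he.differentiableAt.hasDerivAt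
          simp only [id, one_mul, zero_mul, add_zero] at this
          refine HasDerivAt.congr_of_eventuallyEq this (Eventually.of_forall fun z => ?_)
          simp
        exact he0 ((h1.congr_of_eventuallyEq hez).unique hderiv)
      · omega
    obtain ⟨l, rfl⟩ : ∃ l, m = l + 1 := ⟨m - 1, by omega⟩
    have hl : 1 ≤ l := by omega
    have hql : TangentTo l (e 0) q := by
      have h1 : (fun z => e z - e 0) =o[𝓝 0] fun _ : ℂ => (1 : ℂ) := by
        rw [isLittleO_one_iff]
        simpa using (he.continuousAt.tendsto.sub_const (e 0))
      have h2 := (isBigO_refl (fun z : ℂ => z ^ (l + 1)) (𝓝 0)).mul_isLittleO h1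
      refine h2.congr' ?_ (by simp)
      filter_upwards [hez] with z hz
      rw [hz, sub_zero, smul_eq_mul]
      ring
    have hn : (n : ℂ) ≠ 0 := by
      rintro hn
      have h1 := hql.iterate hl n
      have hn' : n = 0 := by exact_mod_cast hn
      subst hn'
      have h4 : Tendsto (fun z : ℂ => relDisp (fun z => z) z / z ^ k) (𝓝[≠] 0) (𝓝 0) := by
        simp [relDisp]
      exact ha (tendsto_nhds_unique h.tendsto_relDisp_div h4)
    -- The n-th iterate of z + e₀z^(l+1) + ⋯ is z + n e₀z^(l+1) + ⋯, and a leading term is unique.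
    obtain ⟨rfl, e1⟩ := h.unique (hql.iterate hl n) ha (mul_ne_zero hn he0)
    rw [e1, mul_div_cancel_left₀ _ hn]
    exact hql

lemma AnalyticAt.conj_conj {F : ℂ → ℂ} (hF : AnalyticAt ℂ F 0) :
    AnalyticAt ℂ (fun z => conj (F (conj z))) 0 := by
  rw [Complex.analyticAt_iff_eventually_differentiableAt] at hF ⊢
  have hconj : Tendsto (conj : ℂ → ℂ) (𝓝 0) (𝓝 0) := by
    simpa using Complex.continuous_conj.tendsto 0
  filter_upwards [hconj.eventually hF] with z hz
  have := hz.conj_conj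
  rwa [Complex.conj_conj] at this

namespace IsAntiholGerm

variable {f h : ℂ → ℂ}

lemma tendsto (hf : IsAntiholGerm f) : Tendsto f (𝓝 0) (𝓝 0) := by
  have hconj : Tendsto (conj : ℂ → ℂ) (𝓝 0) (𝓝 0) := by
    simpa using Complex.continuous_conj.tendsto 0
  have h1 := hf.2.continuousAt.tendsto.comp hconj
  simp only [map_zero, hf.1] at h1
  refine h1.congr fun z => ?_
  simp

lemma analyticAt_comp_self (hf : IsAntiholGerm f) : AnalyticAt ℂ (f ∘ f) 0 := by
  have h1 := AnalyticAt.conj_conj hf.2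
  simp only [Complex.conj_conj] at h1
  have h2 : AnalyticAt ℂ (fun z => f (conj z)) (conj (f 0)) := by
    rw [hf.1, map_zero]
    exact hf.2
  have := AnalyticAt.comp (g := fun z => f (conj z)) (f := fun z => conj (f z)) h2 h1
  refine this.congr (Eventually.of_forall fun z => ?_)
  simp

lemma iterate_comp_self_eventuallyEq (hh : IsAntiholGerm h) {n : ℕ} (hn : h^[n] =ᶠ[𝓝 0] f) :
    (h ∘ h)^[n] =ᶠ[𝓝 0] f ∘ f := by
  have h0 : Tendsto h^[n] (𝓝 0) (𝓝 0) := by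
    clear hn
    induction n with
    | zero => exact tendsto_id
    | succ n ih =>
      rw [Function.iterate_succ']
      exact hh.tendsto.comp ih
  have e : (h ∘ h)^[n] = h^[n] ∘ h^[n] := by
    rw [← Function.iterate_add, show h ∘ h = h^[2] from rfl, ← Function.iterate_mul, two_mul]
  rw [e]
  filter_upwards [hn, h0.eventually hn] with z h1 h2
  rw [Function.comp, h2, Function.comp, h1]

/-- The square of an antiholomorphic germ has a nonnegative multiplier. -/
lemma exists_deriv_comp_self (hh : IsAntiholGerm h) :
    ∃ x : ℝ, 0 ≤ x ∧ HasDerivAt (h ∘ h) x 0 := by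
  have h1 : HasDerivAt (fun z => h (conj z)) (deriv (fun z => h (conj z)) 0) 0 :=
    hh.2.differentiableAt.hasDerivAt
  set a := deriv (fun z => h (conj z)) 0
  have h2 : HasDerivAt (fun z => conj (h z)) (conj a) 0 := by
    have := h1.conj_conj
    rw [map_zero] at this
    refine this.congr_of_eventuallyEq (Eventually.of_forall fun z => ?_)
    simp
  have h3 : HasDerivAt (fun z => h (conj z)) a (conj (h 0)) := by
    rw [hh.1, map_zero]
    exact h1
  have h4 := HasDerivAt.comp (0 : ℂ) h3 h2
  refine ⟨‖a‖ ^ 2, by positivity, ?_⟩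
  rw [Complex.mul_conj, Complex.normSq_eq_norm_sq] at h4
  refine h4.congr_of_eventuallyEq (Eventually.of_forall fun z => ?_)
  simp

end IsAntiholGerm

lemma IsPrenormalized.tangentTo_comp_self {f : ℂ → ℂ} {k : ℕ} {b : ℝ} (hk : 1 ≤ k)
    (h : IsPrenormalized f k b) : TangentTo k 1 (f ∘ f) := by
  have h1 := (h.tangentTo hk).comp hk (h.tangentTo hk).conj_conj
  have e : (1 / 2 + conj (1 / 2) : ℂ) = 1 := by
    rw [map_div₀, map_one, map_ofNat]
    norm_num
  rw [e] at h1
  refine h1.congr (Eventually.of_forall fun z => ?_)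
  simp

/-- The square of a root is tangent to the identity, with the expected coefficient. -/
lemma IsRoot.tangentTo {f h : ℂ → ℂ} {k n : ℕ} {b : ℝ} (hk : 1 ≤ k) (hn : n ≠ 0)
    (hf : IsPrenormalized f k b) (hh : IsRoot n f h) : TangentTo k (1 / n) (h ∘ h) := by
  have hit := hh.1.iterate_comp_self_eventuallyEq hh.2
  have hg := (hf.tangentTo_comp_self hk).congr hit.symm
  have h00 : (h ∘ h) 0 = 0 := by simp [hh.1.1]
  refine tangentTo_of_iterate hh.1.analyticAt_comp_self h00 ?_ hg one_ne_zero
  -- The multiplier of h ∘ h is a nonnegative real whose n-th power is 1, hence 1: the other roots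
  -- of unity are excluded by antiholomorphy.
  obtain ⟨x, hx0, hx⟩ := hh.1.exists_deriv_comp_self
  have h1 := hx.iterate _ h00 n
  have h2 : HasDerivAt (h ∘ h)^[n] 1 0 := by
    rw [hasDerivAt_iff_isLittleO]
    have := (hg.isEquivalent hk).isLittleO
    have h3 : (h ∘ h)^[n] 0 = 0 := Function.iterate_fixed h00 n
    rw [h3]
    refine this.congr (fun z => ?_) (fun z => ?_) <;> simp
  have h3 : x ^ n = 1 := by
    have := h1.unique h2
    exact_mod_cast this
  rw [hx.deriv, (pow_eq_one_iff_of_nonneg hx0 hn).1 h3, Complex.ofReal_one]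

lemma TangentTo.tendsto_petalFilter {k : ℕ} (hk : 1 ≤ k) {a : ℂ} {t : ℂ → ℂ}
    (h : TangentTo k a t) (j : ℤ) : Tendsto t (petalFilter k j) (petalFilter k j) := by
  rw [petalFilter, tendsto_map'_iff]
  exact (tendsto_map.comp (h.tendsto_lift_comap hk j lipschitzWith_rho le_rfl)).congr'
    (h.eventually_chart_lift hk j)

lemma TangentTo.tendsto_overlapFilter {k : ℕ} (hk : 1 ≤ k) {a : ℂ} {t : ℂ → ℂ}
    (h : TangentTo k a t) (j : ℤ) : Tendsto t (overlapFilter k j) (overlapFilter k j) := by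
  rw [overlapFilter, tendsto_map'_iff]
  exact (tendsto_map.comp (h.tendsto_lift_comap hk j lipschitzWith_im up_le_far)).congr'
    (up_le_far (h.eventually_chart_lift hk j))

lemma petalFilter_le_nhds {k : ℕ} (hk : 1 ≤ k) (j : ℤ) : petalFilter k j ≤ 𝓝 0 :=
  (tendsto_chart hk j).mono_right nhdsWithin_le_nhds

namespace IsFatouSystem

variable {f h : ℂ → ℂ} {k n : ℕ} {b r R : ℝ} {φ : ℤ → ℂ → ℂ}

/-- In the Fatou coordinates, the square of a root is a translation. -/
theorem eventually_root (hφ : IsFatouSystem f k b r R φ) (hr : 0 < r) (hk : 1 ≤ k) (hn : n ≠ 0)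
    (hf : IsPrenormalized f k b) (hh : IsRoot n f h) (j : ℤ) :
    ∀ᶠ z in petalFilter k j, φ j (h (h z)) = φ j z + 1 / n := by
  have hq := hh.tangentTo hk hn hf
  have hqP := hq.tendsto_petalFilter hk j
  have hgP := (hf.tangentTo_comp_self hk).tendsto_petalFilter hk j
  obtain ⟨c, hc⟩ := hφ.exists_isAsympLog hr hk hf j
  obtain ⟨Γ, hΓ, hodd, heven⟩ := hf.exists_isNearTranslation hk j
  set D : ℂ → ℂ := fun z => φ j (h (h z)) - φ j z with hD
  have hlim : Tendsto (fun ζ => D (chart k j ζ)) far (𝓝 (1 / n)) := by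
    have h1 := hq.tendsto_lift_sub hk j
    have hb : ∀ᶠ ζ in far, lift k j (h ∘ h) ζ ∈ Metric.closedBall ζ (‖(1 / n : ℂ)‖ + 1) := by
      have := h1.norm
      rw [norm_sgn_mul] at this
      filter_upwards [this.eventually (gt_mem_nhds (lt_add_one _))] with ζ hζ
      rw [Metric.mem_closedBall, dist_eq_norm]
      exact hζ.le
    -- The Fatou coordinate is nearly a translation on balls of fixed radius, so its increment under
    -- h ∘ h has the same limit as the displacement in the chart.
    have h2 : Tendsto (fun ζ => fatouLift k φ j (lift k j (h ∘ h) ζ) - fatouLift k φ j ζ -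
        (lift k j (h ∘ h) ζ - ζ)) far (𝓝 0) := by
      rw [Metric.tendsto_nhds]
      intro ε hε
      filter_upwards [hb, hc.eventually_translation (‖(1 / n : ℂ)‖ + 1)
        (show 0 < ε / 2 by positivity)] with ζ h3 h4
      rw [dist_zero_right]
      linarith [h4 _ h3]
    have h3 := (h2.add h1).const_mul (sgn j : ℂ)
    rw [zero_add, ← mul_assoc, sgn_mul_self_complex, one_mul] at h3
    refine h3.congr' ?_
    filter_upwards [hq.eventually_chart_lift hk j] with ζ hζ
    simp only [fatouLift]
    rw [hζ]
    simp only [hD, Function.comp]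
    linear_combination (φ j (h (h (chart k j ζ))) - φ j (chart k j ζ)) * sgn_mul_self_complex j
  -- Both maps are iterates of h ∘ h near 0, so they commute; the displacement D is then invariant
  -- under f ∘ f, and its limit at the end of the orbit is its value at the start.
  have hcomm : ∀ᶠ z in petalFilter k j, h (h (f (f z))) = f (f (h (h z))) := by
    have hit := hh.1.iterate_comp_self_eventuallyEq hh.2
    filter_upwards [petalFilter_le_nhds hk j hit, hqP.eventually (petalFilter_le_nhds hk j hit)]
      with z h1 h2
    change (h ∘ h) ((f ∘ f) z) = (f ∘ f) ((h ∘ h) z)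
    rw [← h2, ← h1]
    exact (Function.iterate_succ_apply' (h ∘ h) n z).symm.trans
      (Function.iterate_succ_apply (h ∘ h) n z)
  have hinv : ∀ᶠ z in petalFilter k j, D (f (f z)) = D z := by
    have ha := hφ.eventually_abel hr hk hf j
    filter_upwards [ha, hqP.eventually ha, hcomm] with z h1 h2 h3
    simp only [Function.comp] at h2
    simp only [hD]
    rw [h1, h3, h2]
    ring
  have hΓD : ∀ᶠ ζ in far, D (chart k j (Γ ζ)) = D (chart k j ζ) := by
    rcases Int.even_or_odd j with hj | hj
    · filter_upwards [heven hj, hΓ.tendsto_far.eventually (eventually_petalFilter.1 hinv)]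
        with ζ h1 h2
      rw [← h2, h1]
    · filter_upwards [hodd hj, eventually_petalFilter.1 hinv] with ζ h1 h2
      rw [← h2, h1]
  rw [eventually_petalFilter]
  filter_upwards [hΓ.eventually_orbit one_pos hΓD, hΓ.eventually_tendsto_orbit] with ζ h1 h2
  have h3 : ∀ N, D (chart k j (Γ^[N] ζ)) = D (chart k j ζ) := by
    intro N
    induction N with
    | zero => rfl
    | succ N ih => rw [Function.iterate_succ_apply', ← ih]; exact (h1 N).1
  have h4 : D (chart k j ζ) = 1 / n :=
    tendsto_nhds_unique (tendsto_const_nhds.congr fun N => (h3 N).symm) (hlim.comp h2)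
  simp only [hD] at h4
  linear_combination h4

/-- The map h ∘ h preserves the overlap and is T_{1/n} in both adjacent Fatou coordinates, while Ψ_j
passes from one to the other. Points over every W close to the end are supplied by the right inverse
ω. -/
theorem commutesWithTranslation_of_isRoot (hφ : IsFatouSystem f k b r R φ) (hr : 0 < r)
    (hk : 1 ≤ k) (hn : n ≠ 0) (hf : IsPrenormalized f k b) (hh : IsRoot n f h) {Ψ : ℕ → ℂ → ℂ}
    (hΨ : IsTransitionOf f k b r R φ Ψ) {j : ℕ} (hj1 : 1 ≤ j) (hjk : j ≤ k) :
    CommutesWithTranslation j (Ψ j) (1 / n) := by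
  have hT := hφ.eventually_transition hr hk hf hΨ hj1 hjk
  have hq := (hh.tangentTo hk hn hf).tendsto_overlapFilter hk j
  obtain ⟨-, ω, hω, hωW⟩ := hφ.tendsto_src hr hk hf j
  have key : ∀ᶠ z in overlapFilter k j, Ψ j (φ (src j) z + 1 / n) = Ψ j (φ (src j) z) + 1 / n := by
    filter_upwards [hT, hq.eventually hT,
      overlapFilter_le_src k j (hφ.eventually_root hr hk hn hf hh (src j)),
      overlapFilter_le_tgt k j (hφ.eventually_root hr hk hn hf hh (tgt j))] with z h1 h2 h3 h4
    simp only [Function.comp] at h2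
    rw [← h3, ← h2, h4, h1]
  filter_upwards [hω.eventually key, hωW] with W h1 h2
  rwa [h2] at h1

end IsFatouSystem

end Forward

/-! ### Translations of the Fatou coordinates glue to a germ -/

section Charts

variable {k : ℕ}

lemma chart_periodic (hk : 1 ≤ k) (j m : ℤ) : chart k (j + m * (2 * k)) = chart k j :=
  funext fun _ => chart_add_two_mul hk m

lemma tendsto_powCoord_petalFilter (hk : 1 ≤ k) (j : ℤ) {l : Filter ℂ} (hl : l ≤ far) :
    Tendsto (fun z => sgn j * powCoord k z) (map (chart k j) l) l := by
  rw [tendsto_map'_iff]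
  refine tendsto_id.congr' ?_
  filter_upwards [hl eventually_far_mem_slitPlane] with ζ hζ
  exact (sgn_mul_powCoord_chart hk (Complex.slitPlane_ne_zero hζ)).symm

lemma map_chart_nhds (hk : 1 ≤ k) (j : ℤ) {ζ : ℂ} (h : ζ ∈ Complex.slitPlane) :
    map (chart k j) (𝓝 ζ) = 𝓝 (chart k j ζ) := by
  have hk0 : (k : ℂ) ≠ 0 := Nat.cast_ne_zero.2 (by omega)
  have hζ := Complex.slitPlane_ne_zero h
  have h1 : HasStrictDerivAt (chart k j) (chart k j ζ * (-ζ⁻¹ / k)) ζ :=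
    (((Complex.hasStrictDerivAt_log h).const_sub _).div_const _).cexp
  refine h1.map_nhds_eq (mul_ne_zero chart_ne_zero (div_ne_zero (neg_ne_zero.2 ?_) hk0))
  exact inv_ne_zero hζ

lemma eventually_eventually_nhds_petalFilter (hk : 1 ≤ k) {j : ℤ} {p : ℂ → Prop}
    (h : ∀ᶠ z in petalFilter k j, p z) : ∀ᶠ z in petalFilter k j, ∀ᶠ z' in 𝓝 z, p z' := by
  rw [eventually_petalFilter] at h ⊢
  filter_upwards [eventually_eventually_nhds_far h, eventually_far_mem_slitPlane] with ζ h1 h2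
  rw [← map_chart_nhds hk j h2]
  exact h1

lemma eventually_nhdsNE_of_petalFilter (hk : 1 ≤ k) {p : ℂ → Prop}
    (h : ∀ j, ∀ᶠ z in petalFilter k j, p z) : ∀ᶠ z in 𝓝[≠] (0 : ℂ), p z := by
  filter_upwards [eventually_nhdsNE_of_chart hk fun j => eventually_petalFilter.1 (h j)]
    with z hz
  obtain ⟨j, ζ, -, -, h1, h2⟩ := hz
  rwa [← h1]

lemma overlapFilter_succ (k : ℕ) (j : ℤ) :
    overlapFilter k (j + 1) = map (chart k j) (comap Complex.im atBot) := by
  rw [overlapFilter_eq, add_sub_cancel_right]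

end Charts

/-- `p` lifts the translation by `τ` through the Fatou coordinate of index `j`. -/
structure IsPetalTranslation (k : ℕ) (φ : ℤ → ℂ → ℂ) (τ : ℂ) (j : ℤ) (p : ℂ → ℂ) : Prop where
  tendsto : Tendsto p (petalFilter k j) (petalFilter k j)
  tendsto_overlap : Tendsto p (overlapFilter k j) (overlapFilter k j)
  tendsto_overlap_succ : Tendsto p (overlapFilter k (j + 1)) (overlapFilter k (j + 1))
  differentiable : ∀ᶠ z in petalFilter k j, DifferentiableAt ℂ p z
  translation : ∀ᶠ z in petalFilter k j, φ j (p z) = φ j z + τ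

namespace IsFatouSystem

variable {f : ℂ → ℂ} {k : ℕ} {b r R : ℝ} {φ : ℤ → ℂ → ℂ}

/-- The Fatou coordinate is invertible near infinity, so the translation can be conjugated back to
the chart and then to the petal. The sign sgn(j) in front of τ is that of `fatouLift`. -/
theorem exists_isPetalTranslation (hφ : IsFatouSystem f k b r R φ) (hr : 0 < r) (hk : 1 ≤ k)
    (h : IsPrenormalized f k b) (τ : ℂ) (j : ℤ) : ∃ p, IsPetalTranslation k φ τ j p := by
  obtain ⟨c, hc⟩ := hφ.exists_isAsympLog hr hk h j
  obtain ⟨Θ, hΘ⟩ := hc.exists_inverse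
  set T : ℂ → ℂ := fun ζ => Θ (fatouLift k φ j ζ - -(sgn j * τ)) with hT
  have hfar : Tendsto (fun ζ => fatouLift k φ j ζ - -(sgn j * τ)) far far :=
    (tendsto_sub_const_comap lipschitzWith_rho _).comp hc.tendsto_far
  have hup : Tendsto (fun ζ => fatouLift k φ j ζ - -(sgn j * τ)) (comap Complex.im atTop)
      (comap Complex.im atTop) :=
    (tendsto_sub_const_comap lipschitzWith_im _).comp hc.tendsto_up
  have hdown : Tendsto (fun ζ => fatouLift k φ j ζ - -(sgn j * τ)) (comap Complex.im atBot)
      (comap Complex.im atBot) := by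
    have h1 := tendsto_sub_const_comap lipschitzWith_neg_im (-(sgn j * τ))
    rw [← comap_im_atBot] at h1
    exact h1.comp hc.tendsto_down
  have hTf : Tendsto T far far := hΘ.far.comp hfar
  have key : ∀ {l : Filter ℂ}, l ≤ far → Tendsto T l l →
      Tendsto (fun z => chart k j (T (sgn j * powCoord k z))) (map (chart k j) l)
        (map (chart k j) l) := fun hl hTl =>
    tendsto_map.comp (hTl.comp (tendsto_powCoord_petalFilter hk j hl))
  refine ⟨fun z => chart k j (T (sgn j * powCoord k z)), key le_rfl hTf,
    key up_le_far (hΘ.up.comp hup), ?_, ?_, ?_⟩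
  · rw [overlapFilter_succ]
    exact key down_le_far (hΘ.down.comp hdown)
  · rw [eventually_petalFilter]
    filter_upwards [hfar.eventually hΘ.differentiable, hc.differentiable,
      hTf.eventually eventually_far_mem_slitPlane, eventually_far_mem_slitPlane] with ζ h1 h2 h3 h4
    have e := sgn_mul_powCoord_chart (j := j) hk (Complex.slitPlane_ne_zero h4)
    have d1 : DifferentiableAt ℂ T ζ := h1.comp ζ (h2.sub_const _)
    have d2 : DifferentiableAt ℂ (fun ζ => chart k j (T ζ)) ζ :=
      (differentiableAt_chart h3).comp ζ d1
    have d3 : DifferentiableAt ℂ (fun z => sgn j * powCoord k z) (chart k j ζ) :=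
      (differentiableAt_powCoord hk chart_ne_zero).const_mul _
    rw [← e] at d2
    exact DifferentiableAt.comp (g := fun ζ => chart k j (T ζ)) (chart k j ζ) d2 d3
  · rw [eventually_petalFilter]
    filter_upwards [hfar.eventually hΘ.right, eventually_far_mem_slitPlane] with ζ h1 h2
    rw [sgn_mul_powCoord_chart hk (Complex.slitPlane_ne_zero h2), eq_sgn_mul_fatouLift k φ, h1,
      eq_sgn_mul_fatouLift k φ]
    linear_combination τ * sgn_mul_self_complex j

/-- Points near the vertex of a petal are separated by the Fatou coordinate. -/
lemma eventually_eq (hφ : IsFatouSystem f k b r R φ) (hr : 0 < r) (hk : 1 ≤ k)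
    (h : IsPrenormalized f k b) {j : ℤ} {l : Filter ℂ} {u v : ℂ → ℂ}
    (hu : Tendsto u l (petalFilter k j)) (hv : Tendsto v l (petalFilter k j))
    (huv : ∀ᶠ z in l, φ j (u z) = φ j (v z)) : ∀ᶠ z in l, u z = v z := by
  have hm := mem_petalFilter (R := R) hr hk h j
  filter_upwards [hu hm, hv hm, huv] with z h1 h2 h3
  exact hφ.injective j h1 h2 h3

lemma periodic' (hφ : IsFatouSystem f k b r R φ) (j m : ℤ) : φ (j + m * (2 * k)) = φ j := by
  have h : Function.Periodic φ (2 * k) := hφ.periodic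
  simpa using h.int_mul m j

/-- The lifts are chosen for residues modulo 2k, so that they can be compared after a full turn
around the origin. -/
theorem exists_periodic_isPetalTranslation (hφ : IsFatouSystem f k b r R φ) (hr : 0 < r)
    (hk : 1 ≤ k) (h : IsPrenormalized f k b) (τ : ℂ) : ∃ p : ℤ → ℂ → ℂ,
      (∀ j, IsPetalTranslation k φ τ j (p j)) ∧ ∀ j m, p (j + m * (2 * k)) = p j := by
  choose p hp using hφ.exists_isPetalTranslation hr hk h τ
  refine ⟨fun j => p (j % (2 * k)), fun j => ?_, fun j m => ?_⟩
  · have e : j = j % (2 * k) + j / (2 * k) * (2 * k) := (Int.emod_add_ediv_mul j _).symm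
    have hq := hp (j % (2 * k))
    have e1 : φ j = φ (j % (2 * k)) := by conv_lhs => rw [e, hφ.periodic']
    have e2 : chart k j = chart k (j % (2 * k)) := by conv_lhs => rw [e, chart_periodic hk]
    have e3 : chart k (j + 1) = chart k (j % (2 * k) + 1) := by
      conv_lhs => rw [e, add_right_comm, chart_periodic hk]
    obtain ⟨h1, h2, h3, h4, h5⟩ := hq
    constructor <;> simp only [petalFilter, overlapFilter, e1, e2, e3] at * <;> assumption
  · simp only [Int.add_mul_emod_self_right]

section Glue

variable {τ : ℂ} {p : ℤ → ℂ → ℂ}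

/-- In the target coordinate, the source lift becomes Ψ_j(W + τ) and the target lift Ψ_j(W) + τ.
These agree by commutation, and univalence removes the coordinate. -/
lemma eventually_overlap_of_transition (hφ : IsFatouSystem f k b r R φ) (hr : 0 < r) (hk : 1 ≤ k)
    (h : IsPrenormalized f k b) (hp : ∀ j, IsPetalTranslation k φ τ j (p j)) {Ψ : ℕ → ℂ → ℂ}
    (hΨ : IsTransitionOf f k b r R φ Ψ) {j : ℕ} (hj1 : 1 ≤ j) (hjk : j ≤ k)
    (hc : CommutesWithTranslation j (Ψ j) τ) :
    ∀ᶠ z in overlapFilter k j, p (j - 1) z = p j z := by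
  have hT := hφ.eventually_transition hr hk h hΨ hj1 hjk
  have hover : ∀ i, i = (j : ℤ) - 1 ∨ i = j →
      Tendsto (p i) (overlapFilter k j) (overlapFilter k j) := by
    rintro i (rfl | rfl)
    · simpa using (hp ((j : ℤ) - 1)).tendsto_overlap_succ
    · exact (hp _).tendsto_overlap
  have hsrc := hover (src j) (by unfold src; split_ifs <;> simp)
  have htgt := hover (tgt j) (by unfold tgt; split_ifs <;> simp)
  have key : ∀ᶠ z in overlapFilter k j, p (src j) z = p (tgt j) z := by
    refine hφ.eventually_eq hr hk h (j := tgt j) (hsrc.mono_right (overlapFilter_le_tgt k j))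
      (htgt.mono_right (overlapFilter_le_tgt k j)) ?_
    filter_upwards [hT, hsrc.eventually hT, overlapFilter_le_src k j (hp (src j)).translation,
      overlapFilter_le_tgt k j (hp (tgt j)).translation,
      (hφ.tendsto_src hr hk h j).1.eventually hc] with z h1 h2 h3 h4 h5
    rw [h2, h3, h5, h4, h1]
  unfold src tgt at key
  split_ifs at key
  · exact key
  · exact key.mono fun z hz => hz.symm

/-- To leading order f is the conjugation of the charts -(j - 1) and j - 1, which exchanges their
upper and lower ends. -/
lemma tendsto_overlapFilter_neg (hk : 1 ≤ k) (h : IsPrenormalized f k b) (j : ℤ) :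
    Tendsto f (overlapFilter k (1 - j)) (overlapFilter k j) := by
  rw [overlapFilter_eq k j, overlapFilter, tendsto_map'_iff]
  have h1 := h.eventually_apply_chart hk (j - 1)
  rw [neg_sub] at h1
  exact (tendsto_map.comp (h.tendsto_antiLift_up hk (j - 1))).congr'
    (Eventually.mono (up_le_far h1) fun ζ hζ => hζ.symm)

/-- In the Fatou coordinates f is Σ ∘ T_{1/2}, which commutes with T_τ for τ real. -/
lemma eventually_apply_petalTranslation (hφ : IsFatouSystem f k b r R φ) (hr : 0 < r) (hk : 1 ≤ k)
    (h : IsPrenormalized f k b) (hτ : conj τ = τ) (hp : ∀ j, IsPetalTranslation k φ τ j (p j))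
    (j : ℤ) : ∀ᶠ z in petalFilter k (-j), f (p (-j) z) = p j (f z) := by
  have hf := h.tendsto_petalFilter hk j
  have hc := hφ.eventually_conj hr hk h j
  refine hφ.eventually_eq hr hk h (hf.comp (hp (-j)).tendsto) ((hp j).tendsto.comp hf) ?_
  filter_upwards [hc, (hp (-j)).tendsto.eventually hc, (hp (-j)).translation,
    hf.eventually (hp j).translation] with z h1 h2 h3 h4
  rw [h2, h3, h4, h1, map_add, hτ]
  ring

/-- Agreement on the overlap j is pulled back by f: it intertwines the lifts of indices -j and j,
and its expression in the coordinates 1 - j and j - 1 can be solved for φ_{1-j}. -/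
lemma eventually_overlap_one_sub (hφ : IsFatouSystem f k b r R φ) (hr : 0 < r) (hk : 1 ≤ k)
    (h : IsPrenormalized f k b) (hτ : conj τ = τ) (hp : ∀ j, IsPetalTranslation k φ τ j (p j))
    {j : ℤ} (hj : ∀ᶠ z in overlapFilter k j, p (j - 1) z = p j z) :
    ∀ᶠ z in overlapFilter k (1 - j), p (1 - j - 1) z = p (1 - j) z := by
  have hf := tendsto_overlapFilter_neg hk h j
  have e : (1 : ℤ) - j - 1 = -j := by ring
  have e' : (1 : ℤ) - j = -(j - 1) := by ring
  have hneg : overlapFilter k (1 - j) ≤ petalFilter k (-j) := by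
    rw [← e]
    exact overlapFilter_le' k (1 - j)
  have ht : Tendsto (p (-j)) (overlapFilter k (1 - j)) (overlapFilter k (1 - j)) := by
    have := (hp (-j)).tendsto_overlap_succ
    rwa [show -j + 1 = 1 - j by ring] at this
  have hc : ∀ᶠ z in petalFilter k (1 - j), φ (j - 1) (f z) = conj (φ (1 - j) z) + 1 / 2 := by
    have := hφ.eventually_conj hr hk h (j - 1)
    rwa [← e'] at this
  rw [e]
  refine hφ.eventually_eq hr hk h (j := 1 - j) (ht.mono_right (overlapFilter_le k _))
    ((hp _).tendsto_overlap.mono_right (overlapFilter_le k _)) ?_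
  filter_upwards [hf.eventually hj,
    hneg (hφ.eventually_apply_petalTranslation hr hk h hτ hp j),
    ht.eventually (overlapFilter_le k _ hc), overlapFilter_le k _ hc,
    overlapFilter_le k _ (hp (1 - j)).translation,
    hf.eventually (overlapFilter_le' k _ (hp (j - 1)).translation)] with z h1 h2 h3 h4 h5 h6
  rw [h2, ← h1, h6, h4] at h3
  rw [h5]
  have := congrArg conj h3
  simp only [map_add, Complex.conj_conj, hτ] at this
  linear_combination -this

/-- The invariant has only k components for 2k overlaps. They give the indices 1, …, k, the symmetry
j ↦ 1 - j gives 1 - k, …, 0, and together these represent all residues modulo 2k. -/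
theorem eventually_overlap (hφ : IsFatouSystem f k b r R φ) (hr : 0 < r) (hk : 1 ≤ k)
    (h : IsPrenormalized f k b) (hτ : conj τ = τ) (hp : ∀ j, IsPetalTranslation k φ τ j (p j))
    (hper : ∀ j m, p (j + m * (2 * k)) = p j) {Ψ : ℕ → ℂ → ℂ}
    (hΨ : IsTransitionOf f k b r R φ Ψ)
    (hc : ∀ j, 1 ≤ j → j ≤ k → CommutesWithTranslation j (Ψ j) τ) (j : ℤ) :
    ∀ᶠ z in overlapFilter k j, p (j - 1) z = p j z := by
  have hpos : ∀ i : ℤ, 1 ≤ i → i ≤ k → ∀ᶠ z in overlapFilter k i, p (i - 1) z = p i z := by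
    intro i hi1 hik
    lift i to ℕ using by omega
    exact hφ.eventually_overlap_of_transition hr hk h hp hΨ (by exact_mod_cast hi1)
      (by exact_mod_cast hik) (hc i (by exact_mod_cast hi1) (by exact_mod_cast hik))
  have hall : ∀ i : ℤ, 1 - k ≤ i → i ≤ k → ∀ᶠ z in overlapFilter k i, p (i - 1) z = p i z := by
    intro i hi hik
    by_cases h1 : 1 ≤ i
    · exact hpos i h1 hik
    · have := hφ.eventually_overlap_one_sub hr hk h hτ hp (hpos (1 - i) (by omega) (by omega))
      rwa [sub_sub_cancel] at this
  set i := (j + k - 1) % (2 * k) + 1 - k with hi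
  have e : j = i + (j + k - 1) / (2 * k) * (2 * k) := by
    have := Int.emod_add_ediv_mul (j + k - 1) (2 * k)
    omega
  have h0 := Int.emod_nonneg (j + k - 1) (show (2 * k : ℤ) ≠ 0 by omega)
  have h1 := Int.emod_lt_of_pos (j + k - 1) (show (0 : ℤ) < 2 * k by omega)
  have := hall i (by omega) (by omega)
  rw [e, add_sub_right_comm, hper, hper, overlapFilter, chart_periodic hk]
  exact this

/-- The lifts of a translation agree with a map defined on a punctured neighbourhood. -/
theorem exists_glue (hk : 1 ≤ k) (hper : ∀ j m, p (j + m * (2 * k)) = p j)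
    (hover : ∀ j, ∀ᶠ z in overlapFilter k j, p (j - 1) z = p j z) :
    ∃ P : ℂ → ℂ, P 0 = 0 ∧ ∀ j, ∀ᶠ z in petalFilter k j, P z = p j z := by
  classical
  have hex : ∀ z : ℂ, ∃ j : ℤ, z ≠ 0 → ∃ ζ : ℂ, ζ ≠ 0 ∧ 0 ≤ ζ.re ∧ chart k j ζ = z := by
    intro z
    by_cases hz : z = 0
    · exact ⟨0, fun h => absurd hz h⟩
    · obtain ⟨j, -, ζ, hζ⟩ := exists_chart_eq hk hz
      exact ⟨j, fun _ => ⟨ζ, hζ⟩⟩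
  choose J hJ using hex
  refine ⟨fun z => if z = 0 then 0 else p (J z) z, if_pos rfl, fun j => ?_⟩
  have hev : ∀ i, ∃ M : ℝ, ∀ ζ : ℂ, M ≤ ζ.im →
      p (i - 1) (chart k i ζ) = p i (chart k i ζ) := by
    intro i
    have h1 : ∀ᶠ ζ in comap Complex.im atTop, p (i - 1) (chart k i ζ) = p i (chart k i ζ) :=
      eventually_map.1 (hover i)
    rw [eventually_comap, eventually_atTop] at h1
    obtain ⟨M, hM⟩ := h1
    exact ⟨M, fun ζ hζ => hM _ hζ ζ rfl⟩
  obtain ⟨M₁, hM₁⟩ := hev j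
  obtain ⟨M₂, hM₂⟩ := hev (j + 1)
  rw [add_sub_cancel_right] at hM₂
  rw [eventually_petalFilter]
  filter_upwards [eventually_far_ge (max 1 (max M₁ M₂))] with ζ hζ
  obtain ⟨hζ1, hζ2⟩ := max_le_iff.1 hζ
  obtain ⟨hζ2, hζ3⟩ := max_le_iff.1 hζ2
  have hζ0 : ζ ≠ 0 := Complex.slitPlane_ne_zero (mem_slitPlane_of_rho_pos (by linarith))
  rw [if_neg chart_ne_zero]
  set i := J (chart k j ζ) with hi
  obtain ⟨ζ', h0, hre, heq⟩ := hJ (chart k j ζ) chart_ne_zero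
  rw [← hi] at heq
  have hpow : (sgn i : ℂ) * ζ' = sgn j * ζ := by
    rw [← powCoord_chart hk h0, ← powCoord_chart hk hζ0, heq]
  -- Both chart coordinates come from the same value of -1/(k z^k), so they agree up to sign. Equal
  -- signs mean the same index modulo 2k. Opposite signs mean Re ζ ≤ 0, so that the point lies deep
  -- in one of the two adjacent overlaps, where neighbouring lifts coincide.
  have hcase : ζ' = ζ ∨ ζ' = -ζ := by
    rcases Int.even_or_odd i with h1 | h1 <;> rcases Int.even_or_odd j with h2 | h2 <;>
      simp only [sgn_of_even, sgn_of_odd, h1, h2] at hpow <;> push_cast at hpow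
    · left; linear_combination -hpow
    · right; linear_combination -hpow
    · right; linear_combination hpow
    · left; linear_combination hpow
  rcases hcase with rfl | rfl
  · obtain ⟨m, hm⟩ := exists_eq_add_of_chart_eq hk heq
    rw [hm, hper]
  · have hre' : ζ.re ≤ 0 := by simpa using hre
    have him : rho ζ = |ζ.im| := by
      refine max_eq_right ?_
      exact hre'.trans (abs_nonneg _)
    rw [him] at hζ1 hζ2 hζ3
    rcases lt_or_ge 0 ζ.im with hpos | hneg
    · rw [abs_of_pos hpos] at hζ2
      rw [← hM₁ ζ hζ2]
      obtain ⟨m, hm⟩ := exists_eq_add_of_chart_eq hk (heq.trans (chart_sub_one hpos).symm)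
      rw [hm, hper]
    · rw [abs_of_nonpos hneg] at hζ1 hζ3
      have hpos : 0 < (-ζ).im := by rw [Complex.neg_im]; linarith
      have e := chart_sub_one (k := k) (j := j + 1) hpos
      rw [add_sub_cancel_right, neg_neg] at e
      rw [e, hM₂ (-ζ) (by rwa [Complex.neg_im])]
      obtain ⟨m, hm⟩ := exists_eq_add_of_chart_eq hk (heq.trans e)
      rw [hm, hper]

end Glue

/-- The glued map is holomorphic on a punctured neighbourhood, since the petals cover it, and it
tends to 0 along each petal filter; the singularity at 0 is removable. -/
theorem exists_analyticAt_translation (hφ : IsFatouSystem f k b r R φ) (hr : 0 < r) (hk : 1 ≤ k)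
    (h : IsPrenormalized f k b) {τ : ℂ} (hτ : conj τ = τ) {Ψ : ℕ → ℂ → ℂ}
    (hΨ : IsTransitionOf f k b r R φ Ψ)
    (hc : ∀ j, 1 ≤ j → j ≤ k → CommutesWithTranslation j (Ψ j) τ) :
    ∃ P : ℂ → ℂ, P 0 = 0 ∧ AnalyticAt ℂ P 0 ∧
      (∀ j, Tendsto P (petalFilter k j) (petalFilter k j)) ∧
      ∀ j, ∀ᶠ z in petalFilter k j, φ j (P z) = φ j z + τ := by
  obtain ⟨p, hp, hper⟩ := hφ.exists_periodic_isPetalTranslation hr hk h τ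
  obtain ⟨P, hP0, hP⟩ := exists_glue hk hper (hφ.eventually_overlap hr hk h hτ hp hper hΨ hc)
  have hlim : ∀ j, Tendsto P (petalFilter k j) (petalFilter k j) := fun j =>
    (hp j).tendsto.congr' ((hP j).mono fun z hz => hz.symm)
  refine ⟨P, hP0, ?_, hlim, fun j => ?_⟩
  · refine Complex.analyticAt_of_differentiable_on_punctured_nhds_of_continuousAt ?_ ?_
    · refine eventually_nhdsNE_of_petalFilter hk fun j => ?_
      filter_upwards [eventually_eventually_nhds_petalFilter hk (hP j), (hp j).differentiable]
        with z h1 h2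
      exact h2.congr_of_eventuallyEq h1
    · rw [← continuousWithinAt_compl_self, ContinuousWithinAt, hP0]
      intro s hs
      exact eventually_nhdsNE_of_petalFilter hk fun j =>
        (hlim j).eventually (petalFilter_le_nhds hk j hs)
  · filter_upwards [hP j, (hp j).translation] with z h1 h2
    rw [h1, h2]

end IsFatouSystem

/-! ### Construction of the root -/

lemma tendsto_add_const_endFilter (j : ℕ) (c : ℂ) :
    Tendsto (fun W => W + c) (endFilter j) (endFilter j) := by
  unfold endFilter
  split_ifs
  · simpa using tendsto_sub_const_comap lipschitzWith_im (-c)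
  · rw [comap_im_atBot]
    simpa using tendsto_sub_const_comap lipschitzWith_neg_im (-c)

lemma CommutesWithTranslation.neg {j : ℕ} {ψ : ℂ → ℂ} {c : ℂ}
    (h : CommutesWithTranslation j ψ c) : CommutesWithTranslation j ψ (-c) := by
  filter_upwards [(tendsto_add_const_endFilter j (-c)).eventually h] with W hW
  rw [neg_add_cancel_right] at hW
  rw [hW, add_neg_cancel_right]

lemma CommutesWithTranslation.nat_mul {j : ℕ} {ψ : ℂ → ℂ} {c : ℂ}
    (h : CommutesWithTranslation j ψ c) (m : ℕ) : CommutesWithTranslation j ψ (m * c) := by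
  induction m with
  | zero => exact Eventually.of_forall fun W => by simp
  | succ m ih =>
    filter_upwards [ih, (tendsto_add_const_endFilter j (m * c)).eventually h] with W h1 h2
    rw [Nat.cast_succ, add_mul, one_mul, ← add_assoc, h2, h1, add_assoc]

/-- A germ of which the transition functions commute with `T_{1/n}` has an `n`-th root. -/
theorem IsFatouSystem.exists_isRoot {f : ℂ → ℂ} {k n : ℕ} {b r R : ℝ} {φ : ℤ → ℂ → ℂ}
    (hφ : IsFatouSystem f k b r R φ) (hr : 0 < r) (hk : 1 ≤ k) (h : IsPrenormalized f k b)
    (hn : Odd n) {Ψ : ℕ → ℂ → ℂ} (hΨ : IsTransitionOf f k b r R φ Ψ)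
    (hc : ∀ j, 1 ≤ j → j ≤ k → CommutesWithTranslation j (Ψ j) (1 / n)) :
    ∃ q, IsRoot n f q := by
  obtain ⟨m, rfl⟩ := hn
  have hn0 : ((2 * m + 1 : ℕ) : ℂ) ≠ 0 := Nat.cast_ne_zero.2 (by omega)
  -- The value for which 1/2 + τ = 1/(2n) with n = 2m + 1. It is -m times 1/n, so commutation with
  -- T_{1/n} implies commutation with T_τ.
  set τ : ℂ := -(m * (1 / (2 * m + 1 : ℕ))) with hτ
  have hτ' : conj τ = τ := by
    rw [hτ, map_neg, map_mul, map_div₀, map_one, map_natCast, map_natCast]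
  obtain ⟨P, hP0, hPa, hPt, hPφ⟩ := hφ.exists_analyticAt_translation hr hk h hτ' hΨ
    fun j hj1 hjk => ((hc j hj1 hjk).nat_mul m).neg
  set q : ℂ → ℂ := fun z => f (P z) with hq
  have hq0 : q 0 = 0 := by simp only [hq, hP0, h.1.1]
  have hqt : ∀ j, Tendsto q (petalFilter k (-j)) (petalFilter k j) := fun j =>
    (h.tendsto_petalFilter hk j).comp (hPt (-j))
  have hqt' : ∀ j, Tendsto q (petalFilter k j) (petalFilter k (-j)) := fun j => by
    simpa using hqt (-j)
  have hqφ : ∀ j, ∀ᶠ z in petalFilter k (-j), φ j (q z) = conj (φ (-j) z) + (1 / 2 + τ) := by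
    intro j
    filter_upwards [(hPt (-j)).eventually (hφ.eventually_conj hr hk h j), hPφ (-j)] with z h1 h2
    simp only [hq]
    rw [h1, h2, map_add, hτ']
    ring
  have hqq : ∀ j, ∀ᶠ z in petalFilter k j, φ j (q (q z)) = φ j z + 2 * (1 / 2 + τ) := by
    intro j
    have h1 := hqφ (-j)
    rw [neg_neg] at h1
    filter_upwards [h1, (hqt' j).eventually (hqφ j)] with z h1 h2
    rw [h2, h1]
    simp only [map_add, Complex.conj_conj, hτ', map_div₀, map_one, map_ofNat]
    ring
  have hit : ∀ j (l : ℕ), Tendsto (q ∘ q)^[l] (petalFilter k j) (petalFilter k j) ∧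
      ∀ᶠ z in petalFilter k j, φ j ((q ∘ q)^[l] z) = φ j z + l * (2 * (1 / 2 + τ)) := by
    intro j l
    induction l with
    | zero => exact ⟨tendsto_id, Eventually.of_forall fun z => by simp⟩
    | succ l ih =>
      rw [Function.iterate_succ']
      refine ⟨((hqt j).comp (hqt' j)).comp ih.1, ?_⟩
      filter_upwards [ih.2, ih.1.eventually (hqq j)] with z h1 h2
      simp only [Function.comp] at *
      rw [h2, h1]
      push_cast
      ring
  -- The square q ∘ q is T_{1/n}, so the n-th iterate is Σ ∘ T_{1/(2n)} after T_{m/n}, which is Σ ∘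
  -- T_{1/2}, the expression of f.
  have hodd : q^[2 * m + 1] = q ∘ (q ∘ q)^[m] := by
    rw [Function.iterate_succ', Function.iterate_mul]
    rfl
  refine ⟨q, ⟨hq0, ?_⟩, ?_⟩
  · have h1 := AnalyticAt.conj_conj hPa
    have h2 : AnalyticAt ℂ (fun z => f (conj z)) (conj (P (conj 0))) := by
      simpa [hP0] using h.1.2
    have := AnalyticAt.comp (g := fun z => f (conj z)) (f := fun z => conj (P (conj z))) h2 h1
    refine this.congr (Eventually.of_forall fun z => ?_)
    simp [hq]
  · have hne : ∀ᶠ z in 𝓝[≠] (0 : ℂ), q^[2 * m + 1] z = f z := by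
      refine eventually_nhdsNE_of_petalFilter hk fun j => ?_
      have hj := hit j m
      have hf := h.tendsto_petalFilter hk (-j)
      have hcf := hφ.eventually_conj hr hk h (-j)
      have hcq := hqφ (-j)
      rw [neg_neg] at hf hcf hcq
      refine hφ.eventually_eq hr hk h (j := -j) (hodd ▸ (hqt' j).comp hj.1) hf ?_
      filter_upwards [hj.2, hj.1.eventually hcq, hcf] with z h1 h2 h3
      rw [hodd, Function.comp, h2, h1, h3]
      have e : 2 * (1 / 2 + τ) = 1 / (2 * m + 1 : ℕ) := by
        rw [hτ]
        field_simp
        push_cast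
        ring
      have e2 : (m : ℂ) * (1 / (2 * m + 1 : ℕ)) = -τ := by rw [hτ, neg_neg]
      rw [e, e2, map_add, map_neg, hτ']
      ring
    rw [eventually_nhdsWithin_iff] at hne
    filter_upwards [hne] with z hz
    by_cases hz0 : z = 0
    · rw [hz0, Function.iterate_fixed hq0, h.1.1]
    · exact hz hz0

/-! ### The root criterion depends only on the analytic class and on the modulus -/

lemma tendsto_conj_endFilter {i j : ℕ} (hij : Odd j ↔ ¬ Odd i) :
    Tendsto (conj : ℂ → ℂ) (endFilter j) (endFilter i) := by
  unfold endFilter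
  by_cases hi : Odd i
  · rw [if_pos hi, if_neg fun h => hij.1 h hi]
    exact tendsto_conj_down
  · rw [if_neg hi, if_pos (hij.2 hi)]
    exact tendsto_conj_up

namespace CommutesWithTranslation

variable {i j : ℕ} {ψ ψ' : ℂ → ℂ} {c : ℂ}

lemma translate (h : CommutesWithTranslation j ψ c) (a d : ℂ)
    (hψ : ∀ᶠ W in endFilter j, ψ' W = ψ (W + a) + d) : CommutesWithTranslation j ψ' c := by
  filter_upwards [hψ, (tendsto_add_const_endFilter j c).eventually hψ,
    (tendsto_add_const_endFilter j a).eventually h] with W h1 h2 h3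
  rw [h2, add_right_comm, h3, h1]
  ring

/-- Conjugation commutes with real translations and exchanges the two ends, hence the condition of
opposite parity on the indices. -/
lemma conj_translate (h : CommutesWithTranslation i ψ c) (hc : conj c = c) (hij : Odd j ↔ ¬ Odd i)
    (a d : ℂ) (hψ : ∀ᶠ W in endFilter j, ψ' W = conj (ψ (conj (W + a)) + d)) :
    CommutesWithTranslation j ψ' c := by
  filter_upwards [hψ, (tendsto_add_const_endFilter j c).eventually hψ,
    ((tendsto_conj_endFilter hij).comp (tendsto_add_const_endFilter j a)).eventually h]
    with W h1 h2 h3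
  rw [Function.comp] at h3
  rw [h2, add_right_comm, map_add conj (W + a), hc, h3, h1]
  simp only [map_add, hc]
  ring

end CommutesWithTranslation

/-- Both relations conjugate or reflect the tuple by maps commuting with real translations. For k
even, j ↦ k + 1 - j changes parity, as the reflection requires, and is an involution, so the
converse has the same form with the shifts reversed. -/
lemma ModulusRel.commutes_iff {k : ℕ} {Ψ Ψ' : ℕ → ℂ → ℂ} (h : ModulusRel k Ψ Ψ') {c : ℂ}
    (hc : conj c = c) :
    (∀ j, 1 ≤ j → j ≤ k → CommutesWithTranslation j (Ψ j) c) ↔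
      ∀ j, 1 ≤ j → j ≤ k → CommutesWithTranslation j (Ψ' j) c := by
  rcases h with ⟨C, h⟩ | ⟨hk, h⟩
  · refine ⟨fun H j hj1 hjk => (H j hj1 hjk).translate C (-C) ?_,
      fun H j hj1 hjk => (H j hj1 hjk).translate (-C) C (h j hj1 hjk)⟩
    filter_upwards [(tendsto_add_const_endFilter j C).eventually (h j hj1 hjk)] with W hW
    rw [hW]
    ring_nf
  · have hodd : ∀ j, j ≤ k → (Odd j ↔ ¬ Odd (k + 1 - j)) := by
      intro j hj
      rw [Nat.not_odd_iff_even, Nat.even_sub (by omega)]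
      simp [Nat.even_add_one, hk]
    refine ⟨fun H j hj1 hjk => (H (k + 1 - j) (by omega) (by omega)).conj_translate hc
      (hodd j hjk) (-(1 / 2)) (1 / 2) (h j hj1 hjk),
      fun H j hj1 hjk => (H (k + 1 - j) (by omega) (by omega)).conj_translate hc
      (hodd j hjk) (1 / 2) (-(1 / 2)) ?_⟩
    have h1 := h (k + 1 - j) (by omega) (by omega)
    have e : k + 1 - (k + 1 - j) = j := by omega
    rw [e] at h1
    filter_upwards [((tendsto_conj_endFilter (hodd j hjk)).comp
      (tendsto_add_const_endFilter j (1 / 2))).eventually h1] with W hW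
    rw [Function.comp] at hW
    have e' : conj (conj (W + 1 / 2) - 1 / 2) = W := by
      simp [map_ofNat]
    rw [e'] at hW
    rw [hW]
    simp [map_ofNat]

lemma commutes_iff_of_eqvGen {k : ℕ} {Ψ Ψ' : ℕ → ℂ → ℂ}
    (h : Relation.EqvGen (ModulusRel k) Ψ Ψ') {c : ℂ} (hc : conj c = c) :
    (∀ j, 1 ≤ j → j ≤ k → CommutesWithTranslation j (Ψ j) c) ↔
      ∀ j, 1 ≤ j → j ≤ k → CommutesWithTranslation j (Ψ' j) c := by
  induction h with
  | rel _ _ h => exact h.commutes_iff hc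
  | refl _ => exact Iff.rfl
  | symm _ _ _ ih => exact ih.symm
  | trans _ _ _ _ _ ih ih' => exact ih.trans ih'

/-- Roots are carried over by holomorphic changes of coordinate. -/
lemma IsRoot.conjugate {f f' h H K : ℂ → ℂ} {n : ℕ} (hh : IsRoot n f h)
    (hH : AnalyticAt ℂ H 0) (hH0 : H 0 = 0) (hK : AnalyticAt ℂ K 0) (hK0 : K 0 = 0)
    (hKH : ∀ᶠ z in 𝓝 0, K (H z) = z) (hHK : ∀ᶠ z in 𝓝 0, H (K z) = z)
    (hconj : ∀ᶠ z in 𝓝 0, H (f z) = f' (H z)) : IsRoot n f' fun z => H (h (K z)) := by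
  have hKt : Tendsto K (𝓝 0) (𝓝 0) := by simpa [hK0] using hK.continuousAt.tendsto
  refine ⟨⟨by simp only [hK0, hh.1.1, hH0], ?_⟩, ?_⟩
  · have h1 := AnalyticAt.conj_conj hK
    have h2 : AnalyticAt ℂ (fun z => h (conj z)) (conj (K (conj 0))) := by
      simpa [hK0] using hh.1.2
    have h3 := AnalyticAt.comp (g := fun z => h (conj z)) (f := fun z => conj (K (conj z))) h2 h1
    have h4 : AnalyticAt ℂ H (((fun z => h (conj z)) ∘ fun z => conj (K (conj z))) 0) := by
      simpa [hK0, hh.1.1] using hH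
    refine (h4.comp h3).congr (Eventually.of_forall fun z => ?_)
    simp
  · have hit : ∀ m : ℕ, Tendsto (fun z => h^[m] (K z)) (𝓝 0) (𝓝 0) ∧
        ∀ᶠ z in 𝓝 0, (fun z => H (h (K z)))^[m] z = H (h^[m] (K z)) := by
      intro m
      induction m with
      | zero => exact ⟨hKt, hHK.mono fun z hz => hz.symm⟩
      | succ m ih =>
        refine ⟨(hh.1.tendsto.comp ih.1).congr fun z =>
          (Function.iterate_succ_apply' h m (K z)).symm, ?_⟩
        filter_upwards [ih.2, ih.1.eventually hKH] with z h1 h2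
        rw [Function.iterate_succ_apply', h1, h2, Function.iterate_succ_apply']
    filter_upwards [(hit n).2, hKt.eventually hh.2, hKt.eventually hconj, hHK] with z h1 h2 h3 h4
    rw [h1, h2, h3, h4]

lemma AnalyticallyConjugate.exists_isRoot_iff {f f' : ℂ → ℂ} (h : AnalyticallyConjugate f f')
    (hf : IsAntiholGerm f) (n : ℕ) : (∃ q, IsRoot n f q) ↔ ∃ q, IsRoot n f' q := by
  obtain ⟨H, hH, hH0, hH', hconj⟩ := h
  have hst : HasStrictDerivAt H (deriv H 0) 0 := hH.hasStrictDerivAt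
  obtain ⟨K, hK, hKH, hHK⟩ : ∃ K, AnalyticAt ℂ K 0 ∧ (∀ᶠ z in 𝓝 0, K (H z) = z) ∧
      ∀ᶠ z in 𝓝 0, H (K z) = z := by
    refine ⟨hst.localInverse H _ 0 hH', ?_, hst.eventually_left_inverse hH', ?_⟩
    · have := hH.analyticAt_localInverse hH'
      rwa [hH0] at this
    · have := hst.eventually_right_inverse hH'
      rwa [hH0] at this
  have hK0 : K 0 = 0 := by
    have := hKH.self_of_nhds
    rwa [hH0] at this
  have hKt : Tendsto K (𝓝 0) (𝓝 0) := by simpa [hK0] using hK.continuousAt.tendsto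
  refine ⟨fun ⟨q, hq⟩ => ⟨_, hq.conjugate hH hH0 hK hK0 hKH hHK hconj⟩,
    fun ⟨q, hq⟩ => ⟨_, hq.conjugate hK hK0 hH hH0 hHK hKH ?_⟩⟩
  filter_upwards [hKt.eventually hconj, hHK, (hf.tendsto.comp hKt).eventually hKH] with z h1 h2 h3
  rw [← h2, ← h1, h2]
  exact h3

/-- Roots are transported to the prenormalizing coordinate, where both implications hold for the
given Fatou system. The constant terms of the transition functions play no role in commutation with
a translation. -/
theorem IsNormalizedTransition.exists_isRoot_iff {f : ℂ → ℂ} {k n : ℕ} {b : ℝ} {Ψ : ℕ → ℂ → ℂ}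
    (h : IsNormalizedTransition f k b Ψ) (hf : IsAntiholGerm f) (hk : 1 ≤ k) (hn : Odd n) :
    (∃ q, IsRoot n f q) ↔
      ∀ j, 1 ≤ j → j ≤ k → CommutesWithTranslation j (Ψ j) (1 / n) := by
  obtain ⟨f', hff', hf', r, hr, R, -, φ, hφ, hΨ, -⟩ := h
  rw [hff'.exists_isRoot_iff hf]
  exact ⟨fun ⟨q, hq⟩ j hj1 hjk =>
    hφ.commutesWithTranslation_of_isRoot hr hk hn.pos.ne' hf' hq hΨ hj1 hjk,
    hφ.exists_isRoot hr hk hf' hn hΨ⟩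

end AntiholParabolic

end

theorem mainTheorem4 (f : ℂ → ℂ) (k : ℕ) (hf : AntiholParabolic.IsParabolic f)
    (hk : AntiholParabolic.HasCodim f k)
    (htype : Even k → AntiholParabolic.IsPositiveType f k)
    (n : ℕ) (hn : 3 ≤ n) (hodd : Odd n) :
    (∃! P : PowerSeries ℂ, AntiholParabolic.IsFormalRoot n f P) ∧
      ∀ (b : ℝ) (Ψ : ℕ → ℂ → ℂ), AntiholParabolic.IsModulus f k b Ψ →
        ((∃ h : ℂ → ℂ, AntiholParabolic.IsRoot n f h) ↔
          ∀ j : ℕ, 1 ≤ j → j ≤ k →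
            AntiholParabolic.CommutesWithTranslation j (Ψ j) (1 / (n : ℂ))) := by
  refine ⟨AntiholParabolic.existsUnique_isFormalRoot hf hodd, fun b Ψ hΨ => ?_⟩
  obtain ⟨Ψ₀, h, hrel⟩ := hΨ
  rw [h.exists_isRoot_iff hf.1 hk.1 hodd]
  exact AntiholParabolic.commutes_iff_of_eqvGen hrel (by simp)
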